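/- **Lemma (estimating operators).** *Setting.* Let $\mathcal O=\{1,\dots,O\}$ and $T\ge 1$. A distribution $\Pr$ over sequences in $\mathcal O^T$ is given through its conditionals: a probability vector $\Pr[\cdot\mid h]$ on $\mathcal O$ for every history $h$ (also for histories of probability $0$), with $\Pr[f\mid h]=\prod_i\Pr[f_i\mid hf_1\cdots f_{i-1}]$. It has rank $r$ if for each $1\le t\le T$ the matrix $(\Pr[f\mid h])_{f\in\mathcal O^{\le T-t},\,h\in\mathcal O^t}$ has rank at most $r$. The conditional sampling oracle, queried with $h\in\mathcal O^t$, $t\le T$, returns a fresh $f\in\mathcal O^{T-t}$ with probability $\Pr[f\mid h]$. Put $F_t=\mathcal O^{T-t}$. For a finite family $B_t$ of elements of $\mathcal O^t$ (repetitions allowed), let $d_t(f)=\frac1{|B_t|}\sum_{b\in B_t}\Pr[f\mid b]$, $D_t=\mathrm{diag}(d_t)$, and $$\Sigma_t=\Pr[F_t\mid B_t]^\top D_t^{-1}\Pr[F_t\mid B_t],$$ where futures with $d_t(f)=0$ are omitted. The $B_t$ are *bases* if for $1\le t\le T$ every column $\Pr[F_t\mid x]$, $x\in\mathcal O^t$,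 lies in the column span of $\Pr[F_t\mid B_t]$; they are *$\Delta$-robust* if moreover every nonzero eigenvalue of $\Sigma_t$, $1\le t\le T$, is at least $\Delta$. Then $\beta(x)$ denotes the unique vector in $(\ker\Sigma_t)^\perp$ with $\Pr[F_t\mid B_t]\,\beta(x)=\Pr[F_t\mid x]$; $\beta(B_t)$ is the matrix with columns $\beta(b)$, $b\in B_t$; and for $o\in\mathcal O$, $0\le t<T$ and $B_t=\{b_1,\dots,b_{m}\}$, $$A_{o,t}=\big[\beta(b_1o)\ \cdots\ \beta(b_{m}o)\big]\,\mathrm{diag}\big(\Pr[o\mid b_1],\dots,\Pr[o\mid b_{m}]\big).$$ *Claim.* There are a single randomized algorithm with access to the conditional sampling oracle (its only source of randomness; exact real arithmetic at unit cost, and $T+1$ steps for each oracle call), and absolute constants $C,k$, such that the following holds for all $\Delta>0$, $\varepsilon,\delta\in(0,1)$, $c\le 1$, $r,n$, every distribution $\Pr$ of rank $r$, and all $\Delta$-robust bases $\{B_t\}_{1\le t\le T}$, together with a family $B_0$ of copies of the empty sequence, such that $|B_t|\le n$ for $0\le t\le T$ and $\|\beta(x)\|_2\le c$ for all $x\in\mathcal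 O^t$, $1\le t\le T$. Given $T,O,r,n,\Delta,\varepsilon,\delta,c$ and $B_0,\dots,B_T$, the algorithm always halts after at most $$C\Big(r+O+T+n+\tfrac1\varepsilon+\tfrac1\Delta+\log\tfrac1\delta\Big)^k$$ steps, uses at most $$C\,\frac{c^8r^3n^{21}O^3T^5}{\Delta^6\varepsilon^6}\Big(1+\log\tfrac1\delta\Big)^2\log^k\!\Big(2+r+O+T+n+\tfrac1\varepsilon+\tfrac1\Delta+\log\tfrac1\delta\Big)$$ conditional samples, and outputs matrices $\widehat A_{o,t}$ ($o\in\mathcal O$, $0\le t<T$) such that, with probability at least $1-\delta$, simultaneously for all $o$, all $0\le t<T$, every matrix $V_{t+1}^\perp$ whose columns form an orthonormal basis of $\ker\Sigma_{t+1}$, and every vector $v$, there are vectors $\alpha,\alpha^\perp$ with $$(\widehat A_{o,t}-A_{o,t})v=\beta(B_{t+1})\,\alpha+V_{t+1}^\perp\,\alpha^\perp,\qquad \|\alpha\|_1,\ \|\alpha^\perp\|_1\le\varepsilon\|v\|_2 .$$ (In particular both norms are at most $\varepsilon$ for unit vectors $v$.) -/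

import Mathlib

namespace CondSampling

noncomputable section

/-! ### Sequence distributions and the conditional sampling oracle -/

/-- A distribution over observation sequences, given by its one-step conditionals:
`p h o` is `Pr[o | h]`, for every history `h` (also for histories of probability zero).
With horizon `T` only histories of length `< T` are ever used. -/
abbrev SeqDist (O : ℕ) : Type := List (Fin O) → PMF (Fin O)

/-- `Pr[f | h]`, by the chain rule. -/
def condProb {O : ℕ} (p : SeqDist O) : List (Fin O) → List (Fin O) → ℝ
  | _, [] => 1
  | h, o :: f => (p h o).toReal * condProb p (h ++ [o]) f

/-- The law of the next `k` observations after the history `h`. -/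
def condSample {O : ℕ} (p : SeqDist O) : ℕ → List (Fin O) → PMF (List (Fin O))
  | 0, _ => PMF.pure []
  | k + 1, h => (p h).bind fun o => (condSample p k (h ++ [o])).map fun f => o :: f

theorem condProb_nonneg {O : ℕ} (p : SeqDist O) (f h : List (Fin O)) : 0 ≤ condProb p h f := by
  induction f generalizing h with
  | nil => simp [condProb]
  | cons o f ih => exact mul_nonneg ENNReal.toReal_nonneg (ih _)

/-- The sampler returns `f` with probability `Pr[f | h]`. -/
theorem condSample_apply {O : ℕ} (p : SeqDist O) (f h : List (Fin O)) :
    (condSample p f.length h f).toReal = condProb p h f := by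
  classical
  induction f generalizing h with
  | nil => simp [condSample, condProb]
  | cons o f ih =>
    simp only [condSample, condProb, List.length_cons, PMF.bind_apply]
    rw [tsum_eq_single o]
    · rw [ENNReal.toReal_mul, PMF.map_apply, tsum_eq_single f]
      · simp [ih]
      · intro g hg
        simp [Ne.symm hg]
    · intro o' ho'
      rw [PMF.map_apply]
      simp [Ne.symm ho']

/-- The conditional sampling oracle with horizon `T`, on observations coded as `0, …, O - 1`:
for a history of length `t ≤ T` it returns a future of length `T - t` drawn from `Pr[· | h]`
(and the empty list if the query is not a history of length at most `T`). -/
def oracle {O : ℕ} (p : SeqDist O) (T : ℕ) (h : List ℕ) : PMF (List ℕ) :=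
  if (∀ x ∈ h, x < O) ∧ h.length ≤ T then
    (condSample p (T - h.length)
      (h.filterMap fun x => if hx : x < O then some ⟨x, hx⟩ else none)).map (List.map Fin.val)
  else PMF.pure []

/-! ### Rank, bases, coefficients, operators -/

/-- Every matrix `Pr[𝒪^{≤ T-t} | 𝒪^t]`, `1 ≤ t ≤ T`, has rank at most `r`. -/
def HasRank {O : ℕ} (p : SeqDist O) (T r : ℕ) : Prop :=
  ∀ t, 1 ≤ t → t ≤ T →
    (Matrix.of fun (f : Σ k : Fin (T - t + 1), Fin k → Fin O) (h : Fin t → Fin O) =>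
      condProb p (List.ofFn h) (List.ofFn f.2)).rank ≤ r

/-- The matrix `Pr[F_t | B]`, where `F_t = 𝒪^{T-t}` and `B` is a finite family of histories of
length `t`. -/
def futureMat {O : ℕ} (p : SeqDist O) (T : ℕ) {t m : ℕ} (B : Fin m → Fin t → Fin O) :
    Matrix (Fin (T - t) → Fin O) (Fin m) ℝ :=
  Matrix.of fun f b => condProb p (List.ofFn (B b)) (List.ofFn f)

/-- The column `Pr[F_t | x]`. -/
def futureVec {O : ℕ} (p : SeqDist O) (T : ℕ) {t : ℕ} (x : Fin t → Fin O) :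
    (Fin (T - t) → Fin O) → ℝ :=
  fun f => condProb p (List.ofFn x) (List.ofFn f)

/-- The average `d_t(f)` of `Pr[f | b]` over the members of the family. -/
def avgProb {O : ℕ} (p : SeqDist O) (T : ℕ) {t m : ℕ} (B : Fin m → Fin t → Fin O)
    (f : Fin (T - t) → Fin O) : ℝ :=
  (1 / (m : ℝ)) * ∑ b, futureMat p T B f b

/-- `Pr[F_t | B]ᵀ D⁻¹ Pr[F_t | B]` with `D = diag(d_t)`.  Futures with `d_t(f) = 0` contribute
nothing, in accordance with `0⁻¹ = 0`. -/
def covMat {O : ℕ} (p : SeqDist O) (T : ℕ) {t m : ℕ} (B : Fin m → Fin t → Fin O) :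
    Matrix (Fin m) (Fin m) ℝ :=
  (futureMat p T B).transpose * Matrix.diagonal (fun f => (avgProb p T B f)⁻¹) * futureMat p T B

/-- `B` is a basis at length `t`: the columns `Pr[F_t | b]` span all the columns `Pr[F_t | x]`. -/
def IsBasisAt {O : ℕ} (p : SeqDist O) (T : ℕ) {t m : ℕ} (B : Fin m → Fin t → Fin O) : Prop :=
  ∀ x : Fin t → Fin O, ∃ β : Fin m → ℝ, (futureMat p T B).mulVec β = futureVec p T x

/-- `Δ`-robust bases: bases for which the smallest nonzero eigenvalue of `covMat` is at
least `Δ`, at every length `1 ≤ t ≤ T`. -/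
def RobustBases {O : ℕ} (p : SeqDist O) (T : ℕ) {m : ℕ → ℕ}
    (B : (t : ℕ) → Fin (m t) → Fin t → Fin O) (Δ : ℝ) : Prop :=
  ∀ t, 1 ≤ t → t ≤ T → IsBasisAt p T (B t) ∧
    ∀ μ : ℝ, Module.End.HasEigenvalue (Matrix.toLin' (covMat p T (B t))) μ → μ ≠ 0 → Δ ≤ μ

/-- `β` is a vector of coefficients of `x` in `B` that lies in `span V_t`, the sum of the
eigenspaces of `covMat` for nonzero eigenvalues, that is, the orthogonal complement of its
kernel. -/
def IsCoeff {O : ℕ} (p : SeqDist O) (T : ℕ) {t m : ℕ} (B : Fin m → Fin t → Fin O)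
    (x : Fin t → Fin O) (β : Fin m → ℝ) : Prop :=
  (futureMat p T B).mulVec β = futureVec p T x ∧
    ∀ w : Fin m → ℝ, (covMat p T B).mulVec w = 0 → w ⬝ᵥ β = 0

open Classical in
/-- The coefficients `β(x)` of the history `x` in the basis `B` (junk value `0` if `B` is not a
basis). -/
def coeff {O : ℕ} (p : SeqDist O) (T : ℕ) {t m : ℕ} (B : Fin m → Fin t → Fin O)
    (x : Fin t → Fin O) : Fin m → ℝ :=
  if h : ∃ β, IsCoeff p T B x β then h.choose else 0

/-- The matrix `β(B)` with columns `β(b)`, `b ∈ B`. -/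
def coeffMat {O : ℕ} (p : SeqDist O) (T : ℕ) {t m : ℕ} (B : Fin m → Fin t → Fin O) :
    Matrix (Fin m) (Fin m) ℝ :=
  Matrix.of fun i b => coeff p T B (B b) i

/-- The operator `A_{o,t} = [β(b₁ o) ⋯ β(bₙ o)] diag(Pr[o | b₁], …, Pr[o | bₙ])`, from the family
`B` at length `t` to the family `B'` at length `t + 1`. -/
def opMat {O : ℕ} (p : SeqDist O) (T : ℕ) {t m m' : ℕ} (B : Fin m → Fin t → Fin O)
    (B' : Fin m' → Fin (t + 1) → Fin O) (o : Fin O) : Matrix (Fin m') (Fin m) ℝ :=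
  Matrix.of fun i b =>
    coeff p T B' (Fin.snoc (α := fun _ => Fin O) (B b) o) i * (p (List.ofFn (B b)) o).toReal

/-- The columns of `W` are an orthonormal basis of the kernel of `M`. -/
def IsKerONB {m k : ℕ} (M : Matrix (Fin m) (Fin m) ℝ) (W : Matrix (Fin m) (Fin k) ℝ) : Prop :=
  W.transpose * W = 1 ∧ LinearMap.range W.mulVecLin = LinearMap.ker M.mulVecLin

/-! The coefficients exist and are unique. -/

theorem futureMat_mulVec_eq_zero {O : ℕ} (p : SeqDist O) (T : ℕ) {t m : ℕ}
    (B : Fin m → Fin t → Fin O) {w : Fin m → ℝ} (hw : (covMat p T B).mulVec w = 0) :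
    (futureMat p T B).mulVec w = 0 := by
  set M := futureMat p T B with hM
  have hM0 : ∀ f b, 0 ≤ M f b := fun f b => condProb_nonneg p _ _
  have hd0 : ∀ f, 0 ≤ avgProb p T B f := fun f =>
    mul_nonneg (by positivity) (Finset.sum_nonneg fun b _ => hM0 f b)
  have h1 : ∑ f, (avgProb p T B f)⁻¹ * (M.mulVec w f) ^ 2 = 0 := by
    have h2 : w ⬝ᵥ (covMat p T B).mulVec w = 0 := by rw [hw]; simp
    rw [covMat, ← Matrix.mulVec_mulVec, ← Matrix.mulVec_mulVec, Matrix.dotProduct_mulVec,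
      Matrix.vecMul_transpose] at h2
    rw [← h2]
    refine Finset.sum_congr rfl fun f _ => ?_
    rw [Matrix.mulVec_diagonal]
    ring
  rw [Finset.sum_eq_zero_iff_of_nonneg
    (fun f _ => mul_nonneg (inv_nonneg.2 (hd0 f)) (sq_nonneg _))] at h1
  funext f
  rcases mul_eq_zero.1 (h1 f (Finset.mem_univ f)) with h | h
  · have h3 : avgProb p T B f = 0 := inv_eq_zero.1 h
    have h4 : ∀ b, M f b = 0 := by
      intro b
      have hm : (1 / (m : ℝ)) ≠ 0 := by
        have : 0 < m := Fin.pos b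
        positivity
      have h5 := (mul_eq_zero.1 h3).resolve_left hm
      exact (Finset.sum_eq_zero_iff_of_nonneg (fun b _ => hM0 f b)).1 h5 b (Finset.mem_univ b)
    simp [Matrix.mulVec, dotProduct, h4]
  · simpa using h

theorem existsUnique_isCoeff {O : ℕ} (p : SeqDist O) (T : ℕ) {t m : ℕ}
    {B : Fin m → Fin t → Fin O} (hB : IsBasisAt p T B) (x : Fin t → Fin O) :
    ∃! β, IsCoeff p T B x β := by
  obtain ⟨β', hβ'⟩ := hB x
  let K : Submodule ℝ (EuclideanSpace ℝ (Fin m)) :=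
    (LinearMap.ker (covMat p T B).mulVecLin).comap
      (WithLp.linearEquiv 2 ℝ (Fin m → ℝ)).toLinearMap
  have hK : ∀ v : EuclideanSpace ℝ (Fin m), v ∈ K ↔ (covMat p T B).mulVec v.ofLp = 0 :=
    fun v => Iff.rfl
  let b : EuclideanSpace ℝ (Fin m) := WithLp.toLp 2 β'
  obtain ⟨y, hy, z, hz, hyz⟩ := K.exists_add_mem_mem_orthogonal b
  have hb : β' = y.ofLp + z.ofLp := by
    have := congrArg WithLp.ofLp hyz
    simpa [b] using this
  refine ⟨z.ofLp, ⟨?_, ?_⟩, ?_⟩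
  · rw [← hβ', hb, Matrix.mulVec_add, futureMat_mulVec_eq_zero p T B ((hK y).1 hy), zero_add]
  · intro w hw
    have h := (Submodule.mem_orthogonal K z).1 hz (WithLp.toLp 2 w) ((hK _).2 hw)
    rw [EuclideanSpace.inner_eq_star_dotProduct] at h
    simpa [dotProduct_comm] using h
  · intro γ hγ
    have h1 : (futureMat p T B).mulVec (γ - z.ofLp) = 0 := by
      rw [Matrix.mulVec_sub, hγ.1, ← hβ', hb, Matrix.mulVec_add,
        futureMat_mulVec_eq_zero p T B ((hK y).1 hy), zero_add, sub_self]
    have h2 : (covMat p T B).mulVec (γ - z.ofLp) = 0 := by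
      rw [covMat, ← Matrix.mulVec_mulVec, h1, Matrix.mulVec_zero]
    have h3 := hγ.2 _ h2
    have h4 : (γ - z.ofLp) ⬝ᵥ z.ofLp = 0 := by
      have h := (Submodule.mem_orthogonal K z).1 hz (WithLp.toLp 2 (γ - z.ofLp)) ((hK _).2 h2)
      rw [EuclideanSpace.inner_eq_star_dotProduct] at h
      simpa [dotProduct_comm] using h
    have h5 : (γ - z.ofLp) ⬝ᵥ (γ - z.ofLp) = 0 := by
      rw [dotProduct_sub, h3, h4, sub_zero]
    exact sub_eq_zero.1 (dotProduct_self_eq_zero.1 h5)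

/-! ### The machine model

Programs of a small first-order language over natural numbers, exact real numbers, pairs and
linked lists: unit-cost exact real arithmetic and comparison (as on a real RAM, without rounding),
immutable data shared by reference, unrestricted `loop`s, and calls to the oracle. -/

/-- Data types. -/
inductive Ty : Type
  | nat : Ty
  | real : Ty
  | prod : Ty → Ty → Ty
  | list : Ty → Ty

/-- Values of a data type. -/
@[reducible] def Ty.Val : Ty → Type
  | .nat => ℕ
  | .real => ℝ
  | .prod a b => a.Val × b.Val
  | .list a => List a.Val

/-- Programs with input of type `a` and output of type `b`. -/
inductive Prog : Ty → Ty → Type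
  /-- return the input -/
  | id {a : Ty} : Prog a a
  /-- run the first program, then the second on its result -/
  | comp {a b c : Ty} : Prog a b → Prog b c → Prog a c
  /-- run both programs on the input and pair the results -/
  | pair {a b c : Ty} : Prog a b → Prog a c → Prog a (.prod b c)
  | fst {a b : Ty} : Prog (.prod a b) a
  | snd {a b : Ty} : Prog (.prod a b) b
  | natConst {a : Ty} : ℕ → Prog a .nat
  | natAdd : Prog (.prod .nat .nat) .nat
  /-- truncated subtraction -/
  | natSub : Prog (.prod .nat .nat) .nat
  | realOfNat : Prog .nat .real
  | realAdd : Prog (.prod .real .real) .real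
  | realSub : Prog (.prod .real .real) .real
  | realMul : Prog (.prod .real .real) .real
  /-- division, with result `0` for divisor `0` -/
  | realDiv : Prog (.prod .real .real) .real
  /-- comparison `x ≤ y`, with result `1` or `0` -/
  | realLe : Prog (.prod .real .real) .nat
  | nil {a b : Ty} : Prog a (.list b)
  | cons {b : Ty} : Prog (.prod b (.list b)) (.list b)
  /-- case distinction on a list: empty, or a head and a tail -/
  | listCase {a b c : Ty} : Prog a c → Prog (.prod a (.prod b (.list b))) c →
      Prog (.prod a (.list b)) c
  /-- conditional: the second program if the first returns nonzero, else the third -/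
  | cond {a b : Ty} : Prog a .nat → Prog a b → Prog a b → Prog a b
  /-- while loop: repeat the second program as long as the first returns nonzero -/
  | loop {a : Ty} : Prog a .nat → Prog a a → Prog a a
  /-- call of the conditional sampling oracle on a history -/
  | sample : Prog (.list .nat) (.list .nat)

/-- Outcomes of randomized computations: `some (x, time, samples)`, or `none` if a loop has used up
the fuel. -/
abbrev Comp (α : Type) : Type := PMF (Option (α × ℕ × ℕ))

/-- A computation with result `x` that takes `k` steps and no samples. -/
def Comp.ret {α : Type} (k : ℕ) (x : α) : Comp α := PMF.pure (some (x, k, 0))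

/-- Sequential composition; running times and numbers of samples add up. -/
def Comp.andThen {α β : Type} (m : Comp α) (g : α → Comp β) : Comp β :=
  m.bind fun
    | none => PMF.pure none
    | some (x, k, s) => (g x).map (Option.map fun y => (y.1, k + y.2.1, s + y.2.2))

/-- A while loop with at most `fuel` tests of the condition; each test costs one extra step. -/
def Comp.whileLoop {α : Type} (test : α → Comp ℕ) (body : α → Comp α) : ℕ → α → Comp α
  | 0, _ => PMF.pure none
  | fuel + 1, x => (test x).andThen fun c =>
      if c = 0 then Comp.ret 1 x
      else (Comp.ret 1 x).andThen fun x' => (body x').andThen (whileLoop test body fuel)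

open Classical in
/-- Execution of a program against the oracle of `p` with horizon `T`.  Each construct costs one
step in addition to its parts, and an oracle call costs `T + 1` steps and one sample.  The value of
`fuel` bounds the number of iterations of each loop. -/
def Prog.run {O : ℕ} (p : SeqDist O) (T fuel : ℕ) :
    {a b : Ty} → Prog a b → a.Val → Comp b.Val
  | _, _, .id, x => Comp.ret 1 x
  | _, _, .comp P Q, x => (P.run p T fuel x).andThen fun y =>
      (Q.run p T fuel y).andThen fun z => Comp.ret 1 z
  | _, _, .pair P Q, x => (P.run p T fuel x).andThen fun y =>
      (Q.run p T fuel x).andThen fun z => Comp.ret 1 (y, z)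
  | _, _, .fst, x => Comp.ret 1 x.1
  | _, _, .snd, x => Comp.ret 1 x.2
  | _, _, .natConst k, _ => Comp.ret (α := ℕ) 1 k
  | _, _, .natAdd, x => Comp.ret (α := ℕ) 1 (Nat.add x.1 x.2)
  | _, _, .natSub, x => Comp.ret (α := ℕ) 1 (Nat.sub x.1 x.2)
  | _, _, .realOfNat, x => Comp.ret (α := ℝ) 1 (Nat.cast (R := ℝ) x)
  | _, _, .realAdd, x => Comp.ret (α := ℝ) 1 ((x.1 : ℝ) + (x.2 : ℝ))
  | _, _, .realSub, x => Comp.ret (α := ℝ) 1 ((x.1 : ℝ) - (x.2 : ℝ))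
  | _, _, .realMul, x => Comp.ret (α := ℝ) 1 ((x.1 : ℝ) * (x.2 : ℝ))
  | _, _, .realDiv, x => Comp.ret (α := ℝ) 1 ((x.1 : ℝ) / (x.2 : ℝ))
  | _, _, .realLe, x => Comp.ret (α := ℕ) 1 (if (x.1 : ℝ) ≤ (x.2 : ℝ) then 1 else 0)
  | _, _, .nil, _ => Comp.ret 1 []
  | _, _, .cons, x => Comp.ret 1 (List.cons x.1 x.2)
  | _, _, .listCase P Q, x => (Comp.ret 1 x).andThen fun y =>
      match y.2 with
      | [] => P.run p T fuel y.1
      | z :: l => Q.run p T fuel (y.1, (z, l))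
  | _, _, .cond C P Q, x => (C.run p T fuel x).andThen fun (c : ℕ) =>
      (Comp.ret 1 x).andThen fun x' => if c = 0 then Q.run p T fuel x' else P.run p T fuel x'
  | _, _, .loop C P, x => Comp.whileLoop (C.run p T fuel) (P.run p T fuel) fuel x
  | _, _, .sample, h => (oracle p T h).map fun f => some (f, T + 1, 1)

/-- Input of the learner: `((T, |𝒪|), (r, n)), ((Δ, ε), (δ, c)), [B_0, …, B_T]`. -/
abbrev inputTy : Ty :=
  .prod (.prod (.prod .nat .nat) (.prod .nat .nat))
    (.prod (.prod (.prod .real .real) (.prod .real .real)) (.list (.list (.list .nat))))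

/-- Output of the learner: for each `t` and each `o`, the list of the rows of a matrix. -/
abbrev outputTy : Ty := .list (.list (.list (.list .real)))

/-- The histories `B_0, …, B_T` as lists of codes. -/
def encodeBases {O : ℕ} (T : ℕ) {m : ℕ → ℕ} (B : (t : ℕ) → Fin (m t) → Fin t → Fin O) :
    List (List (List ℕ)) :=
  (List.range (T + 1)).map fun t =>
    List.ofFn fun b : Fin (m t) => List.ofFn fun i : Fin t => (B t b i : ℕ)

/-- The input value of the learner. -/
def encodeInput {O : ℕ} (T r n : ℕ) (Δ ε δ c : ℝ) {m : ℕ → ℕ}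
    (B : (t : ℕ) → Fin (m t) → Fin t → Fin O) : inputTy.Val :=
  (((T, O), (r, n)), (((Δ, ε), (δ, c)), encodeBases T B))

/-- The matrix that the output lists for the pair `(o, t)` (missing entries count as `0`). -/
def readOp (out : List (List (List (List ℝ)))) (t o m' m : ℕ) : Matrix (Fin m') (Fin m) ℝ :=
  Matrix.of fun i j => (((out.getD t []).getD o []).getD i []).getD j 0

/-- The learned operators meet the error decomposition with accuracy `ε`, for every observation
`o`, every `t < T`, every vector `v`, and every choice of an orthonormal basis `W = V^⊥_{t+1}`. -/
def GoodOutput {O : ℕ} (p : SeqDist O) (T : ℕ) (ε : ℝ) {m : ℕ → ℕ}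
    (B : (t : ℕ) → Fin (m t) → Fin t → Fin O) (out : List (List (List (List ℝ)))) : Prop :=
  ∀ (o : Fin O) (t : ℕ), t < T →
    ∀ (k : ℕ) (W : Matrix (Fin (m (t + 1))) (Fin k) ℝ), IsKerONB (covMat p T (B (t + 1))) W →
    ∀ v : Fin (m t) → ℝ, ∃ (α : Fin (m (t + 1)) → ℝ) (αperp : Fin k → ℝ),
      (readOp out t o (m (t + 1)) (m t) - opMat p T (B t) (B (t + 1)) o).mulVec v =
        (coeffMat p T (B (t + 1))).mulVec α + W.mulVec αperp ∧
      ∑ i, |α i| ≤ ε * ‖WithLp.toLp 2 v‖ ∧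
      ∑ i, |αperp i| ≤ ε * ‖WithLp.toLp 2 v‖

end

end CondSampling

/-! Fix `t`, let `B'` be the basis at length `t + 1`, with `m'` members, and put `s(f) = ∑ Pr[f |
b']` and `q_{b'}(f) = Pr[f | b'] / s(f)`, the posterior of `b'` given the future `f`. Since `d = s /
m'`, the matrix `P = Σ / m'` (`postMat`) has entries `∑_f Pr[f | b] q_{b'}(f)`, and applying `P` to
the coefficients of `x` gives the vector `∑_f Pr[f | x] q_{b'}(f)`. Hence column `b` of `A_{o,t}` is
the solution orthogonal to `ker Σ` of `P X = R`, where `R_{b'b} = ∑_f Pr[o f | b] q_{b'}(f)`. Both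
`P` and `R` are expectations of `[0,1]`-valued functions of one sampled future, so they can be
estimated entrywise by means.

The posterior must itself be estimated. Each `Pr[f | b']` is a product of one-step conditionals,
each estimated from `N` fresh samples. The product is unbiased, and its `ℓ¹` error over all futures
grows only linearly with the length (`sumF_ex_futD_abs`). The clipped ratio `min 1 (num / den)` has
an error which, multiplied by `s(f)`, is at most the error of the numerator plus that of the
denominator (`mul_abs_min_div_sub_le`). No lower bound on `s(f)` is needed, because every weight
that occurs is at most `s(f)`: for `R` this follows from `c ≤ 1`, which makes all coefficients at
most one. So the bias of an entry is at most half the accuracy `σ`, and a Chernoff bound for `S`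
repetitions controls the rest (`HP_matD`).

The equation is solved by the iteration `X ↦ X + R - P X` from zero, with estimates in place of `P`
and `R`. The eigenvalues of `P` lie in `{0} ∪ [Δ/n, 1]`: the upper bound is Cauchy–Schwarz, the gap
is robustness. The error of the exact iteration stays orthogonal to the kernel and contracts by `1 -
Δ/n` per step, while perturbations are never amplified, even along the kernel, and accumulate
linearly (`l2_landweber_sub_le`). About `(n/Δ) log(n/ε)` steps with `σ` of order `ε / (steps · n²
c)` give columns with error at most `ε/n`.

Finally, `β(B')` is the orthogonal projection `1 - W Wᵀ` onto the complement of the kernel, so an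
error vector `u` splits as `β(B') u + W (Wᵀ u)`, and `‖·‖₁ ≤ √n ‖·‖₂` gives the two bounds
(`exists_decomposition`).

The algorithm is written as a program of the machine model. `Runs` records the exact law of the
output together with worst-case time and sample bounds, so that probability and complexity can be
treated separately. The sample count obtained is of order `c⁴ n¹⁷ O² T⁴ / (Δ⁴ ε⁴)` up to logarithms;
the claimed bound follows because `√n c`, `n/Δ`, `1/ε`, `r`, `O` and `T` are at least one. -/

namespace CondSampling

noncomputable section

/-! ### Expectations under finitely supported distributions -/

/-- The expectation of a real function. -/
def ex {α : Type*} (μ : PMF α) (f : α → ℝ) : ℝ := ∑' a, (μ a).toReal * f a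

/-- The distribution has finite support. -/
abbrev FinSupp {α : Type*} (μ : PMF α) : Prop := μ.support.Finite

variable {α β γ : Type*}

theorem ex_eq_sum {μ : PMF α} {s : Finset α} (h : μ.support ⊆ s) (f : α → ℝ) :
    ex μ f = ∑ a ∈ s, (μ a).toReal * f a := by
  refine tsum_eq_sum fun a ha => ?_
  have : μ a = 0 := by
    by_contra h0
    exact ha (h ((PMF.mem_support_iff _ _).2 h0))
  simp [this]

theorem finSupp_pure (a : α) : FinSupp (PMF.pure a) := by
  simp [FinSupp, PMF.support_pure]

theorem FinSupp.bind {μ : PMF α} (h : FinSupp μ) {κ : α → PMF β}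
    (hκ : ∀ a ∈ μ.support, FinSupp (κ a)) : FinSupp (μ.bind κ) := by
  rw [FinSupp, PMF.support_bind]
  exact h.biUnion hκ

theorem FinSupp.map {μ : PMF α} (h : FinSupp μ) (f : α → β) : FinSupp (μ.map f) := by
  rw [FinSupp, PMF.support_map]
  exact h.image f

theorem finSupp_of_finite [Finite α] (μ : PMF α) : FinSupp μ := Set.toFinite _

theorem ex_pure (a : α) (f : α → ℝ) : ex (PMF.pure a) f = f a := by
  classical
  rw [ex_eq_sum (s := {a}) (by simp [PMF.support_pure])]
  simp

/-- The law of total expectation. Finite supports turn all series into finite sums, so that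
exchanging them needs no summability condition. -/
theorem ex_bind {μ : PMF α} (h : FinSupp μ) {κ : α → PMF β}
    (hκ : ∀ a ∈ μ.support, FinSupp (κ a)) (f : β → ℝ) :
    ex (μ.bind κ) f = ex μ fun a => ex (κ a) f := by
  classical
  have hb := h.bind hκ
  set t := hb.toFinset with ht
  rw [ex_eq_sum (s := t) (by simp [ht]), ex_eq_sum (s := h.toFinset) (by simp)]
  have h1 : ∀ a ∈ h.toFinset, (μ a).toReal * ex (κ a) f
      = ∑ b ∈ t, (μ a).toReal * ((κ a b).toReal * f b) := by
    intro a ha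
    have ha' : a ∈ μ.support := by simpa using ha
    rw [ex_eq_sum (s := t), Finset.mul_sum]
    intro b hb'
    simp only [ht, Set.Finite.coe_toFinset, PMF.support_bind, Set.mem_iUnion]
    exact ⟨a, ha', hb'⟩
  rw [Finset.sum_congr rfl h1, Finset.sum_comm]
  refine Finset.sum_congr rfl fun b _ => ?_
  have h2 : (μ.bind κ) b = ∑ a ∈ h.toFinset, μ a * κ a b := by
    rw [PMF.bind_apply]
    refine tsum_eq_sum fun a ha => ?_
    have : μ a = 0 := by
      by_contra h0
      exact ha (by simpa using h0)
    simp [this]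
  rw [h2, ENNReal.toReal_sum, Finset.sum_mul]
  · refine Finset.sum_congr rfl fun a _ => ?_
    rw [ENNReal.toReal_mul, mul_assoc]
  · intro a _
    exact ENNReal.mul_ne_top (PMF.apply_ne_top _ _) (PMF.apply_ne_top _ _)

theorem ex_map {μ : PMF α} (h : FinSupp μ) (g : α → β) (f : β → ℝ) :
    ex (μ.map g) f = ex μ fun a => f (g a) := by
  rw [PMF.map, ex_bind h (κ := PMF.pure ∘ g) fun a _ => finSupp_pure _]
  simp only [Function.comp_apply, ex_pure]

theorem ex_congr {μ : PMF α} {f g : α → ℝ} (h : ∀ a ∈ μ.support, f a = g a) :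
    ex μ f = ex μ g := by
  refine tsum_congr fun a => ?_
  by_cases ha : a ∈ μ.support
  · rw [h a ha]
  · have : μ a = 0 := by simpa using ha
    simp [this]

theorem ex_mono {μ : PMF α} (hμ : FinSupp μ) {f g : α → ℝ} (h : ∀ a ∈ μ.support, f a ≤ g a) :
    ex μ f ≤ ex μ g := by
  rw [ex_eq_sum (s := hμ.toFinset) (by simp), ex_eq_sum (s := hμ.toFinset) (by simp)]
  refine Finset.sum_le_sum fun a ha => mul_le_mul_of_nonneg_left (h a (by simpa using ha)) ?_
  exact ENNReal.toReal_nonneg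

theorem ex_const (μ : PMF α) (c : ℝ) : ex μ (fun _ => c) = c := by
  rw [ex, tsum_mul_right, ← ENNReal.tsum_toReal_eq (fun a => PMF.apply_ne_top _ _), PMF.tsum_coe]
  simp

theorem ex_add {μ : PMF α} (hμ : FinSupp μ) (f g : α → ℝ) :
    ex μ (fun a => f a + g a) = ex μ f + ex μ g := by
  simp only [ex_eq_sum (s := hμ.toFinset) (show μ.support ⊆ hμ.toFinset by simp), mul_add,
    Finset.sum_add_distrib]

theorem ex_sub {μ : PMF α} (hμ : FinSupp μ) (f g : α → ℝ) :
    ex μ (fun a => f a - g a) = ex μ f - ex μ g := by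
  simp only [ex_eq_sum (s := hμ.toFinset) (show μ.support ⊆ hμ.toFinset by simp), mul_sub,
    Finset.sum_sub_distrib]

theorem ex_mul_left (μ : PMF α) (c : ℝ) (f : α → ℝ) :
    ex μ (fun a => c * f a) = c * ex μ f := by
  rw [ex, ex, ← tsum_mul_left]
  exact tsum_congr fun a => by ring

theorem ex_mul_right (μ : PMF α) (c : ℝ) (f : α → ℝ) :
    ex μ (fun a => f a * c) = ex μ f * c := by
  rw [ex, ex, ← tsum_mul_right]
  exact tsum_congr fun a => by ring

theorem ex_nonneg {μ : PMF α} {f : α → ℝ} (h : ∀ a ∈ μ.support, 0 ≤ f a) : 0 ≤ ex μ f := by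
  refine tsum_nonneg fun a => ?_
  by_cases ha : a ∈ μ.support
  · exact mul_nonneg ENNReal.toReal_nonneg (h a ha)
  · have : μ a = 0 := by simpa using ha
    simp [this]

theorem ex_fintype [Fintype α] (μ : PMF α) (f : α → ℝ) :
    ex μ f = ∑ a, (μ a).toReal * f a := ex_eq_sum (by simp) f

theorem abs_ex_le {μ : PMF α} (hμ : FinSupp μ) (f : α → ℝ) : |ex μ f| ≤ ex μ fun a => |f a| := by
  rw [abs_le]
  constructor
  · have := ex_mono hμ (f := fun a => (-1) * |f a|) (g := f) fun a _ => by
      have := neg_abs_le (f a); linarith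
    rw [ex_mul_left] at this; linarith
  · exact ex_mono hμ fun a _ => le_abs_self _

/-! ### Events of high probability -/

open Classical in
/-- The event `G` fails with probability at most `η`. -/
def HP (μ : PMF α) (G : α → Prop) (η : ℝ) : Prop := ex μ (fun a => if G a then 0 else 1) ≤ η

theorem HP.pure {a : α} {G : α → Prop} (h : G a) : HP (PMF.pure a) G 0 := by
  simp [HP, ex_pure, h]

theorem HP.mono {μ : PMF α} (hμ : FinSupp μ) {G G' : α → Prop} {η η' : ℝ} (h : HP μ G η)
    (hG : ∀ a ∈ μ.support, G a → G' a) (hη : η ≤ η') : HP μ G' η' := by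
  refine le_trans (ex_mono hμ fun a ha => ?_) (h.trans hη)
  by_cases h1 : G a
  · simp [h1, hG a ha h1]
  · simp only [h1, if_false]; split_ifs <;> norm_num

/-- Union bound along a sequential composition: where `G` holds the second stage fails with
probability at most `η'`, and where it fails the indicator is at most one. Independence plays no
role. -/
theorem HP.bind {μ : PMF α} (hμ : FinSupp μ) {κ : α → PMF β}
    (hκ : ∀ a ∈ μ.support, FinSupp (κ a)) {G : α → Prop} {G' : β → Prop} {η η' : ℝ}
    (h : HP μ G η) (hη : 0 ≤ η') (h' : ∀ a ∈ μ.support, G a → HP (κ a) G' η') :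
    HP (μ.bind κ) G' (η + η') := by
  classical
  rw [HP, ex_bind hμ hκ]
  refine le_trans (ex_mono hμ (g := fun a => (if G a then 0 else 1) + η') fun a ha => ?_) ?_
  · by_cases h1 : G a
    · have := h' a ha h1
      simp only [h1, if_true, zero_add]
      exact this
    · simp only [h1, if_false]
      have : ex (κ a) (fun b => if G' b then (0 : ℝ) else 1) ≤ ex (κ a) (fun _ => (1 : ℝ)) :=
        ex_mono (hκ a ha) fun b _ => by split_ifs <;> norm_num
      rw [ex_const] at this
      linarith
  · rw [ex_add hμ, ex_const]
    refine add_le_add_left (le_trans (le_of_eq (ex_congr fun a _ => ?_)) h) η'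
    congr

theorem HP.map {μ : PMF α} (hμ : FinSupp μ) {g : α → β} {G : β → Prop} {η : ℝ}
    (h : HP μ (fun a => G (g a)) η) : HP (μ.map g) G η := by
  rw [HP, ex_map hμ]; exact h

/-- Converts a failure bound, stated through expectations, into the form in which the main theorem
states its success probability. -/
theorem HP.le_toOuterMeasure {μ : PMF α} (hμ : FinSupp μ) {G : α → Prop} {η : ℝ} (h : HP μ G η) :
    ENNReal.ofReal (1 - η) ≤ μ.toOuterMeasure {a | G a} := by
  classical
  have h1 : 1 - η ≤ ex μ (fun a => if G a then 1 else 0) := by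
    have h2 : ex μ (fun a => (if G a then (1 : ℝ) else 0) + (if G a then 0 else 1)) = 1 := by
      refine (ex_congr fun a _ => ?_).trans (ex_const μ 1)
      split_ifs <;> norm_num
    rw [ex_add hμ] at h2
    have : ex μ (fun a => if G a then (0 : ℝ) else 1) ≤ η := by
      refine le_trans (le_of_eq (ex_congr fun a _ => ?_)) h
      congr
    linarith
  refine (ENNReal.ofReal_le_ofReal h1).trans ?_
  rw [ex_eq_sum (s := hμ.toFinset) (by simp), ENNReal.ofReal_sum_of_nonneg]
  · rw [PMF.toOuterMeasure_apply]
    refine le_trans (le_of_eq ?_) (ENNReal.sum_le_tsum hμ.toFinset)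
    refine Finset.sum_congr rfl fun a _ => ?_
    by_cases hG : G a
    · simp [hG, ENNReal.ofReal_toReal (PMF.apply_ne_top _ _)]
    · simp [hG]
  · intro a _
    exact mul_nonneg ENNReal.toReal_nonneg (by split_ifs <;> norm_num)

/-! ### Iteration, independent lists, and means -/

/-- Random iteration of a kernel. -/
def iterD (κ : α → PMF α) : ℕ → α → PMF α
  | 0, x => PMF.pure x
  | n + 1, x => (κ x).bind (iterD κ n)

/-- Random fold along a list. -/
def foldD (κ : β → α → PMF α) : List β → α → PMF α
  | [], s => PMF.pure s
  | x :: l, s => (κ x s).bind (foldD κ l)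

/-- A list of independent samples, one for each entry of a list. -/
def mapD (κ : α → PMF β) : List α → PMF (List β)
  | [] => PMF.pure []
  | x :: l => (κ x).bind fun y => (mapD κ l).map (y :: ·)

/-- `a` plus the sum of `K` independent samples. -/
def sumD (μ : PMF ℝ) : ℕ → ℝ → PMF ℝ
  | 0, a => PMF.pure a
  | K + 1, a => μ.bind fun x => sumD μ K (a + x)

/-- The mean of `K` independent samples. -/
def meanD (K : ℕ) (μ : PMF ℝ) : PMF ℝ := (sumD μ K 0).map (· / (K : ℝ))

theorem finSupp_foldD {κ : β → α → PMF α} (h : ∀ x s, FinSupp (κ x s)) (l : List β) (s : α) :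
    FinSupp (foldD κ l s) := by
  induction l generalizing s with
  | nil => exact finSupp_pure _
  | cons x l ih => exact (h x s).bind fun a _ => ih a

theorem finSupp_mapD {κ : α → PMF β} (h : ∀ x, FinSupp (κ x)) (l : List α) :
    FinSupp (mapD κ l) := by
  induction l with
  | nil => exact finSupp_pure _
  | cons x l ih => exact (h x).bind fun a _ => ih.map _

theorem finSupp_sumD {μ : PMF ℝ} (h : FinSupp μ) (K : ℕ) (a : ℝ) : FinSupp (sumD μ K a) := by
  induction K generalizing a with
  | zero => exact finSupp_pure _
  | succ K ih => exact h.bind fun x _ => ih _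

theorem finSupp_meanD {μ : PMF ℝ} (h : FinSupp μ) (K : ℕ) : FinSupp (meanD K μ) :=
  (finSupp_sumD h K 0).map _

/-- Only the length of the list matters; this identifies the law of a summation loop over a dummy
list of indices. -/
theorem foldD_const_eq_sumD (μ : PMF ℝ) (l : List β) (a : ℝ) :
    foldD (fun _ s => μ.map (s + ·)) l a = sumD μ l.length a := by
  induction l generalizing a with
  | nil => rfl
  | cons x l ih => simp only [foldD, List.length_cons, sumD, PMF.bind_map]; congr 1; funext y; exact ih _

theorem foldD_pure (g : β → α → α) (l : List β) (s : α) :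
    foldD (fun x s => PMF.pure (g x s)) l s = PMF.pure (l.foldl (fun s x => g x s) s) := by
  induction l generalizing s with
  | nil => rfl
  | cons x l ih => simp only [foldD, PMF.pure_bind, ih, List.foldl_cons]

/-- A fold that conses its results produces them in reverse order; the law of the list before
reversal is still that of independent samples. -/
theorem foldD_cons_eq (κ : α → PMF β) (l : List α) (acc : List β) :
    foldD (fun x s => (κ x).map (· :: s)) l acc
      = (mapD κ l).map fun ys => ys.reverse ++ acc := by
  induction l generalizing acc with
  | nil => simp [foldD, mapD, PMF.pure_map]
  | cons x l ih =>
    simp only [foldD, mapD, PMF.bind_map, PMF.map_bind, PMF.map_comp]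
    congr 1; funext y
    simp only [Function.comp_apply, ih]
    congr 1; funext ys
    simp

theorem mapD_pure (g : α → β) (l : List α) :
    mapD (fun x => PMF.pure (g x)) l = PMF.pure (l.map g) := by
  induction l with
  | nil => rfl
  | cons x l ih => simp [mapD, ih, PMF.pure_map, PMF.pure_bind]

theorem length_of_mem_support_mapD {κ : α → PMF β} {l : List α} {ys : List β}
    (h : ys ∈ (mapD κ l).support) : ys.length = l.length := by
  induction l generalizing ys with
  | nil => simp [mapD] at h; simp [h]
  | cons x l ih =>
    simp only [mapD, PMF.support_bind, Set.mem_iUnion, PMF.support_map, Set.mem_image] at h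
    obtain ⟨y, _, zs, hz, rfl⟩ := h
    simp [ih hz]

theorem forall₂_of_mem_support_mapD {κ : α → PMF β} {R : α → β → Prop} {l : List α} {ys : List β}
    (hR : ∀ x ∈ l, ∀ y ∈ (κ x).support, R x y)
    (h : ys ∈ (mapD κ l).support) : List.Forall₂ R l ys := by
  induction l generalizing ys with
  | nil => simp [mapD] at h; simp [h]
  | cons x l ih =>
    simp only [mapD, PMF.support_bind, Set.mem_iUnion, PMF.support_map, Set.mem_image] at h
    obtain ⟨y, hy, zs, hz, rfl⟩ := h
    exact List.Forall₂.cons (hR x (by simp) y hy)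
      (ih (fun x hx => hR x (List.mem_cons_of_mem _ hx)) hz)

end

end CondSampling

/-! ### Semantics of programs: output laws with time and sample bounds. -/

namespace CondSampling

noncomputable section

/-! ### Laws and costs of computations -/

/-- The computation terminates, its result has law `μ`, and it takes at most `τ` steps and `s`
samples. -/
def CompLaw {α : Type} (m : Comp α) (μ : PMF α) (τ s : ℕ) : Prop :=
  ∃ ν : PMF (α × ℕ × ℕ), m = ν.map some ∧ ν.map Prod.fst = μ ∧
    ∀ y ∈ ν.support, y.2.1 ≤ τ ∧ y.2.2 ≤ s

theorem CompLaw.mono {α : Type} {m : Comp α} {μ : PMF α} {τ s τ' s' : ℕ} (h : CompLaw m μ τ s)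
    (hτ : τ ≤ τ') (hs : s ≤ s') : CompLaw m μ τ' s' := by
  obtain ⟨ν, h1, h2, h3⟩ := h
  exact ⟨ν, h1, h2, fun y hy => ⟨(h3 y hy).1.trans hτ, (h3 y hy).2.trans hs⟩⟩

theorem CompLaw.ret {α : Type} (k : ℕ) (x : α) : CompLaw (Comp.ret k x) (PMF.pure x) k 0 := by
  refine ⟨PMF.pure (x, k, 0), ?_, ?_, ?_⟩
  · rw [PMF.pure_map]; rfl
  · rw [PMF.pure_map]
  · intro y hy
    simp only [PMF.support_pure, Set.mem_singleton_iff] at hy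
    subst hy; simp

theorem pmf_bind_congr {α β : Type*} {μ : PMF α} {f g : α → PMF β}
    (h : ∀ a ∈ μ.support, f a = g a) : μ.bind f = μ.bind g := by
  ext b
  rw [PMF.bind_apply, PMF.bind_apply]
  refine tsum_congr fun a => ?_
  by_cases ha : a ∈ μ.support
  · rw [h a ha]
  · have : μ a = 0 := by simpa using ha
    simp [this]

/-- The costs are bounded on every outcome of positive probability, hence they add along each pair
of consecutive outcomes, whatever the joint law of results and costs. -/
theorem CompLaw.andThen {α β : Type} {m : Comp α} {μ : PMF α} {τ s τ' s' : ℕ}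
    (h : CompLaw m μ τ s) {g : α → Comp β} {κ : α → PMF β}
    (hg : ∀ x ∈ μ.support, CompLaw (g x) (κ x) τ' s') :
    CompLaw (m.andThen g) (μ.bind κ) (τ + τ') (s + s') := by
  classical
  obtain ⟨ν, rfl, rfl, h3⟩ := h
  have hg' : ∀ y, ∃ ρ : PMF (β × ℕ × ℕ), y ∈ ν.support → g y.1 = ρ.map some ∧
      ρ.map Prod.fst = κ y.1 ∧ ∀ z ∈ ρ.support, z.2.1 ≤ τ' ∧ z.2.2 ≤ s' := by
    intro y
    by_cases hy : y ∈ ν.support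
    · exact (hg y.1 (by rw [PMF.support_map]; exact ⟨y, hy, rfl⟩)).imp fun ρ h _ => h
    -- Nothing is known about `g` off the support of `ν`; any distribution serves there, since it is
    -- never reached.
    · exact ⟨(κ y.1).map fun z => (z, 0, 0), fun h => (hy h).elim⟩
  choose ρ hρ using hg'
  have hρ1 := fun y hy => (hρ y hy).1
  have hρ2 := fun y hy => (hρ y hy).2.1
  have hρ3 := fun y hy => (hρ y hy).2.2
  refine ⟨ν.bind fun y => (ρ y).map fun z => (z.1, y.2.1 + z.2.1, y.2.2 + z.2.2), ?_, ?_, ?_⟩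
  · rw [Comp.andThen, PMF.bind_map, PMF.map_bind]
    refine pmf_bind_congr fun y hy => ?_
    simp only [Function.comp_apply]
    rw [hρ1 y hy, PMF.map_comp, PMF.map_comp]
    rfl
  · rw [PMF.bind_map, PMF.map_bind]
    refine pmf_bind_congr fun y hy => ?_
    rw [PMF.map_comp, Function.comp_apply, ← hρ2 y hy]
    rfl
  · intro z hz
    simp only [PMF.support_bind, Set.mem_iUnion, PMF.support_map, Set.mem_image] at hz
    obtain ⟨y, hy, w, hw, rfl⟩ := hz
    have h1 := h3 y hy
    have h2 := hρ3 y hy w hw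
    exact ⟨by simp only; omega, by simp only; omega⟩

/-- `I n x` says that exactly `n` iterations remain in state `x`. The states may be random, but the
number of iterations is not, so the law is an `n`-fold iterate of the kernel. The fuel `n + 1`
covers the last, failing test. -/
theorem CompLaw.whileLoop {α : Type} {test : α → Comp ℕ} {body : α → Comp α} {κ : α → PMF α}
    (I : ℕ → α → Prop) {τc τb s : ℕ}
    (htest : ∀ n x, I n x → ∃ c : ℕ, (c = 0 ↔ n = 0) ∧ CompLaw (test x) (PMF.pure c) τc 0)
    (hbody : ∀ n x, I (n + 1) x → CompLaw (body x) (κ x) τb s ∧ ∀ y ∈ (κ x).support, I n y)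
    (n : ℕ) : ∀ (fuel : ℕ) (x : α), I n x → n + 1 ≤ fuel →
      CompLaw (Comp.whileLoop test body fuel x) (iterD κ n x) ((n + 1) * (τc + 1 + τb)) (n * s) := by
  induction n with
  | zero =>
    intro fuel x hx hf
    obtain ⟨fuel, rfl⟩ : ∃ f, fuel = f + 1 := ⟨fuel - 1, by omega⟩
    obtain ⟨c, hc, ht⟩ := htest 0 x hx
    have hc0 : c = 0 := hc.2 rfl
    subst hc0
    have := ht.andThen (g := fun c => if c = 0 then Comp.ret 1 x
      else (Comp.ret 1 x).andThen fun x' => (body x').andThen (Comp.whileLoop test body fuel))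
      (κ := fun _ => PMF.pure x) (τ' := 1) (s' := 0) (by
        intro c hc
        simp only [PMF.support_pure, Set.mem_singleton_iff] at hc
        subst hc
        simpa using CompLaw.ret 1 x)
    rw [PMF.pure_bind] at this
    exact this.mono (by nlinarith) (by simp)
  | succ n ih =>
    intro fuel x hx hf
    obtain ⟨fuel, rfl⟩ : ∃ f, fuel = f + 1 := ⟨fuel - 1, by omega⟩
    obtain ⟨c, hc, ht⟩ := htest _ x hx
    have hc0 : c ≠ 0 := fun h => by simpa using hc.1 h
    obtain ⟨hb, hI⟩ := hbody n x hx
    have := ht.andThen (g := fun c => if c = 0 then Comp.ret 1 x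
      else (Comp.ret 1 x).andThen fun x' => (body x').andThen (Comp.whileLoop test body fuel))
      (κ := fun _ => iterD κ (n + 1) x) (τ' := 1 + (τb + (n + 1) * (τc + 1 + τb)))
      (s' := 0 + (s + n * s)) (by
        intro c' hc'
        simp only [PMF.support_pure, Set.mem_singleton_iff] at hc'
        subst hc'
        simp only [hc0, if_false]
        have h1 : iterD κ (n + 1) x = (PMF.pure x).bind fun x => iterD κ (n + 1) x := by
          rw [PMF.pure_bind]
        rw [h1]
        refine (CompLaw.ret 1 x).andThen fun y hy => ?_
        simp only [PMF.support_pure, Set.mem_singleton_iff] at hy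
        subst hy
        exact hb.andThen fun z hz => ih fuel z (hI z hz) (by omega))
    rw [PMF.pure_bind] at this
    exact this.mono (by ring_nf; omega) (by ring_nf; omega)

/-! ### Laws and costs of programs -/

variable {O : ℕ} {p : SeqDist O} {T : ℕ}

/-- On input `x` the program terminates, its output has law `μ`, and it takes at most `τ` steps
and `s` samples. -/
def Runs (p : SeqDist O) (T : ℕ) {a b : Ty} (P : Prog a b) (x : a.Val) (μ : PMF b.Val)
    (τ s : ℕ) : Prop :=
  ∀ fuel, τ ≤ fuel → CompLaw (P.run p T fuel x) μ τ s

theorem Runs.mono {a b : Ty} {P : Prog a b} {x : a.Val} {μ : PMF b.Val} {τ s τ' s' : ℕ}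
    (h : Runs p T P x μ τ s) (hτ : τ ≤ τ') (hs : s ≤ s') : Runs p T P x μ τ' s' :=
  fun fuel hf => (h fuel (hτ.trans hf)).mono hτ hs

theorem Runs.comp {a b c : Ty} {P : Prog a b} {Q : Prog b c} {x : a.Val} {μ : PMF b.Val}
    {κ : b.Val → PMF c.Val} {τ s τ' s' : ℕ} (hP : Runs p T P x μ τ s)
    (hQ : ∀ y ∈ μ.support, Runs p T Q y (κ y) τ' s') :
    Runs p T (P.comp Q) x (μ.bind κ) (τ + τ' + 1) (s + s') := by
  intro fuel hf
  have := (hP fuel (by omega)).andThen (g := fun y => (Q.run p T fuel y).andThen fun z =>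
      Comp.ret 1 z) (κ := κ) (τ' := τ' + 1) (s' := s' + 0) (fun y hy => by
        have h2 := (hQ y hy fuel (by omega)).andThen (g := fun z => Comp.ret 1 z)
          (κ := PMF.pure) (fun z _ => CompLaw.ret 1 z)
        rwa [PMF.bind_pure] at h2)
  exact this

theorem Runs.pair {a b c : Ty} {P : Prog a b} {Q : Prog a c} {x : a.Val} {μ : PMF b.Val}
    {ν : PMF c.Val} {τ s τ' s' : ℕ} (hP : Runs p T P x μ τ s) (hQ : Runs p T Q x ν τ' s') :
    Runs p T (P.pair Q) x (μ.bind fun y => ν.map fun z => (y, z)) (τ + τ' + 1) (s + s') := by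
  intro fuel hf
  exact (hP fuel (by omega)).andThen (g := fun y => (Q.run p T fuel x).andThen fun z =>
      Comp.ret 1 (y, z)) (τ' := τ' + 1) (s' := s' + 0) (fun y hy =>
        (hQ fuel (by omega)).andThen (g := fun z => Comp.ret 1 (y, z))
          (κ := fun z => PMF.pure (y, z)) (fun z _ => CompLaw.ret 1 _))

/-- Loop-free and sample-free programs. -/
def Prog.Simple : {a b : Ty} → Prog a b → Bool
  | _, _, .comp P Q => P.Simple && Q.Simple
  | _, _, .pair P Q => P.Simple && Q.Simple
  | _, _, .listCase P Q => P.Simple && Q.Simple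
  | _, _, .cond C P Q => C.Simple && P.Simple && Q.Simple
  | _, _, .loop _ _ => false
  | _, _, .sample => false
  | _, _, _ => true

/-- An upper bound for the running time of a loop-free program. -/
def Prog.cost : {a b : Ty} → Prog a b → ℕ
  | _, _, .comp P Q => P.cost + Q.cost + 1
  | _, _, .pair P Q => P.cost + Q.cost + 1
  | _, _, .listCase P Q => P.cost + Q.cost + 1
  | _, _, .cond C P Q => C.cost + P.cost + Q.cost + 1
  | _, _, _ => 1

open Classical in
/-- The function computed by a loop-free and sample-free program. -/
def Prog.eval : {a b : Ty} → Prog a b → a.Val → b.Val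
  | _, _, .id, x => x
  | _, _, .comp P Q, x => Q.eval (P.eval x)
  | _, _, .pair P Q, x => (P.eval x, Q.eval x)
  | _, _, .fst, x => x.1
  | _, _, .snd, x => x.2
  | _, _, .natConst k, _ => (k : ℕ)
  | _, _, .natAdd, x => Nat.add x.1 x.2
  | _, _, .natSub, x => Nat.sub x.1 x.2
  | _, _, .realOfNat, x => Nat.cast (R := ℝ) x
  | _, _, .realAdd, x => (x.1 : ℝ) + (x.2 : ℝ)
  | _, _, .realSub, x => (x.1 : ℝ) - (x.2 : ℝ)
  | _, _, .realMul, x => (x.1 : ℝ) * (x.2 : ℝ)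
  | _, _, .realDiv, x => (x.1 : ℝ) / (x.2 : ℝ)
  | _, _, .realLe, x => ((if (x.1 : ℝ) ≤ (x.2 : ℝ) then 1 else 0 : ℕ))
  | _, _, .nil, _ => []
  | _, _, .cons, x => List.cons x.1 x.2
  | _, _, .listCase P Q, x =>
      match x.2 with
      | [] => P.eval x.1
      | z :: l => Q.eval (x.1, (z, l))
  | _, _, .cond C P Q, x => if (C.eval x : ℕ) = 0 then Q.eval x else P.eval x
  | _, _, .loop _ _, x => x
  | _, _, .sample, _ => []

theorem CompLaw.andThen_pure {α β : Type} {m : Comp α} {x : α} {μ : PMF β} {τ s τ' s' : ℕ}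
    (h : CompLaw m (PMF.pure x) τ s) {g : α → Comp β} (hg : CompLaw (g x) μ τ' s') :
    CompLaw (m.andThen g) μ (τ + τ') (s + s') := by
  have := h.andThen (g := g) (κ := fun _ => μ) (τ' := τ') (s' := s') (fun y hy => by
    simp only [PMF.support_pure, Set.mem_singleton_iff] at hy
    subst hy; exact hg)
  rwa [PMF.pure_bind] at this

/-- Straight-line code is deterministic and has a cost bound independent of the input, since `cost`
counts both branches of a case distinction. Its specification therefore reduces to evaluating
`eval`, mostly by `rfl`. -/
theorem Runs.of_simple {a b : Ty} (P : Prog a b) (hP : P.Simple = true) (x : a.Val) :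
    Runs p T P x (PMF.pure (P.eval x)) P.cost 0 := by
  induction P with
  | comp P Q ihP ihQ =>
    simp only [Prog.Simple, Bool.and_eq_true] at hP
    have := (ihP hP.1 x).comp (κ := fun y => PMF.pure (Q.eval y)) (fun y _ => ihQ hP.2 y)
    rwa [PMF.pure_bind] at this
  | pair P Q ihP ihQ =>
    simp only [Prog.Simple, Bool.and_eq_true] at hP
    have := (ihP hP.1 x).pair (ihQ hP.2 x)
    rwa [PMF.pure_bind, PMF.pure_map] at this
  | listCase P Q ihP ihQ =>
    simp only [Prog.Simple, Bool.and_eq_true] at hP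
    intro fuel hf
    simp only [Prog.cost] at hf
    obtain ⟨y, l⟩ := x
    have h1 := (CompLaw.ret 1 ((y, l) : Ty.Val (.prod _ (.list _))))
    cases l with
    | nil =>
      exact CompLaw.mono (τ := 1 + P.cost) (s := 0 + 0)
        ((CompLaw.ret 1 _).andThen_pure (ihP hP.1 y fuel (by omega)))
        (by simp only [Prog.cost]; omega) le_rfl
    | cons z l =>
      exact CompLaw.mono (τ := 1 + Q.cost) (s := 0 + 0)
        ((CompLaw.ret 1 _).andThen_pure (ihQ hP.2 (y, (z, l)) fuel (by omega)))
        (by simp only [Prog.cost]; omega) le_rfl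
  | cond C P Q ihC ihP ihQ =>
    simp only [Prog.Simple, Bool.and_eq_true] at hP
    intro fuel hf
    simp only [Prog.cost] at hf
    have h1 := ihC hP.1.1 x fuel (by omega)
    by_cases hc : (C.eval x : ℕ) = 0
    · have h2 := h1.andThen_pure (g := fun (c : ℕ) => (Comp.ret 1 x).andThen fun x' =>
        if c = 0 then Q.run p T fuel x' else P.run p T fuel x') (μ := PMF.pure (Q.eval x))
        (by
          refine (CompLaw.ret 1 _).andThen_pure (τ' := Q.cost) (s' := 0) ?_
          rw [if_pos hc]
          exact ihQ hP.2 x fuel (by omega))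
      simp only [Prog.eval, hc, if_true]
      exact h2.mono (by simp only [Prog.cost]; omega) le_rfl
    · have h2 := h1.andThen_pure (g := fun (c : ℕ) => (Comp.ret 1 x).andThen fun x' =>
        if c = 0 then Q.run p T fuel x' else P.run p T fuel x') (μ := PMF.pure (P.eval x))
        (by
          refine (CompLaw.ret 1 _).andThen_pure (τ' := P.cost) (s' := 0) ?_
          rw [if_neg hc]
          exact ihP hP.1.2 x fuel (by omega))
      simp only [Prog.eval, hc, if_false]
      exact h2.mono (by simp only [Prog.cost]; omega) le_rfl
  | loop C P _ _ => simp [Prog.Simple] at hP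
  | sample => simp [Prog.Simple] at hP
  | _ => intro fuel _; exact CompLaw.ret 1 _

theorem Runs.listCase {a b c : Ty} {P : Prog a c} {Q : Prog (.prod a (.prod b (.list b))) c}
    {x : a.Val} {l : List b.Val} {μ : PMF c.Val} {τ s : ℕ}
    (hP : l = [] → Runs p T P x μ τ s)
    (hQ : ∀ z l', l = z :: l' → Runs p T Q (x, (z, l')) μ τ s) :
    Runs p T (P.listCase Q) (x, l) μ (τ + 1) s := by
  intro fuel hf
  cases l with
  | nil =>
    exact CompLaw.mono (τ := 1 + τ) (s := 0 + s) ((CompLaw.ret 1 _).andThen_pure (hP rfl fuel (by omega)))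
      (by omega) (by omega)
  | cons z l =>
    exact CompLaw.mono (τ := 1 + τ) (s := 0 + s) ((CompLaw.ret 1 _).andThen_pure (hQ z l rfl fuel (by omega)))
      (by omega) (by omega)

theorem Runs.cond {a b : Ty} {C : Prog a .nat} {P Q : Prog a b} {x : a.Val} {k : ℕ}
    {μ : PMF b.Val} {τc τ s : ℕ} (hC : Runs p T C x (PMF.pure k) τc 0)
    (hP : k ≠ 0 → Runs p T P x μ τ s) (hQ : k = 0 → Runs p T Q x μ τ s) :
    Runs p T (Prog.cond C P Q) x μ (τc + τ + 1) s := by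
  intro fuel hf
  have h2 := (hC fuel (by omega)).andThen_pure (g := fun (c : ℕ) => (Comp.ret 1 x).andThen fun x' =>
        if c = 0 then Q.run p T fuel x' else P.run p T fuel x') (μ := μ) (τ' := 1 + τ)
        (s' := 0 + s) (by
          refine (CompLaw.ret 1 _).andThen_pure ?_
          by_cases hk : k = 0
          · simp only [hk, if_true]
            exact hQ hk fuel (by omega)
          · simp only [hk, if_false]
            exact hP hk fuel (by omega))
  exact h2.mono (by omega) (by omega)

/-- The time bound dominates the number of tests and the time of one round, so the same number
serves as sufficient fuel for this loop and for all loops nested in it. -/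
theorem Runs.loop {a : Ty} {C : Prog a .nat} {P : Prog a a} {κ : a.Val → PMF a.Val}
    (I : ℕ → a.Val → Prop) {τc τb s : ℕ}
    (htest : ∀ n x, I n x → ∃ c : ℕ, (c = 0 ↔ n = 0) ∧ Runs p T C x (PMF.pure c) τc 0)
    (hbody : ∀ n x, I (n + 1) x → Runs p T P x (κ x) τb s ∧ ∀ y ∈ (κ x).support, I n y)
    (n : ℕ) (x : a.Val) (hx : I n x) :
    Runs p T (Prog.loop C P) x (iterD κ n x) ((n + 1) * (τc + 1 + τb)) (n * s) := by
  intro fuel hf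
  have h1 : τc + 1 + τb ≤ fuel := le_trans (by nlinarith) hf
  have h2 : n + 1 ≤ fuel := le_trans (by nlinarith) hf
  exact CompLaw.whileLoop I
    (fun n x hI => (htest n x hI).imp fun c hc => ⟨hc.1, hc.2 fuel (by omega)⟩)
    (fun n x hI => ⟨(hbody n x hI).1 fuel (by omega), (hbody n x hI).2⟩) n fuel x hx h2

theorem Runs.comp_pure {a b c : Ty} {P : Prog a b} {Q : Prog b c} {x : a.Val} {y : b.Val}
    {μ : PMF c.Val} {τ s τ' s' : ℕ} (hP : Runs p T P x (PMF.pure y) τ s)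
    (hQ : Runs p T Q y μ τ' s') : Runs p T (P.comp Q) x μ (τ + τ' + 1) (s + s') := by
  have := hP.comp (κ := fun _ => μ) (Q := Q) (τ' := τ') (s' := s') (fun z hz => by
    simp only [PMF.support_pure, Set.mem_singleton_iff] at hz
    subst hz; exact hQ)
  rwa [PMF.pure_bind] at this

theorem Runs.comp_map {a b c : Ty} {P : Prog a b} {Q : Prog b c} {x : a.Val} {μ : PMF b.Val}
    (f : b.Val → c.Val) {τ s τ' s' : ℕ} (hP : Runs p T P x μ τ s)
    (hQ : ∀ y ∈ μ.support, Runs p T Q y (PMF.pure (f y)) τ' s') :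
    Runs p T (P.comp Q) x (μ.map f) (τ + τ' + 1) (s + s') :=
  hP.comp (κ := fun y => PMF.pure (f y)) hQ

theorem Runs.simple {a b : Ty} {P : Prog a b} {x : a.Val} {y : b.Val} (hP : P.Simple = true)
    (hy : P.eval x = y) : Runs p T P x (PMF.pure y) P.cost 0 := hy ▸ Runs.of_simple P hP x

theorem Runs.sample {l : List ℕ} : Runs p T Prog.sample l (oracle p T l) (T + 1) 1 := by
  intro fuel _
  refine ⟨(oracle p T l).map fun f => (f, T + 1, 1), ?_, ?_, ?_⟩
  · rw [PMF.map_comp]; rfl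
  · rw [PMF.map_comp]; exact PMF.map_id _
  · intro y hy
    rw [PMF.support_map] at hy
    obtain ⟨f, _, rfl⟩ := hy
    exact ⟨le_rfl, le_rfl⟩

end

end CondSampling

/-! ### Programming the learner. -/

namespace CondSampling

noncomputable section

variable {O : ℕ} {p : SeqDist O} {T : ℕ}

/-! ### Program combinators -/

theorem Runs.pair_pure_left {a b c : Ty} {P : Prog a b} {Q : Prog a c} {x : a.Val} {y : b.Val}
    {ν : PMF c.Val} {τ s τ' s' : ℕ} (hP : Runs p T P x (PMF.pure y) τ s)
    (hQ : Runs p T Q x ν τ' s') :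
    Runs p T (P.pair Q) x (ν.map fun z => (y, z)) (τ + τ' + 1) (s + s') := by
  have := hP.pair hQ
  rwa [PMF.pure_bind] at this

theorem Runs.pair_pure_right {a b c : Ty} {P : Prog a b} {Q : Prog a c} {x : a.Val} {z : c.Val}
    {μ : PMF b.Val} {τ s τ' s' : ℕ} (hP : Runs p T P x μ τ s)
    (hQ : Runs p T Q x (PMF.pure z) τ' s') :
    Runs p T (P.pair Q) x (μ.map fun y => (y, z)) (τ + τ' + 1) (s + s') := by
  have := hP.pair hQ
  simp only [PMF.pure_map] at this
  exact this

theorem Runs.pair_pure {a b c : Ty} {P : Prog a b} {Q : Prog a c} {x : a.Val} {y : b.Val}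
    {z : c.Val} {τ s τ' s' : ℕ} (hP : Runs p T P x (PMF.pure y) τ s)
    (hQ : Runs p T Q x (PMF.pure z) τ' s') :
    Runs p T (P.pair Q) x (PMF.pure (y, z)) (τ + τ' + 1) (s + s') := by
  have := hP.pair_pure_left hQ
  rwa [PMF.pure_map] at this

theorem iterD_pure {α : Type*} (g : α → α) (n : ℕ) (x : α) :
    iterD (fun x => PMF.pure (g x)) n x = PMF.pure (g^[n] x) := by
  induction n generalizing x with
  | zero => rfl
  | succ n ih => simp only [iterD, PMF.pure_bind, ih, Function.iterate_succ_apply]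

/-- Fold of a program along a list. -/
def foldP {e x s : Ty} (body : Prog (.prod e (.prod x s)) s) :
    Prog (.prod (.prod e s) (.list x)) s :=
  (Prog.loop (.listCase (.natConst 0) (.natConst 1))
    (.listCase (.pair .id .nil)
      (.pair (.pair (.comp .fst .fst)
        (.comp (.pair (.comp .fst .fst) (.pair (.comp .snd .fst) (.comp .fst .snd))) body))
        (.comp .snd .snd)))).comp (.comp .fst .snd)

/-- The loop state holds the environment, the accumulator and the unread part of the list; the
length of the latter is the number of remaining iterations required by `Runs.loop`. The invariant
`I` may depend on the unread part as well as on the accumulator. The constant `40` absorbs the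
bookkeeping of one round. -/
theorem Runs.foldP {e x s : Ty} {body : Prog (.prod e (.prod x s)) s} {env : e.Val}
    (κ : x.Val → s.Val → PMF s.Val) (I : List x.Val → s.Val → Prop) {τ sb : ℕ}
    (hb : ∀ y l st, I (y :: l) st → Runs p T body (env, (y, st)) (κ y st) τ sb ∧
      ∀ st' ∈ (κ y st).support, I l st')
    (l : List x.Val) (s0 : s.Val) (h0 : I l s0) :
    Runs p T (foldP body) ((env, s0), l) (foldD κ l s0) ((l.length + 1) * (τ + 40))
      (l.length * sb) := by
  -- One round on whole loop states. The empty-list case is a filler, because the loop has stopped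
  -- by then.
  let κ' : (Ty.prod (.prod e s) (.list x)).Val → PMF (Ty.prod (.prod e s) (.list x)).Val :=
    fun w => match w.2 with
      | [] => PMF.pure w
      | y :: l => (κ y w.1.2).map fun st => ((env, st), l)
  -- After `l.length` rounds the accumulator has the law of the fold; the rest of the state is
  -- discarded.
  have hlaw : ∀ (l : List x.Val) (s0 : s.Val),
      (iterD κ' l.length ((env, s0), l)).map (fun w => w.1.2) = foldD κ l s0 := by
    intro l
    induction l with
    | nil => intro s0; simp [iterD, foldD, PMF.pure_map]
    | cons y l ih =>
      intro s0
      simp only [List.length_cons, iterD, foldD, κ', PMF.bind_map, PMF.map_bind]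
      congr 1
      funext st
      simpa using ih st
  have hloop := Runs.loop (p := p) (T := T) (κ := κ')
    (C := Prog.listCase (.natConst 0) (.natConst 1))
    (P := .listCase (.pair .id .nil)
      (.pair (.pair (.comp .fst .fst)
        (.comp (.pair (.comp .fst .fst) (.pair (.comp .snd .fst) (.comp .fst .snd))) body))
        (.comp .snd .snd)))
    (fun n w => w.2.length = n ∧ w.1.1 = env ∧ I w.2 w.1.2) (τc := 3) (τb := τ + 24) (s := sb)
    (by
      rintro n ⟨w, l⟩ ⟨h1, h2, h3⟩
      cases l with
      | nil =>
        refine ⟨0, ?_, Runs.simple rfl rfl⟩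
        simp at h1; simp [h1]
      | cons y l =>
        refine ⟨1, ?_, Runs.simple rfl rfl⟩
        simp at h1; simp [← h1])
    (by
      rintro n ⟨⟨en, st⟩, l⟩ ⟨h1, h2, h3⟩
      cases l with
      | nil => simp at h1
      | cons y l =>
        simp only [List.length_cons, Nat.add_right_cancel_iff] at h1 h2
        subst h2
        obtain ⟨hr, hI⟩ := hb y l st h3
        constructor
        · refine Runs.listCase (τ := τ + 23) (by simp) ?_
          intro z l' h
          simp only [List.cons.injEq] at h
          obtain ⟨rfl, rfl⟩ := h
          have h4 : Runs p T (.pair (.comp .fst .fst) (.comp (.pair (.comp .fst .fst)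
            (.pair (.comp .snd .fst) (.comp .fst .snd))) body))
              (((en, st), (y, l)) : Ty.Val (.prod (.prod e s) (.prod x (.list x))))
              ((κ y st).map fun st' => (en, st')) _ _ :=
            Runs.pair_pure_left (Runs.simple rfl rfl)
              (Runs.comp_pure (y := (en, (y, st))) (Runs.simple rfl rfl) hr)
          have h5 := h4.pair_pure_right (Q := Prog.comp .snd .snd) (z := l)
            (Runs.simple rfl rfl)
          rw [PMF.map_comp] at h5
          exact h5.mono (by simp only [Prog.cost]; omega) (by omega)
        · intro w hw
          simp only [κ', PMF.support_map, Set.mem_image] at hw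
          obtain ⟨st', hst, rfl⟩ := hw
          exact ⟨h1, rfl, hI st' hst⟩)
    l.length ((env, s0), l) ⟨rfl, rfl, h0⟩
  have := hloop.comp_map (Q := Prog.comp .fst .snd) (fun w => w.1.2)
    (fun y _ => Runs.simple rfl rfl)
  rw [hlaw] at this
  refine this.mono ?_ (by omega)
  simp only [Prog.cost]
  nlinarith

theorem Runs.foldP_pure {e x s : Ty} {body : Prog (.prod e (.prod x s)) s} {env : e.Val}
    (g : s.Val → x.Val → s.Val) (I : List x.Val → s.Val → Prop) {τ sb : ℕ}
    (hb : ∀ y l st, I (y :: l) st → Runs p T body (env, (y, st)) (PMF.pure (g st y)) τ sb ∧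
      I l (g st y))
    (l : List x.Val) (s0 : s.Val) (h0 : I l s0) :
    Runs p T (CondSampling.foldP body) ((env, s0), l) (PMF.pure (l.foldl g s0))
      ((l.length + 1) * (τ + 40)) (l.length * sb) := by
  have := Runs.foldP (p := p) (T := T) (body := body) (env := env)
    (fun y st => PMF.pure (g st y)) I (τ := τ) (sb := sb)
    (fun y l st h => ⟨(hb y l st h).1, fun st' hst => by
      simp only [PMF.support_pure, Set.mem_singleton_iff] at hst
      subst hst; exact (hb y l st h).2⟩) l s0 h0
  rwa [foldD_pure] at this

/-- Reversal of a list. -/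
def reverseP {x : Ty} : Prog (.list x) (.list x) :=
  .comp (.pair (.pair .id .nil) .id) (foldP (.comp .snd .cons))

theorem Runs.reverseP {x : Ty} (l : List x.Val) :
    Runs p T CondSampling.reverseP l (PMF.pure l.reverse) ((l.length + 1) * 60) 0 := by
  have h := Runs.foldP_pure (p := p) (T := T)
    (body := (Prog.comp .snd .cons : Prog (.prod (.list x) (.prod x (.list x))) (.list x)))
    (env := l) (fun st y => y :: st) (fun _ _ => True) (τ := 3) (sb := 0)
    (fun y l st _ => ⟨Runs.simple rfl rfl, trivial⟩) l [] trivial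
  have h2 := Runs.comp_pure (P := (Prog.pair (.pair .id .nil) .id : Prog (.list x) _))
    (x := l) (y := ((l, []), l)) (Runs.simple rfl rfl) h
  have e : List.foldl (fun st y => y :: st) [] l = l.reverse := by
    simp
  rw [e] at h2
  exact h2.mono (by simp only [Prog.cost]; omega) (by omega)

/-- Independent application of a program to the entries of a list. -/
def mapP {e x y : Ty} (body : Prog (.prod e x) y) : Prog (.prod e (.list x)) (.list y) :=
  .comp (.comp (.pair (.pair .fst .nil) .snd) (foldP
    (.comp (.pair (.comp (.pair .fst (.comp .snd .fst)) body) (.comp .snd .snd)) .cons))) reverseP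

theorem Runs.mapP {e x y : Ty} {body : Prog (.prod e x) y} {env : e.Val}
    (κ : x.Val → PMF y.Val) {τ sb : ℕ} {l : List x.Val}
    (hb : ∀ z ∈ l, Runs p T body (env, z) (κ z) τ sb) :
    Runs p T (CondSampling.mapP body) (env, l) (mapD κ l) ((l.length + 1) * (τ + 150))
      (l.length * sb) := by
  have h := Runs.foldP (p := p) (T := T) (env := env)
    (body := Prog.comp (.pair (.comp (.pair .fst (.comp .snd .fst)) body) (.comp .snd .snd)) .cons)
    (fun z st => (κ z).map (· :: st)) (fun l' _ => ∀ z ∈ l', z ∈ l) (τ := τ + 15) (sb := sb)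
    (by
      intro z l' st hl
      refine ⟨?_, fun _ _ z hz => hl z (List.mem_cons_of_mem _ hz)⟩
      have h1 : Runs p T (.pair (.comp (.pair .fst (.comp .snd .fst)) body) (.comp .snd .snd))
          (env, (z, st)) ((κ z).map fun w => (w, st)) _ _ :=
        Runs.pair_pure_right (Runs.comp_pure (y := (env, z)) (Runs.simple rfl rfl)
          (hb z (hl z (by simp)))) (Runs.simple rfl rfl)
      have h2 := h1.comp_map (Q := Prog.cons) (fun w => w.1 :: w.2)
        (fun w _ => Runs.simple rfl rfl)
      rw [PMF.map_comp] at h2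
      exact h2.mono (by simp only [Prog.cost]; omega) (by omega))
    l [] (fun z hz => hz)
  rw [foldD_cons_eq] at h
  have h2 := Runs.comp_pure (P := (Prog.pair (.pair .fst .nil) .snd))
    (x := ((env, l) : Ty.Val (.prod _ (.list _)))) (y := ((env, []), l)) (Runs.simple rfl rfl) h
  have h3 := h2.comp_map (Q := CondSampling.reverseP) (fun l => l.reverse)
    (τ' := (l.length + 1) * 60) (s' := 0) (by
      intro ys hys
      rw [PMF.support_map] at hys
      obtain ⟨zs, hz, rfl⟩ := hys
      have := length_of_mem_support_mapD hz
      have h4 := Runs.reverseP (p := p) (T := T) (x := y) (zs.reverse ++ [])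
      simpa [this] using h4)
  rw [PMF.map_comp] at h3
  -- The final reversal undoes the reversal caused by accumulating with `cons`.
  have e : (mapD κ l).map ((fun l => l.reverse) ∘ fun ys => ys.reverse ++ []) = mapD κ l := by
    convert PMF.map_id (mapD κ l) using 2
    funext ys; simp
  rw [e] at h3
  refine h3.mono ?_ (by omega)
  simp only [Prog.cost]
  nlinarith

theorem Runs.mapP_pure {e x y : Ty} {body : Prog (.prod e x) y} {env : e.Val}
    (g : x.Val → y.Val) {τ sb : ℕ} {l : List x.Val}
    (hb : ∀ z ∈ l, Runs p T body (env, z) (PMF.pure (g z)) τ sb) :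
    Runs p T (CondSampling.mapP body) (env, l) (PMF.pure (l.map g)) ((l.length + 1) * (τ + 150))
      (l.length * sb) := by
  have := Runs.mapP (fun z => PMF.pure (g z)) hb
  rwa [mapD_pure] at this

/-- The list `0, …, n - 1`. -/
def iotaP : Prog .nat (.list .nat) :=
  .comp (.pair .id .nil) (.comp (.loop .fst
    (.comp (.pair (.comp (.pair .fst (.natConst 1)) .natSub) .snd) (.pair .fst .cons))) .snd)

theorem Runs.iotaP (n : ℕ) :
    Runs p T CondSampling.iotaP n (PMF.pure (List.range n)) ((n + 1) * 30) 0 := by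
  -- Counting downwards makes the consed list increasing.
  let g : ℕ × List ℕ → ℕ × List ℕ := fun w => (w.1 - 1, (w.1 - 1) :: w.2)
  have hg : ∀ n acc, g^[n] (n, acc) = (0, List.range n ++ acc) := by
    intro n
    induction n with
    | zero => intro acc; simp
    | succ n ih =>
      intro acc
      rw [Function.iterate_succ_apply]
      simp only [g, Nat.add_sub_cancel]
      rw [ih, List.range_succ]
      simp
  have h := Runs.loop (p := p) (T := T) (a := .prod .nat (.list .nat)) (C := .fst)
    (P := .comp (.pair (.comp (.pair .fst (.natConst 1)) .natSub) .snd) (.pair .fst .cons))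
    (κ := fun w => PMF.pure (g w)) (fun n w => w.1 = n) (τc := 1) (τb := 11) (s := 0)
    (fun n w hw => ⟨w.1, by rw [hw], Runs.simple rfl rfl⟩)
    (fun n w hw => ⟨Runs.simple rfl rfl, fun y hy => by
      simp only [PMF.support_pure, Set.mem_singleton_iff] at hy
      subst hy; simp [g, hw]⟩) n (n, []) rfl
  rw [iterD_pure, hg] at h
  have h2 := Runs.comp_pure (P := (Prog.pair .id .nil : Prog .nat (.prod .nat (.list .nat))))
    (x := n) (y := (n, [])) (Runs.simple rfl rfl)
    (h.comp_pure (Q := .snd) (Runs.simple (y := List.range n) rfl (by simp [Prog.eval])))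
  refine h2.mono ?_ (by omega)
  simp only [Prog.cost]
  nlinarith

/-- The real number zero. -/
def zeroP {a : Ty} : Prog a .real := .comp (.natConst 0) .realOfNat

/-- The mean of independent runs of a program. -/
def meanP {e : Ty} (body : Prog e .real) : Prog (.prod e .nat) .real :=
  .comp (.pair (.comp (.pair (.pair .fst zeroP) (.comp .snd iotaP))
    (foldP (.comp (.pair (.comp .snd .snd) (.comp .fst body)) .realAdd)))
    (.comp .snd .realOfNat)) .realDiv

theorem Runs.meanP {e : Ty} {body : Prog e .real} {env : e.Val} {μ : PMF ℝ} {τ s : ℕ} (K : ℕ)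
    (hb : Runs p T body env μ τ s) :
    Runs p T (CondSampling.meanP body) (env, K) (meanD K μ) ((K + 1) * (τ + 150)) (K * s) := by
  have h := Runs.foldP (p := p) (T := T) (env := env) (x := .nat) (s := .real)
    (body := Prog.comp (.pair (.comp .snd .snd) (.comp .fst body)) .realAdd)
    (fun _ st => μ.map (st + ·)) (fun _ _ => True) (τ := τ + 15) (sb := s)
    (by
      intro z l' st _
      refine ⟨?_, fun _ _ => trivial⟩
      have h1 : Runs p T (.pair (.comp .snd .snd) (.comp .fst body))
          ((env, (z, st)) : Ty.Val (.prod e (.prod .nat .real)))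
          (μ.map fun w => (st, w)) _ _ :=
        Runs.pair_pure_left (Runs.simple rfl rfl)
          (Runs.comp_pure (y := env) (Runs.simple rfl rfl) hb)
      have h2 := h1.comp_map (Q := Prog.realAdd) (fun w => (w.1 : ℝ) + w.2)
        (fun w _ => Runs.simple rfl rfl)
      rw [PMF.map_comp] at h2
      exact h2.mono (by simp only [Prog.cost]; omega) (by omega))
    (List.range K) (0 : ℝ) trivial
  rw [foldD_const_eq_sumD, List.length_range] at h
  have h1 : Runs p T (.pair (.pair .fst zeroP) (.comp .snd CondSampling.iotaP))
      ((env, K) : Ty.Val (.prod e .nat)) (PMF.pure ((env, (0 : ℝ)), List.range K)) _ _ :=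
    Runs.pair_pure (Runs.simple rfl (by simp [Prog.eval, zeroP]))
      (Runs.comp_pure (y := K) (Runs.simple rfl rfl) (Runs.iotaP K))
  have h3 := (h1.comp_pure h).pair_pure_right (Q := .comp .snd .realOfNat) (z := (K : ℝ))
    (Runs.simple rfl rfl)
  have h4 := h3.comp_map (Q := Prog.realDiv) (fun w => (w.1 : ℝ) / w.2)
    (fun w _ => Runs.simple rfl rfl)
  rw [PMF.map_comp] at h4
  refine h4.mono ?_ (by omega)
  simp only [Prog.cost, zeroP]
  nlinarith

/-- Two lists zipped together. -/
def zipP {a b : Ty} : Prog (.prod (.list a) (.list b)) (.list (.prod a b)) :=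
  .comp (.comp (.comp (.pair (.pair (.natConst 0) (.pair .nil .snd)) .fst)
    (foldP (.comp (.pair (.pair (.comp .snd .fst) (.comp (.comp .snd .snd) .fst))
      (.comp (.comp .snd .snd) .snd)) (.listCase (.pair .snd .nil)
        (.pair (.comp (.pair (.pair (.comp .fst .fst) (.comp .snd .fst)) (.comp .fst .snd)) .cons)
          (.comp .snd .snd)))))) .fst) reverseP

/-- The fold runs along `la` and carries the unread part of `lb` in its state; once that is empty
nothing more is added, as in `List.zip`. -/
theorem Runs.zipP {a b : Ty} (la : List a.Val) (lb : List b.Val) :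
    Runs p T CondSampling.zipP (la, lb) (PMF.pure (la.zip lb)) ((la.length + 1) * 200) 0 := by
  let g : List (a.Val × b.Val) × List b.Val → a.Val → List (a.Val × b.Val) × List b.Val :=
    fun st x => match st.2 with
      | [] => (st.1, [])
      | y :: l => ((x, y) :: st.1, l)
  have hg : ∀ (la : List a.Val) (lb : List b.Val) acc,
      (la.foldl g (acc, lb)).1 = (la.zip lb).reverse ++ acc := by
    intro la
    induction la with
    | nil => intro lb acc; simp
    | cons x la ih =>
      intro lb acc
      cases lb with
      | nil => simp [g, ih]
      | cons y lb => simp [g, ih]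
  have h := Runs.foldP_pure (p := p) (T := T) (e := .nat) (x := a)
    (s := .prod (.list (.prod a b)) (.list b)) (env := 0)
    (body := (.comp (.pair (.pair (.comp .snd .fst) (.comp (.comp .snd .snd) .fst))
      (.comp (.comp .snd .snd) .snd)) (.listCase (.pair .snd .nil)
        (.pair (.comp (.pair (.pair (.comp .fst .fst) (.comp .snd .fst)) (.comp .fst .snd)) .cons)
          (.comp .snd .snd)))))
    g (fun _ _ => True) (τ := 45) (sb := 0)
    (by
      rintro z l ⟨acc, lb⟩ _
      refine ⟨Runs.mono (Runs.simple rfl ?_) (by simp [Prog.cost]) le_rfl, trivial⟩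
      cases lb <;> rfl)
    la ([], lb) trivial
  have h2 := ((Runs.comp_pure (P := (Prog.pair (.pair (.natConst 0) (.pair .nil .snd)) .fst))
    (x := ((la, lb) : Ty.Val (.prod (.list a) (.list b)))) (Runs.simple rfl rfl) h).comp_pure
      (Q := .fst) (Runs.simple rfl rfl)).comp_pure (Runs.reverseP _)
  have e : (Prog.eval (a := Ty.prod (.list (.prod a b)) (.list b)) .fst
      (la.foldl g ([], lb))) = (la.zip lb).reverse := by
    have := hg la lb []
    rw [List.append_nil] at this
    exact this
  rw [e, List.reverse_reverse, List.length_reverse] at h2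
  refine h2.mono ?_ (by omega)
  simp only [Prog.cost, List.length_zip]
  nlinarith [min_le_left la.length lb.length]

/-- The least natural number that is at least the input. -/
def ceilP : Prog .real .nat :=
  .comp (.comp (.pair (.natConst 0) .id) (.loop
    (.cond (.comp (.pair .snd (.comp .fst .realOfNat)) .realLe) (.natConst 0) (.natConst 1))
    (.pair (.comp (.pair .fst (.natConst 1)) .natAdd) .snd))) .fst

/-- The machine has no rounding operation, so the ceiling is found by counting up with comparisons.
The time is linear in the value, which is harmless for parameters of polynomial size. -/
theorem Runs.ceilP (x : ℝ) :
    Runs p T CondSampling.ceilP x (PMF.pure ⌈x⌉₊) ((⌈x⌉₊ + 1) * 40) 0 := by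
  let g : ℕ × ℝ → ℕ × ℝ := fun w => (w.1 + 1, w.2)
  have hg : ∀ n k, g^[n] (k, x) = (k + n, x) := by
    intro n
    induction n with
    | zero => intro k; simp
    | succ n ih => intro k; rw [Function.iterate_succ_apply]; simp only [g]; rw [ih]; simp; omega
  have h := Runs.loop (p := p) (T := T) (a := .prod .nat .real)
    (C := .cond (.comp (.pair .snd (.comp .fst .realOfNat)) .realLe) (.natConst 0) (.natConst 1))
    (P := .pair (.comp (.pair .fst (.natConst 1)) .natAdd) .snd)
    (κ := fun w => PMF.pure (g w)) (fun n w => w.2 = x ∧ ⌈x⌉₊ = w.1 + n) (τc := 10) (τb := 7)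
    (s := 0)
    (by
      rintro n ⟨k, y⟩ ⟨hy, hk⟩
      simp only at hy hk
      subst hy
      refine ⟨if y ≤ (k : ℝ) then 0 else 1, ?_, Runs.simple rfl ?_⟩
      · have := Nat.ceil_le (a := y) (n := k)
        split_ifs with h
        · have := this.2 h; simp; omega
        · have := mt this.1 h; simp; omega
      · by_cases h : y ≤ (k : ℝ) <;> simp [Prog.eval, h])
    (by
      rintro n ⟨k, y⟩ ⟨hy, hk⟩
      refine ⟨Runs.simple rfl rfl, fun w hw => ?_⟩
      simp only [PMF.support_pure, Set.mem_singleton_iff] at hw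
      subst hw
      simp only [g] at hy hk ⊢
      exact ⟨hy, by omega⟩) ⌈x⌉₊ (0, x) ⟨rfl, by simp⟩
  rw [iterD_pure, hg] at h
  have h2 := (Runs.comp_pure (P := (Prog.pair (.natConst 0) .id : Prog .real _))
    (x := x) (Runs.simple rfl rfl) h).comp_pure
      (Q := .fst) (Runs.simple (y := ⌈x⌉₊) rfl (by simp [Prog.eval]))
  refine h2.mono ?_ (by omega)
  simp only [Prog.cost]
  nlinarith

/-- The least exponent of a power of two that is at least the input. -/
def log2P : Prog .real .nat :=
  .comp (.comp (.pair (.natConst 0) (.pair (.comp (.natConst 1) .realOfNat) .id)) (.loop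
    (.cond (.comp (.pair (.comp .snd .snd) (.comp .snd .fst)) .realLe) (.natConst 0) (.natConst 1))
    (.pair (.comp (.pair .fst (.natConst 1)) .natAdd)
      (.pair (.comp (.pair (.comp .snd .fst) (.comp .snd .fst)) .realAdd) (.comp .snd .snd))))) .fst

/-- The machine has no logarithm, so `1` is doubled until it reaches `x`. This is correct because
`⌈logb 2 x⌉₊ ≤ k` is equivalent to `x ≤ 2 ^ k`. -/
theorem Runs.log2P (x : ℝ) (hx : 0 < x) :
    Runs p T CondSampling.log2P x (PMF.pure ⌈Real.logb 2 x⌉₊) ((⌈Real.logb 2 x⌉₊ + 1) * 60) 0 := by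
  have hlog : ∀ k : ℕ, ⌈Real.logb 2 x⌉₊ ≤ k ↔ x ≤ 2 ^ k := by
    intro k
    rw [Nat.ceil_le, Real.logb_le_iff_le_rpow (by norm_num) hx, Real.rpow_natCast]
  let g : ℕ × ℝ × ℝ → ℕ × ℝ × ℝ := fun w => (w.1 + 1, (w.2.1 + w.2.1, w.2.2))
  have hg : ∀ n k, (g^[n] (k, (2 ^ k, x))) = (k + n, (2 ^ (k + n), x)) := by
    intro n
    induction n with
    | zero => intro k; simp
    | succ n ih =>
      intro k; rw [Function.iterate_succ_apply]; simp only [g]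
      have e : (2 : ℝ) ^ k + 2 ^ k = 2 ^ (k + 1) := by ring
      rw [e, ih, show k + 1 + n = k + (n + 1) by omega]
  have h := Runs.loop (p := p) (T := T) (a := .prod .nat (.prod .real .real))
    (C := .cond (.comp (.pair (.comp .snd .snd) (.comp .snd .fst)) .realLe) (.natConst 0)
      (.natConst 1))
    (P := .pair (.comp (.pair .fst (.natConst 1)) .natAdd)
      (.pair (.comp (.pair (.comp .snd .fst) (.comp .snd .fst)) .realAdd) (.comp .snd .snd)))
    (κ := fun w => PMF.pure (g w))
    (fun n w => w.2.2 = x ∧ w.2.1 = 2 ^ w.1 ∧ ⌈Real.logb 2 x⌉₊ = w.1 + n) (τc := 12) (τb := 19)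
    (s := 0)
    (by
      rintro n ⟨k, z, y⟩ ⟨hy, hz, hk⟩
      simp only at hy hz hk
      subst hy hz
      refine ⟨if y ≤ 2 ^ k then 0 else 1, ?_, Runs.simple rfl ?_⟩
      · have := hlog k
        split_ifs with h
        · have := this.2 h; simp; omega
        · have := mt this.1 h; simp; omega
      · by_cases h : y ≤ 2 ^ k <;> simp [Prog.eval, h])
    (by
      rintro n ⟨k, z, y⟩ ⟨hy, hz, hk⟩
      refine ⟨Runs.simple rfl rfl, fun w hw => ?_⟩
      simp only [PMF.support_pure, Set.mem_singleton_iff] at hw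
      subst hw
      simp only [g] at hy hz hk ⊢
      exact ⟨hy, by rw [hz]; ring, by omega⟩) ⌈Real.logb 2 x⌉₊ (0, (2 ^ 0, x)) ⟨rfl, rfl, by simp⟩
  rw [iterD_pure, hg] at h
  have h2 := (Runs.comp_pure (P := (Prog.pair (.natConst 0)
      (.pair (.comp (.natConst 1) .realOfNat) .id) : Prog .real _))
    (x := x) (Runs.simple rfl (by simp [Prog.eval])) h).comp_pure
      (Q := .fst) (Runs.simple (y := ⌈Real.logb 2 x⌉₊) rfl (by simp [Prog.eval]))
  refine h2.mono ?_ (by omega)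
  simp only [Prog.cost]
  nlinarith

end

end CondSampling

namespace CondSampling

noncomputable section

variable {O : ℕ} {p : SeqDist O} {T : ℕ}

/-! ### Sampling subroutines -/

/-- The type of histories. -/
abbrev histTy : Ty := .list .nat

theorem length_of_mem_support_condSample {k : ℕ} {h f : List (Fin O)}
    (hf : f ∈ (condSample p k h).support) : f.length = k := by
  induction k generalizing h f with
  | zero => simp [condSample] at hf; simp [hf]
  | succ k ih =>
    simp only [condSample, PMF.support_bind, Set.mem_iUnion, PMF.support_map, Set.mem_image] at hf
    obtain ⟨o, _, g, hg, rfl⟩ := hf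
    simp [ih hg]

theorem length_of_mem_support_oracle {h f : List ℕ} (hf : f ∈ (oracle p T h).support) :
    f.length ≤ T - h.length := by
  rw [oracle] at hf
  split_ifs at hf with hh
  · rw [PMF.support_map] at hf
    obtain ⟨g, hg, rfl⟩ := hf
    simp [length_of_mem_support_condSample hg]
  · simp at hf; simp [hf]

/-- Reversal of a history. -/
def revHistP : Prog histTy histTy := reverseP

theorem Runs.revHistP (h : List ℕ) :
    Runs p T CondSampling.revHistP h (PMF.pure h.reverse) ((h.length + 1) * 60) 0 :=
  Runs.reverseP (x := .nat) h

/-- Whether the first entry of a list is `o`, as a real number. -/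
def headInd (o : ℕ) : List ℕ → ℝ
  | [] => 0
  | x :: _ => if x = o then 1 else 0

/-- Nonzero if and only if the two numbers differ. -/
def neP : Prog (.prod .nat .nat) .nat :=
  .comp (.pair .natSub (.comp (.pair .snd .fst) .natSub)) .natAdd

theorem neP_eval (x y : ℕ) : (neP.eval (x, y) : ℕ) = 0 ↔ x = y := by
  have : (neP.eval (x, y) : ℕ) = (x - y) + (y - x) := rfl
  rw [this, Nat.add_eq_zero_iff]; omega

/-- The real number one. -/
def oneP {a : Ty} : Prog a .real := .comp (.natConst 1) .realOfNat

theorem zeroP_eval {a : Ty} (x : a.Val) : (zeroP : Prog a .real).eval x = (0 : ℝ) := by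
  simp [zeroP, Prog.eval]

theorem oneP_eval {a : Ty} (x : a.Val) : (oneP : Prog a .real).eval x = (1 : ℝ) := by
  simp [oneP, Prog.eval]

/-- Program for `headInd`. -/
def headIndP : Prog (.prod .nat histTy) .real :=
  .listCase zeroP (.cond (.comp (.pair (.comp .snd .fst) .fst) neP) zeroP oneP)

theorem headIndP_eval (o : ℕ) (f : List ℕ) : headIndP.eval (o, f) = headInd o f := by
  cases f with
  | nil => simp [headIndP, Prog.eval, zeroP, headInd]
  | cons x l =>
    have h := neP_eval x o
    have e : headIndP.eval (o, x :: l) = if (neP.eval (x, o) : ℕ) = 0 then (1 : ℝ) else 0 := by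
      rw [← oneP_eval (a := .prod .nat (.prod .nat histTy)) (o, (x, l)),
        ← zeroP_eval (a := .prod .nat (.prod .nat histTy)) (o, (x, l))]
      rfl
    rw [e]
    simp only [h, headInd]

/-- The empirical conditional probability of `o` after `h`, from `N` samples. -/
def phatD (p : SeqDist O) (T N : ℕ) (h : List ℕ) (o : ℕ) : PMF ℝ :=
  meanD N ((oracle p T h).map (headInd o))

/-- Program for `phatD`, with the history reversed. -/
def phatP : Prog (.prod .nat (.prod histTy .nat)) .real :=
  .comp (.pair .snd .fst)
    (meanP (.comp (.pair .snd (.comp (.comp .fst revHistP) .sample)) headIndP))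

theorem Runs.phatP (N : ℕ) (h : List ℕ) (o : ℕ) (hh : h.length ≤ T) :
    Runs p T phatP (N, (h, o)) (phatD p T N h.reverse o) ((N + 1) * (70 * T + 400)) N := by
  have h1 : Runs p T (.comp (.pair .snd (.comp (.comp .fst CondSampling.revHistP) .sample))
      headIndP) ((h, o) : Ty.Val (.prod histTy .nat))
      ((oracle p T h.reverse).map (headInd o)) (70 * T + 200) 1 := by
    have e1 := Runs.comp_pure (p := p) (T := T) (P := (.fst : Prog (.prod histTy .nat) histTy)) (x := (h, o))
      (y := h) (Runs.simple (p := p) (T := T) rfl rfl) (Runs.revHistP h)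
    have e2 := e1.comp_pure (Q := .sample) Runs.sample
    have h2 := Runs.pair_pure_left (P := (.snd : Prog (.prod histTy .nat) .nat)) (x := (h, o))
      (y := o) (Runs.simple rfl rfl) e2
    have h3 := h2.comp_map (Q := headIndP) (fun w => headInd w.1 w.2)
      (fun w _ => Runs.simple rfl (headIndP_eval _ _))
    rw [PMF.map_comp] at h3
    refine h3.mono ?_ (by omega)
    simp only [Prog.cost, headIndP, zeroP, oneP, neP]
    nlinarith
  have h4 := Runs.comp_pure (P := (Prog.pair .snd .fst : Prog (.prod .nat (.prod histTy .nat)) _))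
    (x := (N, (h, o))) (y := ((h, o), N)) (Runs.simple rfl rfl) (Runs.meanP N h1)
  refine h4.mono ?_ (by omega)
  simp only [Prog.cost]
  nlinarith

/-- The estimate of `acc * Pr[f | h]` by the chain rule. -/
def futD (p : SeqDist O) (T N : ℕ) : List ℕ → ℝ → List ℕ → PMF ℝ
  | _, acc, [] => PMF.pure acc
  | h, acc, o :: f => (phatD p T N h o).bind fun q => futD p T N (h ++ [o]) (acc * q) f

/-- Program for `futD`. -/
def futP : Prog (.prod (.prod .nat histTy) histTy) .real :=
  .comp (.comp (.pair (.pair (.comp .fst .fst) (.pair (.comp (.comp .fst .snd) revHistP) oneP))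
    .snd) (foldP (.pair
      (.comp (.pair (.comp .snd .fst) (.comp (.comp .snd .snd) .fst)) .cons)
      (.comp (.pair (.comp (.comp .snd .snd) .snd)
        (.comp (.pair .fst (.pair (.comp (.comp .snd .snd) .fst) (.comp .snd .fst))) phatP))
          .realMul)))) .snd

/-- Time bound for `futP`. -/
def futTime (T N : ℕ) : ℕ := (T + 1) * ((N + 1) * (70 * T + 400) + 400)

/-- The loop keeps the history reversed, so that appending an observation is a `cons`; `phatP`
reverses it again before each oracle call. The invariant keeps the current history plus the unread
future within the horizon. -/
theorem Runs.futP (N : ℕ) (h f : List ℕ) (hh : h.length + f.length ≤ T) :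
    Runs p T futP ((N, h), f) (futD p T N h 1 f) (futTime T N) (T * N) := by
  have hf := Runs.foldP (p := p) (T := T) (e := .nat) (x := .nat) (s := .prod histTy .real)
    (env := N) (body := .pair
      (.comp (.pair (.comp .snd .fst) (.comp (.comp .snd .snd) .fst)) .cons)
      (.comp (.pair (.comp (.comp .snd .snd) .snd)
        (.comp (.pair .fst (.pair (.comp (.comp .snd .snd) .fst) (.comp .snd .fst)))
          CondSampling.phatP)) .realMul))
    (fun o st => (phatD p T N st.1.reverse o).map fun q => (o :: st.1, st.2 * q))
    (fun l st => st.1.length + l.length ≤ T) (τ := (N + 1) * (70 * T + 400) + 40) (sb := N)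
    (by
      rintro o l ⟨hr, acc⟩ hst
      simp only [List.length_cons] at hst
      constructor
      · have e1 := Runs.comp_pure (p := p) (T := T) (P := (.pair .fst (.pair (.comp (.comp .snd .snd) .fst)
            (.comp .snd .fst)) : Prog (.prod .nat (.prod .nat (.prod histTy .real))) _))
          (x := (N, (o, (hr, acc)))) (y := (N, (hr, o))) (Runs.simple rfl rfl)
          (Runs.phatP N hr o (by omega))
        have h1 := Runs.pair_pure_left (p := p) (T := T) (P := (.comp (.comp .snd .snd) .snd :
            Prog (.prod .nat (.prod .nat (.prod histTy .real))) .real))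
          (x := (N, (o, (hr, acc)))) (y := acc) (Runs.simple rfl rfl) e1
        have h2 := h1.comp_map (Q := Prog.realMul) (fun w => (w.1 : ℝ) * w.2)
          (fun w _ => Runs.simple rfl rfl)
        rw [PMF.map_comp] at h2
        have h3 := Runs.pair_pure_left (P := .comp (.pair (.comp .snd .fst)
          (.comp (.comp .snd .snd) .fst)) .cons) (y := o :: hr) (Runs.simple rfl rfl) h2
        rw [PMF.map_comp] at h3
        exact h3.mono (by simp only [Prog.cost]; omega) (by omega)
      · intro st' hst'
        rw [PMF.support_map] at hst'
        obtain ⟨q, _, rfl⟩ := hst'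
        simp only [List.length_cons]
        omega) f (h.reverse, (1 : ℝ)) (by simpa using hh)
  -- Forgetting the history turns the fold into the chain-rule recursion.
  have hlaw : ∀ (f hr : List ℕ) (acc : ℝ),
      (foldD (fun o st => (phatD p T N st.1.reverse o).map fun q => (o :: st.1, st.2 * q))
        f (hr, acc)).map Prod.snd = futD p T N hr.reverse acc f := by
    intro f
    induction f with
    | nil => intro hr acc; simp [foldD, futD, PMF.pure_map]
    | cons o f ih =>
      intro hr acc
      simp only [foldD, futD, PMF.bind_map, PMF.map_bind]
      congr 1
      funext q
      simp only [Function.comp_apply]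
      rw [ih]
      simp
  have e1 := Runs.comp_pure (p := p) (T := T)
    (P := (.comp .fst .snd : Prog (.prod (.prod .nat histTy) histTy) histTy))
    (x := ((N, h), f)) (y := h) (Runs.simple rfl rfl) (Runs.revHistP h)
  have e2 := e1.pair_pure (Q := oneP) (z := (1 : ℝ)) (Runs.simple rfl (oneP_eval _))
  have e3 := Runs.pair_pure (p := p) (T := T)
    (P := (.comp .fst .fst : Prog (.prod (.prod .nat histTy) histTy) .nat))
    (x := ((N, h), f)) (y := N) (Runs.simple rfl rfl) e2
  have h1 := e3.pair_pure (Q := .snd) (z := f) (Runs.simple rfl rfl)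
  have h2 := (h1.comp_pure hf).comp_map (Q := .snd) Prod.snd (fun w _ => Runs.simple rfl rfl)
  rw [hlaw, List.reverse_reverse] at h2
  refine h2.mono ?_ ?_
  · simp only [Prog.cost, oneP, futTime]
    have e1 : f.length ≤ T := by omega
    have e2 : h.length ≤ T := by omega
    have e3 := Nat.mul_le_mul_right ((N + 1) * (70 * T + 400) + 80) (Nat.succ_le_succ e1)
    simp only [Nat.succ_eq_add_one] at e3
    have : (f.length + 1) * ((N + 1) * (70 * T + 400) + 40 + 40)
      = (f.length + 1) * ((N + 1) * (70 * T + 400) + 80) := by ring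
    rw [this]
    nlinarith
  · have : f.length * N ≤ T * N := Nat.mul_le_mul_right _ (by omega)
    omega

/-- The estimate of the sum of `Pr[f | b]` over a list of histories. -/
def denD (p : SeqDist O) (T N : ℕ) (Bl : List (List ℕ)) (f : List ℕ) : PMF ℝ :=
  foldD (fun b s => (futD p T N b 1 f).map (s + ·)) Bl 0

/-- The estimate of the posterior probability of `b` after the future `f`. -/
def postD (p : SeqDist O) (T N : ℕ) (Bl : List (List ℕ)) (b f : List ℕ) : PMF ℝ :=
  (futD p T N b 1 f).bind fun num => (denD p T N Bl f).map fun den => min 1 (num / den)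

/-- The minimum of the input and one. -/
def clipP : Prog .real .real := .cond (.comp (.pair oneP .id) .realLe) oneP .id

theorem clipP_eval (x : ℝ) : clipP.eval x = min 1 x := by
  by_cases h : 1 ≤ x
  · simp [clipP, Prog.eval, oneP, h]
  · simp [clipP, Prog.eval, oneP, h, le_of_not_ge h]

/-- Program for `postD`. -/
def postP : Prog (.prod (.prod .nat (.list histTy)) (.prod histTy histTy)) .real :=
  .comp (.comp (.pair
    (.comp (.pair (.pair (.comp .fst .fst) (.comp .snd .fst)) (.comp .snd .snd)) futP)
    (.comp (.pair (.pair (.pair (.comp .fst .fst) (.comp .snd .snd)) zeroP) (.comp .fst .snd))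
      (foldP (.comp (.pair (.comp .snd .snd)
        (.comp (.pair (.pair (.comp .fst .fst) (.comp .snd .fst)) (.comp .fst .snd)) futP))
          .realAdd)))) .realDiv) clipP

/-- Time bound for `postP`. -/
def postTime (T N n : ℕ) : ℕ := (n + 2) * (futTime T N + 200)

theorem Runs.postP (N : ℕ) {n : ℕ} (Bl : List (List ℕ)) (b f : List ℕ)
    (hB : ∀ h ∈ Bl, h.length + f.length ≤ T) (hb : b.length + f.length ≤ T) (hn : Bl.length ≤ n) :
    Runs p T postP ((N, Bl), (b, f)) (postD p T N Bl b f) (postTime T N n)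
      ((n + 1) * (T * N)) := by
  have hf := Runs.foldP (p := p) (T := T) (e := .prod .nat histTy) (x := histTy) (s := .real)
    (env := (N, f)) (body := .comp (.pair (.comp .snd .snd)
        (.comp (.pair (.pair (.comp .fst .fst) (.comp .snd .fst)) (.comp .fst .snd))
          CondSampling.futP)) .realAdd)
    (fun b s => (futD p T N b 1 f).map (s + ·))
    (fun l st => ∀ h ∈ l, h.length + f.length ≤ T) (τ := futTime T N + 40) (sb := T * N)
    (by
      rintro b l st hl
      refine ⟨?_, fun _ _ h hh => hl h (List.mem_cons_of_mem _ hh)⟩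
      have e1 := Runs.comp_pure (p := p) (T := T) (P := (.pair (.pair (.comp .fst .fst) (.comp .snd .fst))
            (.comp .fst .snd) : Prog (.prod (.prod .nat histTy) (.prod histTy .real)) _))
          (x := ((N, f), (b, st))) (y := ((N, b), f)) (Runs.simple rfl rfl)
          (Runs.futP N b f (hl b (by simp)))
      have h1 := Runs.pair_pure_left (p := p) (T := T) (P := (.comp .snd .snd :
            Prog (.prod (.prod .nat histTy) (.prod histTy .real)) .real))
          (x := ((N, f), (b, st))) (y := st) (Runs.simple rfl rfl) e1
      have h2 := h1.comp_map (Q := Prog.realAdd) (fun w => (w.1 : ℝ) + w.2)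
        (fun w _ => Runs.simple rfl rfl)
      rw [PMF.map_comp] at h2
      exact h2.mono (by simp only [Prog.cost]; omega) (by omega)) Bl (0 : ℝ) hB
  have h1 := Runs.comp_pure (p := p) (T := T)
    (P := (.pair (.pair (.pair (.comp .fst .fst) (.comp .snd .snd)) zeroP) (.comp .fst .snd) :
      Prog (.prod (.prod .nat (.list histTy)) (.prod histTy histTy)) _))
    (x := ((N, Bl), (b, f))) (y := (((N, f), (0 : ℝ)), Bl))
    (Runs.simple rfl (by simp [Prog.eval, zeroP])) hf
  have h2 := Runs.comp_pure (p := p) (T := T)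
    (P := (.pair (.pair (.comp .fst .fst) (.comp .snd .fst)) (.comp .snd .snd) :
      Prog (.prod (.prod .nat (.list histTy)) (.prod histTy histTy)) _))
    (x := ((N, Bl), (b, f))) (y := ((N, b), f)) (Runs.simple rfl rfl) (Runs.futP N b f hb)
  have h3 := ((h2.pair h1).comp_map (Q := .realDiv) (fun w => (w.1 : ℝ) / w.2)
    (fun w _ => Runs.simple rfl rfl)).comp_map (Q := clipP) (fun x => min 1 x)
    (fun w _ => Runs.simple rfl (clipP_eval w))
  simp only [PMF.map_bind, PMF.map_comp] at h3
  refine h3.mono ?_ ?_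
  · simp only [Prog.cost, zeroP, oneP, clipP, postTime]
    have e := Nat.mul_le_mul_right (futTime T N + 80) (Nat.succ_le_succ hn)
    simp only [Nat.succ_eq_add_one] at e
    have : (Bl.length + 1) * (futTime T N + 40 + 40)
      = (Bl.length + 1) * (futTime T N + 80) := by ring
    rw [this]
    nlinarith
  · have := Nat.mul_le_mul_right (T * N) hn
    nlinarith

/-- The estimate of the posterior probability after the prefix `w` (at most one observation) has
been removed from the future; zero if `w` is not a prefix. -/
def stripD (p : SeqDist O) (T N : ℕ) (Bl : List (List ℕ)) (b : List ℕ) : List ℕ → List ℕ → PMF ℝ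
  | [], f => postD p T N Bl b f
  | _ :: _, [] => PMF.pure 0
  | o :: _, x :: f => if x = o then postD p T N Bl b f else PMF.pure 0

/-- A single sample for an entry of the empirical matrices. -/
def entryD (p : SeqDist O) (T N : ℕ) (Bl : List (List ℕ)) (b w x : List ℕ) : PMF ℝ :=
  (oracle p T x).bind fun f => stripD p T N Bl b w f

/-- Type of the environment of `entryP`. -/
abbrev entryTy : Ty := .prod (.prod .nat (.list histTy)) (.prod histTy (.prod histTy histTy))

/-- Program for `entryD`. -/
def entryP : Prog entryTy .real :=
  .comp (.pair .id (.comp (.comp (.comp .snd .snd) .snd) .sample))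
    (.comp (.pair .id (.comp (.comp (.comp .fst .snd) .snd) .fst)) (.listCase
      (.comp (.pair (.comp .fst .fst) (.pair (.comp (.comp .fst .snd) .fst) .snd)) postP)
      (.comp (.pair (.pair (.comp .fst .fst) (.comp .snd .fst)) (.comp .fst .snd)) (.listCase zeroP
        (.cond (.comp (.pair (.comp .snd .fst) (.comp .fst .snd)) neP) zeroP
          (.comp (.pair (.comp (.comp .fst .fst) .fst)
            (.pair (.comp (.comp (.comp .fst .fst) .snd) .fst) (.comp .snd .snd))) postP))))))

/-- Time bound for `entryP`. -/
def entryTime (T N n : ℕ) : ℕ := postTime T N n + T + 200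

/-- The prefix `w` is empty for the matrix of the system and `[o]` for the right-hand side. A
sampled future has length at most `T - x.length`; once `w` is removed it fits after any history of
length at most `x.length + w.length`, so all queries for the posterior respect the horizon. -/
theorem Runs.entryP (N : ℕ) {n : ℕ} (Bl : List (List ℕ)) (b w x : List ℕ) (hw : w.length ≤ 1)
    (hB : ∀ h ∈ Bl, h.length ≤ x.length + w.length) (hb : b.length ≤ x.length + w.length)
    (hx : x.length + w.length ≤ T) (hn : Bl.length ≤ n) :
    Runs p T entryP ((N, Bl), (b, (w, x))) (entryD p T N Bl b w x) (entryTime T N n)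
      ((n + 1) * (T * N) + 1) := by
  have h1 : Runs p T (.pair .id (.comp (.comp (.comp .snd .snd) .snd) .sample))
      (((N, Bl), (b, (w, x))) : entryTy.Val)
      ((oracle p T x).map fun f => (((N, Bl), (b, (w, x))), f)) _ _ :=
    Runs.pair_pure_left (Runs.simple rfl rfl)
      (Runs.comp_pure (y := x) (Runs.simple rfl rfl) Runs.sample)
  have h2 := h1.comp (Q := .comp (.pair .id (.comp (.comp (.comp .fst .snd) .snd) .fst)) (.listCase
      (.comp (.pair (.comp .fst .fst) (.pair (.comp (.comp .fst .snd) .fst) .snd))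
        CondSampling.postP)
      (.comp (.pair (.pair (.comp .fst .fst) (.comp .snd .fst)) (.comp .fst .snd)) (.listCase zeroP
        (.cond (.comp (.pair (.comp .snd .fst) (.comp .fst .snd)) neP) zeroP
          (.comp (.pair (.comp (.comp .fst .fst) .fst)
            (.pair (.comp (.comp (.comp .fst .fst) .snd) .fst) (.comp .snd .snd)))
              CondSampling.postP))))))
    (κ := fun y => stripD p T N Bl b w y.2) (τ' := postTime T N n + 150)
    (s' := (n + 1) * (T * N)) (by
      intro y hy
      rw [PMF.support_map] at hy
      obtain ⟨f, hf, rfl⟩ := hy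
      have hlen := length_of_mem_support_oracle hf
      refine Runs.mono (Runs.comp_pure (y := ((((N, Bl), (b, (w, x))), f), w))
        (τ' := postTime T N n + 100) (s' := (n + 1) * (T * N)) (Runs.simple rfl rfl)
          (Runs.mono (Runs.listCase (τ := postTime T N n + 90) (s := (n + 1) * (T * N)) ?_ ?_)
            (by omega) le_rfl)) (by simp only [Prog.cost]; omega) (by omega)
      · rintro rfl
        simp only [List.length_nil, add_zero] at hB hb hx
        exact (Runs.comp_pure (y := ((N, Bl), (b, f))) (Runs.simple rfl rfl)
          (Runs.postP N Bl b f (fun h hh => by have := hB h hh; omega) (by omega) hn)).mono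
            (by simp only [Prog.cost]; omega) (by omega)
      · rintro o w' rfl
        refine Runs.mono (Runs.comp_pure (y := ((((N, Bl), (b, (o :: w', x))), o), f))
          (τ' := postTime T N n + 70) (s' := (n + 1) * (T * N)) (Runs.simple rfl rfl)
            (Runs.mono (Runs.listCase (τ := postTime T N n + 60) (s := (n + 1) * (T * N)) ?_ ?_)
              (by omega) le_rfl)) (by simp only [Prog.cost]; omega) (by omega)
        · rintro rfl
          exact Runs.mono (Runs.simple rfl (zeroP_eval _)) (by simp [Prog.cost, zeroP])
            (by omega)
        · rintro z f' rfl
          refine Runs.mono (Runs.cond (k := neP.eval (z, o)) (τ := postTime T N n + 30)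
            (s := (n + 1) * (T * N)) (Runs.simple rfl rfl) ?_ ?_)
            (by simp only [Prog.cost, neP]; omega) le_rfl
          · intro hk
            rw [ne_eq, neP_eval] at hk
            simp only [stripD, if_neg hk]
            exact Runs.mono (Runs.simple rfl (zeroP_eval _)) (by simp [Prog.cost, zeroP])
              (by omega)
          · intro hk
            rw [neP_eval] at hk
            simp only [stripD, if_pos hk]
            simp only [List.length_cons] at hlen hB hb hx hw
            exact (Runs.comp_pure (y := ((N, Bl), (b, f'))) (Runs.simple rfl rfl)
              (Runs.postP N Bl b f' (fun h hh => by have := hB h hh; omega) (by omega) hn)).mono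
                (by simp only [Prog.cost]; omega) (by omega))
  rw [PMF.bind_map] at h2
  refine h2.mono ?_ (by omega)
  simp only [Prog.cost, entryTime]
  omega

/-- The empirical matrix, by rows. -/
def matD (p : SeqDist O) (T N S : ℕ) (Bl : List (List ℕ)) (w : List ℕ) (Bs : List (List ℕ)) :
    PMF (List (List ℝ)) :=
  mapD (fun b => mapD (fun x => meanD S (entryD p T N Bl b w x)) Bs) Bl

/-- Type of the environment of `matP`. -/
abbrev matTy : Ty := .prod (.prod .nat (.list histTy)) (.prod .nat (.prod histTy (.list histTy)))

/-- Program for `matD`. -/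
def matP : Prog matTy (.list (.list .real)) :=
  .comp (.pair .id (.comp .fst .snd)) (mapP
    (.comp (.pair .id (.comp (.comp (.comp .fst .snd) .snd) .snd)) (mapP
      (.comp (.pair (.pair (.comp (.comp .fst .fst) .fst) (.pair (.comp .fst .snd)
        (.pair (.comp (.comp (.comp (.comp .fst .fst) .snd) .snd) .fst) .snd)))
          (.comp (.comp (.comp .fst .fst) .snd) .fst)) (meanP entryP)))))

/-- Time bound for `matP`. -/
def matTime (T N S n : ℕ) : ℕ :=
  (n + 1) * ((n + 1) * ((S + 1) * (entryTime T N n + 150) + 300) + 300)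

theorem Runs.matP (N S : ℕ) {n : ℕ} (Bl : List (List ℕ)) (w : List ℕ) (Bs : List (List ℕ))
    (hw : w.length ≤ 1) (hB : ∀ h ∈ Bl, ∀ x ∈ Bs, h.length ≤ x.length + w.length)
    (hx : ∀ x ∈ Bs, x.length + w.length ≤ T) (hn : Bl.length ≤ n) (hs : Bs.length ≤ n) :
    Runs p T matP ((N, Bl), (S, (w, Bs))) (matD p T N S Bl w Bs) (matTime T N S n)
      (n * (n * (S * ((n + 1) * (T * N) + 1)))) := by
  have h1 := Runs.mapP (p := p) (T := T) (e := matTy) (env := ((N, Bl), (S, (w, Bs)))) (l := Bl)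
    (body := (.comp (.pair .id (.comp (.comp (.comp .fst .snd) .snd) .snd)) (CondSampling.mapP
      (.comp (.pair (.pair (.comp (.comp .fst .fst) .fst) (.pair (.comp .fst .snd)
        (.pair (.comp (.comp (.comp (.comp .fst .fst) .snd) .snd) .fst) .snd)))
          (.comp (.comp (.comp .fst .fst) .snd) .fst)) (CondSampling.meanP
            CondSampling.entryP)))))
    (fun b => mapD (fun x => meanD S (entryD p T N Bl b w x)) Bs)
    (τ := (n + 1) * ((S + 1) * (entryTime T N n + 150) + 200) + 20)
    (sb := n * (S * ((n + 1) * (T * N) + 1)))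
    (by
      intro b hb
      have h2 := Runs.mapP (p := p) (T := T) (e := .prod matTy histTy)
        (env := (((N, Bl), (S, (w, Bs))), b)) (l := Bs)
        (body := (.comp (.pair (.pair (.comp (.comp .fst .fst) .fst) (.pair (.comp .fst .snd)
          (.pair (.comp (.comp (.comp (.comp .fst .fst) .snd) .snd) .fst) .snd)))
            (.comp (.comp (.comp .fst .fst) .snd) .fst)) (CondSampling.meanP
              CondSampling.entryP)))
        (fun x => meanD S (entryD p T N Bl b w x))
        (τ := (S + 1) * (entryTime T N n + 150) + 50)
        (sb := S * ((n + 1) * (T * N) + 1))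
        (by
          intro x hxs
          exact (Runs.comp_pure (y := (((N, Bl), (b, (w, x))), S)) (Runs.simple rfl rfl)
            (Runs.meanP S (Runs.entryP N Bl b w x hw (fun h hh => hB h hh x hxs) (hB b hb x hxs)
              (hx x hxs) hn))).mono (by simp only [Prog.cost]; omega) (by omega))
      refine (Runs.comp_pure (y := ((((N, Bl), (S, (w, Bs))), b), Bs)) (Runs.simple rfl rfl)
        h2).mono ?_ ?_
      · have := Nat.mul_le_mul_right ((S + 1) * (entryTime T N n + 150) + 200)
          (Nat.succ_le_succ hs)
        simp only [Nat.succ_eq_add_one] at this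
        simp only [Prog.cost]
        have e : (Bs.length + 1) * ((S + 1) * (entryTime T N n + 150) + 50 + 150)
          = (Bs.length + 1) * ((S + 1) * (entryTime T N n + 150) + 200) := by ring
        rw [e]; omega
      · have := Nat.mul_le_mul_right (S * ((n + 1) * (T * N) + 1)) hs
        omega)
  refine (Runs.comp_pure (y := (((N, Bl), (S, (w, Bs))), Bl)) (Runs.simple rfl rfl) h1).mono ?_ ?_
  · simp only [Prog.cost, matTime]
    generalize (S + 1) * (entryTime T N n + 150) = u
    have := Nat.mul_le_mul_right ((n + 1) * (u + 200) + 20 + 150) (Nat.succ_le_succ hn)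
    simp only [Nat.succ_eq_add_one] at this
    nlinarith
  · have := Nat.mul_le_mul_right (n * (S * ((n + 1) * (T * N) + 1))) hn
    omega

end

end CondSampling

namespace CondSampling

noncomputable section

variable {O : ℕ} {p : SeqDist O} {T : ℕ}

/-! ### Landweber iteration -/

/-- The type of vectors. -/
abbrev vecTy : Ty := .list .real

/-- The type of matrices, as lists of rows. -/
abbrev rowsTy : Ty := .list vecTy

/-- `acc - k v` for vectors given by lists. -/
def axpy (acc : List ℝ) (k : ℝ) (v : List ℝ) : List ℝ := (acc.zip v).map fun z => z.1 - k * z.2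

/-- One row of a Landweber step. -/
def stepRow (X : List (List ℝ)) (z : List ℝ × List ℝ × List ℝ) : List ℝ :=
  (((0 : ℝ) - 1, z.2.1) :: z.1.zip X).foldl (fun acc kv => axpy acc kv.1 kv.2) z.2.2

/-- The Landweber step `X + R - Q X`, by rows. -/
def stepRows (Q R X : List (List ℝ)) : List (List ℝ) := (Q.zip (R.zip X)).map (stepRow X)

theorem length_axpy_le (acc v : List ℝ) (k : ℝ) : (axpy acc k v).length ≤ acc.length := by
  simp [axpy]

theorem length_stepRow_le (X : List (List ℝ)) (z : List ℝ × List ℝ × List ℝ) :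
    (stepRow X z).length ≤ z.2.2.length := by
  rw [stepRow]
  generalize ((0 : ℝ) - 1, z.2.1) :: z.1.zip X = l
  generalize z.2.2 = acc
  induction l generalizing acc with
  | nil => simp
  | cons y l ih => exact (ih _).trans (length_axpy_le _ _ _)

/-- Program for `axpy`. -/
def axpyP : Prog (.prod rowsTy (.prod (.prod .real vecTy) vecTy)) vecTy :=
  .comp (.pair (.comp (.comp .snd .fst) .fst)
    (.comp (.pair (.comp .snd .snd) (.comp (.comp .snd .fst) .snd)) zipP))
    (mapP (.comp (.pair (.comp .snd .fst) (.comp (.pair .fst (.comp .snd .snd)) .realMul))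
      .realSub))

theorem Runs.axpyP (X : List (List ℝ)) (k : ℝ) (v acc : List ℝ) {n : ℕ} (hn : acc.length ≤ n) :
    Runs p T axpyP (X, ((k, v), acc)) (PMF.pure (axpy acc k v)) ((n + 1) * 500) 0 := by
  have e1 := Runs.comp_pure (p := p) (T := T)
    (P := (.pair (.comp .snd .snd) (.comp (.comp .snd .fst) .snd) :
      Prog (.prod rowsTy (.prod (.prod .real vecTy) vecTy)) (.prod vecTy vecTy)))
    (x := (X, ((k, v), acc))) (y := (acc, v)) (Runs.simple rfl rfl) (Runs.zipP (a := .real) (b := .real) acc v)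
  have e2 := Runs.pair_pure (p := p) (T := T)
    (P := (.comp (.comp .snd .fst) .fst :
      Prog (.prod rowsTy (.prod (.prod .real vecTy) vecTy)) .real))
    (x := (X, ((k, v), acc))) (y := k) (Runs.simple rfl rfl) e1
  have e3 := Runs.mapP_pure (p := p) (T := T) (e := .real) (x := .prod .real .real) (y := .real)
    (body := .comp (.pair (.comp .snd .fst) (.comp (.pair .fst (.comp .snd .snd)) .realMul))
      .realSub) (env := k) (l := acc.zip v) (fun z => (z.1 : ℝ) - k * z.2) (τ := 20) (sb := 0)
    (fun z _ => Runs.mono (Runs.simple rfl rfl) (by simp [Prog.cost]) le_rfl)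
  refine (e2.comp_pure e3).mono ?_ (by omega)
  simp only [Prog.cost, List.length_zip]
  have := min_le_left acc.length v.length
  omega

/-- Program for `stepRow`. -/
def stepRowP : Prog (.prod rowsTy (.prod vecTy (.prod vecTy vecTy))) vecTy :=
  .comp (.pair (.pair .fst (.comp (.comp .snd .snd) .snd))
    (.comp (.pair (.pair (.comp (.pair zeroP oneP) .realSub) (.comp (.comp .snd .snd) .fst))
      (.comp (.pair (.comp .snd .fst) .fst) zipP)) .cons)) (foldP axpyP)

/-- The pair `(-1, r)` at the head of the list adds `r` by the same operation `axpy` that subtracts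
the multiples of the rows of `X`. -/
theorem Runs.stepRowP (X : List (List ℝ)) (q r x : List ℝ) {n : ℕ} (hx : x.length ≤ n)
    (hq : q.length ≤ n) :
    Runs p T stepRowP (X, (q, (r, x))) (PMF.pure (stepRow X (q, (r, x))))
      ((n + 2) * ((n + 1) * 1000)) 0 := by
  have e1 := Runs.comp_pure (p := p) (T := T)
    (P := (.pair (.comp .snd .fst) .fst :
      Prog (.prod rowsTy (.prod vecTy (.prod vecTy vecTy))) (.prod vecTy rowsTy)))
    (x := (X, (q, (r, x)))) (y := (q, X)) (Runs.simple rfl rfl) (Runs.zipP (a := .real) (b := vecTy) q X)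
  have e2 := Runs.pair_pure (p := p) (T := T)
    (P := (.pair (.comp (.pair zeroP oneP) .realSub) (.comp (.comp .snd .snd) .fst) :
      Prog (.prod rowsTy (.prod vecTy (.prod vecTy vecTy))) (.prod .real vecTy)))
    (x := (X, (q, (r, x)))) (y := ((0 : ℝ) - 1, r))
    (Runs.simple rfl (by simp [Prog.eval, zeroP, oneP])) e1
  have e3 := e2.comp_pure (Q := .cons) (Runs.simple rfl rfl)
  have e4 := Runs.pair_pure (p := p) (T := T)
    (P := (.pair .fst (.comp (.comp .snd .snd) .snd) :
      Prog (.prod rowsTy (.prod vecTy (.prod vecTy vecTy))) (.prod rowsTy vecTy)))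
    (x := (X, (q, (r, x)))) (y := (X, x)) (Runs.simple rfl rfl) e3
  have e5 := Runs.foldP_pure (p := p) (T := T) (e := rowsTy) (x := .prod .real vecTy)
    (s := vecTy) (body := CondSampling.axpyP) (env := X) (fun acc kv => axpy acc kv.1 kv.2)
    (fun _ acc => List.length (α := ℝ) acc ≤ n) (τ := (n + 1) * 500) (sb := 0)
    (fun kv l acc h => ⟨Runs.axpyP X kv.1 kv.2 acc h, (length_axpy_le _ _ _).trans h⟩)
    (((0 : ℝ) - 1, r) :: q.zip X) x hx
  refine (e4.comp_pure e5).mono ?_ (by omega)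
  simp only [Prog.cost, List.length_cons, List.length_zip, zeroP, oneP]
  have h1 := min_le_left q.length X.length
  generalize min q.length X.length = u at h1
  have : (u + 1 + 1) * ((n + 1) * 500 + 40) ≤ (n + 2) * ((n + 1) * 500 + 40) :=
    Nat.mul_le_mul_right _ (by omega)
  nlinarith

/-- Program for `stepRows`. -/
def stepP : Prog (.prod (.prod rowsTy rowsTy) rowsTy) rowsTy :=
  .comp (.pair .snd (.comp (.pair (.comp .fst .fst)
    (.comp (.pair (.comp .fst .snd) .snd) zipP)) zipP)) (mapP stepRowP)

/-- Time bound for `stepP`. -/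
def stepTime (n : ℕ) : ℕ := (n + 1) * ((n + 2) * ((n + 1) * 1000) + 1000)

theorem Runs.stepP (Q R X : List (List ℝ)) {n : ℕ} (hQ : Q.length ≤ n) (hR : R.length ≤ n)
    (hQr : ∀ q ∈ Q, q.length ≤ n) (hX : ∀ x ∈ X, x.length ≤ n) :
    Runs p T stepP ((Q, R), X) (PMF.pure (stepRows Q R X)) (stepTime n) 0 := by
  have e1 := Runs.comp_pure (p := p) (T := T)
    (P := (.pair (.comp .fst .snd) .snd :
      Prog (.prod (.prod rowsTy rowsTy) rowsTy) (.prod rowsTy rowsTy)))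
    (x := ((Q, R), X)) (y := (R, X)) (Runs.simple rfl rfl) (Runs.zipP (a := vecTy) (b := vecTy) R X)
  have e2 := Runs.pair_pure (p := p) (T := T)
    (P := (.comp .fst .fst : Prog (.prod (.prod rowsTy rowsTy) rowsTy) rowsTy))
    (x := ((Q, R), X)) (y := Q) (Runs.simple rfl rfl) e1
  have e3 := e2.comp_pure (Q := CondSampling.zipP) (Runs.zipP (a := vecTy) (b := .prod vecTy vecTy) Q _)
  have e4 := Runs.pair_pure (p := p) (T := T)
    (P := (.snd : Prog (.prod (.prod rowsTy rowsTy) rowsTy) rowsTy))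
    (x := ((Q, R), X)) (y := X) (Runs.simple rfl rfl) e3
  have e5 := Runs.mapP_pure (p := p) (T := T) (e := rowsTy)
    (x := .prod vecTy (.prod vecTy vecTy)) (y := vecTy)
    (body := CondSampling.stepRowP) (env := X) (l := Q.zip (R.zip X)) (stepRow X)
    (τ := (n + 2) * ((n + 1) * 1000)) (sb := 0)
    (fun z hz => by
      obtain ⟨q, r, x⟩ := z
      have h1 := List.of_mem_zip hz
      exact Runs.stepRowP X q r x (hX x (List.of_mem_zip h1.2).2) (hQr q h1.1))
  refine (e4.comp_pure e5).mono ?_ (by omega)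
  simp only [Prog.cost, List.length_zip, stepTime]
  have h1 := (min_le_left Q.length (min R.length X.length)).trans hQ
  generalize min Q.length (min R.length X.length) = u at h1
  have : (u + 1) * ((n + 2) * ((n + 1) * 1000) + 150)
      ≤ (n + 1) * ((n + 2) * ((n + 1) * 1000) + 150) := Nat.mul_le_mul_right _ (by omega)
  nlinarith

/-- The Landweber iteration. -/
def lwRows (Q R : List (List ℝ)) (J : ℕ) : List (List ℝ) := (stepRows Q R)^[J] R

/-- Program for `lwRows`. -/
def lwP : Prog (.prod (.prod rowsTy rowsTy) .nat) rowsTy :=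
  .comp (.pair (.pair .fst (.comp .fst .snd)) (.comp .snd iotaP))
    (foldP (.comp (.pair .fst (.comp .snd .snd)) stepP))

/-- Time bound for `lwP`. -/
def lwTime (J n : ℕ) : ℕ := (J + 1) * (stepTime n + 200)

theorem Runs.lwP (Q R : List (List ℝ)) (J : ℕ) {n : ℕ} (hQ : Q.length ≤ n) (hR : R.length ≤ n)
    (hQr : ∀ q ∈ Q, q.length ≤ n) (hRr : ∀ x ∈ R, x.length ≤ n) :
    Runs p T lwP ((Q, R), J) (PMF.pure (lwRows Q R J)) (lwTime J n) 0 := by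
  have e1 := Runs.comp_pure (p := p) (T := T)
    (P := (.snd : Prog (.prod (.prod rowsTy rowsTy) .nat) .nat))
    (x := ((Q, R), J)) (y := J) (Runs.simple rfl rfl) (Runs.iotaP J)
  have e2 := Runs.pair_pure (p := p) (T := T)
    (P := (.pair .fst (.comp .fst .snd) :
      Prog (.prod (.prod rowsTy rowsTy) .nat) (.prod (.prod rowsTy rowsTy) rowsTy)))
    (x := ((Q, R), J)) (y := ((Q, R), R)) (Runs.simple rfl rfl) e1
  have e3 := Runs.foldP_pure (p := p) (T := T) (e := .prod rowsTy rowsTy) (x := .nat)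
    (s := rowsTy) (body := .comp (.pair .fst (.comp .snd .snd)) CondSampling.stepP)
    (env := (Q, R)) (fun X _ => stepRows Q R X)
    -- Row lengths never grow, so one time bound holds for all iterations.
    (fun _ X => ∀ x ∈ X, List.length (α := ℝ) x ≤ n) (τ := stepTime n + 10) (sb := 0)
    (fun _ l X h => ⟨(Runs.comp_pure (y := ((Q, R), X)) (Runs.simple rfl rfl)
        (Runs.stepP Q R X hQ hR hQr h)).mono (by simp only [Prog.cost]; omega) (by omega), by
      intro x hx
      simp only [stepRows, List.mem_map] at hx
      obtain ⟨⟨q, r, y⟩, hz, rfl⟩ := hx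
      exact (length_stepRow_le _ _).trans (h y (List.of_mem_zip (List.of_mem_zip hz).2).2)⟩)
    (List.range J) R hRr
  rw [List.foldl_const, List.length_range] at e3
  refine (e2.comp_pure e3).mono ?_ (by omega)
  simp only [Prog.cost, lwTime]
  nlinarith

/-! ### The learner -/

/-- The dimensions hold on every outcome, as is needed for a worst-case time bound of the iteration
run on random matrices. -/
theorem length_of_mem_support_matD {N S : ℕ} {Bl : List (List ℕ)} {w : List ℕ}
    {Bs : List (List ℕ)} {M : List (List ℝ)} (h : M ∈ (matD p T N S Bl w Bs).support) :
    M.length = Bl.length ∧ ∀ row ∈ M, row.length = Bs.length := by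
  refine ⟨length_of_mem_support_mapD h, ?_⟩
  have h1 := forall₂_of_mem_support_mapD (R := fun _ row => row.length = Bs.length)
    (fun x _ y hy => length_of_mem_support_mapD hy) h
  clear h
  induction h1 with
  | nil => simp
  | cons h _ ih => simpa using ⟨h, ih⟩

/-- The law of the estimated operator. -/
def opD (p : SeqDist O) (T N S J : ℕ) (Bl Bl' : List (List ℕ)) (o : ℕ) : PMF (List (List ℝ)) :=
  (matD p T N S Bl' [] Bl').bind fun Q =>
    (matD p T N S Bl' [o] Bl).map fun R => lwRows Q R J

/-- The numbers `N, S, J`. -/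
abbrev paramTy : Ty := .prod .nat (.prod .nat .nat)

/-- Type of the environment of `opP`. -/
abbrev opTy : Ty := .prod (.prod paramTy (.prod (.list histTy) (.list histTy))) .nat

/-- Program for `opD`. -/
def opP : Prog opTy rowsTy :=
  .comp (.pair (.pair
    (.comp (.pair (.pair (.comp (.comp .fst .fst) .fst) (.comp (.comp .fst .snd) .snd))
      (.pair (.comp (.comp (.comp .fst .fst) .snd) .fst) (.pair .nil (.comp (.comp .fst .snd) .snd))))
        matP)
    (.comp (.pair (.pair (.comp (.comp .fst .fst) .fst) (.comp (.comp .fst .snd) .snd))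
      (.pair (.comp (.comp (.comp .fst .fst) .snd) .fst)
        (.pair (.comp (.pair .snd .nil) .cons) (.comp (.comp .fst .snd) .fst)))) matP))
    (.comp (.comp (.comp .fst .fst) .snd) .snd)) lwP

/-- Time bound for `opP`. -/
def opTime (T N S J n : ℕ) : ℕ := 2 * matTime T N S n + lwTime J n + 100

/-- Number of samples of `opP`. -/
def opSamples (T N S n : ℕ) : ℕ := 2 * (n * (n * (S * ((n + 1) * (T * N) + 1))))

theorem Runs.opP (N S J : ℕ) {n t : ℕ} (Bl Bl' : List (List ℕ)) (o : ℕ) (ht : t + 1 ≤ T)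
    (hB : ∀ x ∈ Bl, x.length = t) (hB' : ∀ x ∈ Bl', x.length = t + 1) (hn : Bl.length ≤ n)
    (hn' : Bl'.length ≤ n) :
    Runs p T opP (((N, (S, J)), (Bl, Bl')), o) (opD p T N S J Bl Bl' o) (opTime T N S J n)
      (opSamples T N S n) := by
  have e1 := Runs.comp_pure (p := p) (T := T)
    (P := (.pair (.pair (.comp (.comp .fst .fst) .fst) (.comp (.comp .fst .snd) .snd))
      (.pair (.comp (.comp (.comp .fst .fst) .snd) .fst)
        (.pair .nil (.comp (.comp .fst .snd) .snd))) : Prog opTy matTy))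
    (x := (((N, (S, J)), (Bl, Bl')), o)) (y := ((N, Bl'), (S, ([], Bl')))) (Runs.simple rfl rfl)
    (Runs.matP N S Bl' [] Bl' (by simp)
      (fun h hh x hx => by simp [hB' h hh, hB' x hx])
      (fun x hx => by simpa [hB' x hx] using ht) hn' hn')
  have e2 := Runs.comp_pure (p := p) (T := T)
    (P := (.pair (.pair (.comp (.comp .fst .fst) .fst) (.comp (.comp .fst .snd) .snd))
      (.pair (.comp (.comp (.comp .fst .fst) .snd) .fst)
        (.pair (.comp (.pair .snd .nil) .cons) (.comp (.comp .fst .snd) .fst))) :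
          Prog opTy matTy))
    (x := (((N, (S, J)), (Bl, Bl')), o)) (y := ((N, Bl'), (S, ([o], Bl)))) (Runs.simple rfl rfl)
    (Runs.matP N S Bl' [o] Bl (by simp)
      (fun h hh x hx => by simp [hB' h hh, hB x hx])
      (fun x hx => by simpa [hB x hx] using ht) hn' hn)
  have e3 := (e1.pair e2).pair_pure_right (Q := .comp (.comp (.comp .fst .fst) .snd) .snd)
    (z := J) (Runs.simple rfl rfl)
  have e4 := e3.comp_map (Q := CondSampling.lwP) (fun w => lwRows w.1.1 w.1.2 w.2)
    (τ' := lwTime J n) (s' := 0) (by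
      intro w hw
      rw [PMF.support_map] at hw
      obtain ⟨⟨Q, R⟩, hQR, rfl⟩ := hw
      simp only [PMF.support_bind, Set.mem_iUnion, PMF.support_map, Set.mem_image] at hQR
      obtain ⟨Q', hQ, R', hR, hQR⟩ := hQR
      obtain ⟨rfl, rfl⟩ := Prod.mk.inj hQR
      have h1 := length_of_mem_support_matD hQ
      have h2 := length_of_mem_support_matD hR
      exact Runs.lwP Q' R' J (h1.1.le.trans hn') (h2.1.le.trans hn')
        (fun q hq => (h1.2 q hq).le.trans hn') (fun q hq => (h2.2 q hq).le.trans hn))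
  simp only [PMF.map_bind, PMF.map_comp] at e4
  refine e4.mono ?_ ?_
  · simp only [Prog.cost, opTime]; omega
  · simp only [opSamples]; omega

/-- Program that estimates the operators of all observations at one length. -/
def levelP : Prog (.prod (.prod paramTy .nat) (.prod (.list histTy) (.list histTy)))
    (.list rowsTy) :=
  .comp (.pair (.pair (.comp .fst .fst) .snd) (.comp (.comp .fst .snd) iotaP)) (mapP opP)

/-- Time bound for `levelP`. -/
def levelTime (O T N S J n : ℕ) : ℕ := (O + 1) * (opTime T N S J n + 300)

theorem Runs.levelP (N S J K : ℕ) {n t : ℕ} (Bl Bl' : List (List ℕ)) (ht : t + 1 ≤ T)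
    (hB : ∀ x ∈ Bl, x.length = t) (hB' : ∀ x ∈ Bl', x.length = t + 1) (hn : Bl.length ≤ n)
    (hn' : Bl'.length ≤ n) :
    Runs p T levelP (((N, (S, J)), K), (Bl, Bl'))
      (mapD (opD p T N S J Bl Bl') (List.range K)) (levelTime K T N S J n)
      (K * opSamples T N S n) := by
  have e1 := Runs.comp_pure (p := p) (T := T)
    (P := (.comp .fst .snd :
      Prog (.prod (.prod paramTy .nat) (.prod (.list histTy) (.list histTy))) .nat))
    (x := (((N, (S, J)), K), (Bl, Bl'))) (y := K) (Runs.simple rfl rfl) (Runs.iotaP K)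
  have e2 := Runs.pair_pure (p := p) (T := T)
    (P := (.pair (.comp .fst .fst) .snd :
      Prog (.prod (.prod paramTy .nat) (.prod (.list histTy) (.list histTy))) _))
    (x := (((N, (S, J)), K), (Bl, Bl'))) (y := ((N, (S, J)), (Bl, Bl'))) (Runs.simple rfl rfl) e1
  have e3 := Runs.mapP (p := p) (T := T) (e := .prod paramTy (.prod (.list histTy) (.list histTy)))
    (x := .nat) (y := rowsTy) (body := CondSampling.opP) (env := ((N, (S, J)), (Bl, Bl')))
    (l := List.range K) (opD p T N S J Bl Bl') (τ := opTime T N S J n) (sb := opSamples T N S n)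
    (fun o _ => Runs.opP N S J Bl Bl' o ht hB hB' hn hn')
  rw [List.length_range] at e3
  refine (e2.comp_pure e3).mono ?_ (by omega)
  simp only [Prog.cost, levelTime]
  nlinarith

/-- Multiplication of the results of two programs. -/
def mulP {a : Ty} (P Q : Prog a .real) : Prog a .real := .comp (.pair P Q) .realMul

/-- Division of the results of two programs. -/
def divP {a : Ty} (P Q : Prog a .real) : Prog a .real := .comp (.pair P Q) .realDiv

/-- A natural number as a real number. -/
def castP {a : Ty} (P : Prog a .nat) : Prog a .real := .comp P .realOfNat

/-- The number `n` from the input. -/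
def inN : Prog inputTy .real := castP (.comp (.comp .fst .snd) .snd)
/-- The number `T` from the input. -/
def inT : Prog inputTy .real := castP (.comp (.comp .fst .fst) .fst)
/-- The number `O` from the input. -/
def inO : Prog inputTy .nat := .comp (.comp .fst .fst) .snd
/-- The number `Δ` from the input. -/
def inΔ : Prog inputTy .real := .comp (.comp (.comp .snd .fst) .fst) .fst
/-- The number `ε` from the input. -/
def inε : Prog inputTy .real := .comp (.comp (.comp .snd .fst) .fst) .snd
/-- The number `δ` from the input. -/
def inδ : Prog inputTy .real := .comp (.comp (.comp .snd .fst) .snd) .fst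
/-- The number `c` from the input. -/
def inC : Prog inputTy .real := .comp (.comp (.comp .snd .fst) .snd) .snd

/-- Number of halvings that bring the initial error below the accuracy. -/
def numHalf (n : ℕ) (ε : ℝ) : ℕ := ⌈Real.logb 2 (2 * n / ε)⌉₊
/-- Number of Landweber steps. -/
def numIter (n : ℕ) (Δ ε : ℝ) : ℕ := ⌈n * numHalf n ε / Δ⌉₊
/-- Accuracy for the matrix entries. -/
def acc (n : ℕ) (Δ ε c : ℝ) : ℝ := ε / (16 * (numIter n Δ ε * (n * (n * c))))
/-- Bound for the logarithm of the number of estimated entries over the error probability. -/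
def numLog (O T n : ℕ) (δ : ℝ) : ℕ := ⌈Real.logb 2 (4 * (T * (O * (n * n))) / δ)⌉₊
/-- Number of samples for a matrix entry. -/
def numS (O T n : ℕ) (Δ ε δ c : ℝ) : ℕ :=
  ⌈16 * numLog O T n δ / (acc n Δ ε c * acc n Δ ε c)⌉₊
/-- Number of samples for a conditional probability. -/
def numN (O T n : ℕ) (Δ ε c : ℝ) : ℕ :=
  ⌈16 * ((n * n) * ((T * T) * O)) / (acc n Δ ε c * acc n Δ ε c)⌉₊

/-- Computation of `numIter`. -/
def iterNumP : Prog inputTy .nat :=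
  .comp (.pair .id (.comp (divP (mulP (castP (.natConst 2)) inN) inε) log2P))
    (.comp (divP (mulP (.comp .fst inN) (castP .snd)) (.comp .fst inΔ)) ceilP)

/-- Computation of the number of Landweber steps and of the squared accuracy. -/
def accP : Prog inputTy (.prod .nat .real) :=
  .comp (.pair .id iterNumP) (.pair .snd (.comp (divP (.comp .fst inε)
    (mulP (castP (.natConst 16)) (mulP (castP .snd)
      (mulP (.comp .fst inN) (mulP (.comp .fst inN) (.comp .fst inC))))))
        (.comp (.pair .id .id) .realMul)))

/-- Computation of the parameters. -/
def paramP : Prog inputTy paramTy :=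
  .comp (.pair (.pair .id (.comp (divP (mulP (castP (.natConst 4)) (mulP inT (mulP (castP inO)
      (mulP inN inN)))) inδ) log2P)) accP)
    (.pair
      (.comp (divP (mulP (castP (.natConst 16)) (mulP
        (mulP (.comp (.comp .fst .fst) inN) (.comp (.comp .fst .fst) inN))
        (mulP (mulP (.comp (.comp .fst .fst) inT) (.comp (.comp .fst .fst) inT))
          (castP (.comp (.comp .fst .fst) inO))))) (.comp .snd .snd)) ceilP)
      (.pair (.comp (divP (mulP (castP (.natConst 16)) (castP (.comp .fst .snd)))
        (.comp .snd .snd)) ceilP) (.comp .snd .fst)))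

section

variable {r n : ℕ} {Δ ε δ c : ℝ} {K L : ℕ} {l : List (List (List ℕ))}

theorem Runs.iterNumP (hn : 0 < n) (hε : 0 < ε) :
    Runs p T iterNumP (((K, L), (r, n)), (((Δ, ε), (δ, c)), l))
      (PMF.pure (numIter n Δ ε)) ((numHalf n ε + 1) * 60 + (numIter n Δ ε + 1) * 40 + 100) 0 := by
  have e1 := Runs.comp_pure (p := p) (T := T)
    (P := divP (mulP (castP (.natConst 2)) inN) inε)
    (x := (((K, L), (r, n)), (((Δ, ε), (δ, c)), l))) (y := (2 * n / ε : ℝ))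
    (Runs.simple rfl (by simp [divP, mulP, castP, inN, inε, Prog.eval]))
    (Runs.log2P (2 * n / ε) (by positivity))
  have e2 := Runs.pair_pure (P := (.id : Prog inputTy inputTy))
    (y := (((K, L), (r, n)), (((Δ, ε), (δ, c)), l))) (Runs.simple rfl rfl) e1
  have e3 := Runs.comp_pure (p := p) (T := T)
    (P := (divP (mulP (.comp .fst inN) (castP .snd)) (.comp .fst inΔ) :
      Prog (.prod inputTy .nat) .real))
    (x := ((((K, L), (r, n)), (((Δ, ε), (δ, c)), l)), numHalf n ε))
    (y := (n * numHalf n ε / Δ : ℝ))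
    (Runs.simple rfl (by simp [divP, mulP, castP, inN, inΔ, Prog.eval]))
    (Runs.ceilP (n * numHalf n ε / Δ))
  refine (e2.comp_pure e3).mono ?_ (by omega)
  rw [numIter, numHalf]
  simp only [Prog.cost, divP, mulP, castP, inN, inΔ, inε]
  omega

theorem Runs.accP (hn : 0 < n) (hε : 0 < ε) :
    Runs p T accP (((K, L), (r, n)), (((Δ, ε), (δ, c)), l))
      (PMF.pure (numIter n Δ ε, acc n Δ ε c * acc n Δ ε c))
      ((numHalf n ε + 1) * 60 + (numIter n Δ ε + 1) * 40 + 300) 0 := by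
  have e1 := Runs.pair_pure (P := (.id : Prog inputTy inputTy))
    (y := (((K, L), (r, n)), (((Δ, ε), (δ, c)), l))) (Runs.simple rfl rfl)
    (Runs.iterNumP (p := p) (T := T) (K := K) (L := L) (r := r) (δ := δ) (c := c)
      (l := l) (Δ := Δ) hn hε)
  have e2 := Runs.simple (p := p) (T := T)
    (P := (.pair .snd (.comp (divP (.comp .fst inε)
      (mulP (castP (.natConst 16)) (mulP (castP .snd)
        (mulP (.comp .fst inN) (mulP (.comp .fst inN) (.comp .fst inC))))))
          (.comp (.pair .id .id) .realMul)) : Prog (.prod inputTy .nat) (.prod .nat .real)))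
    (x := ((((K, L), (r, n)), (((Δ, ε), (δ, c)), l)), numIter n Δ ε))
    (y := (numIter n Δ ε, acc n Δ ε c * acc n Δ ε c)) rfl
    (by simp [divP, mulP, castP, inN, inε, inC, Prog.eval, acc])
  refine (e1.comp_pure e2).mono ?_ (by omega)
  simp only [Prog.cost, divP, mulP, castP, inN, inε, inC]
  omega

/-- Time bound for `paramP`. -/
def paramTime (O T n : ℕ) (Δ ε δ c : ℝ) : ℕ :=
  (numHalf n ε + 1) * 60 + (numIter n Δ ε + 1) * 40 + (numLog O T n δ + 1) * 60 +
    (numS O T n Δ ε δ c + 1) * 40 + (numN O T n Δ ε c + 1) * 40 + 1000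

theorem Runs.paramP (hn : 0 < n) (hε : 0 < ε) (hδ : 0 < δ) (hK : 0 < K) (hL : 0 < L) :
    Runs p T paramP (((K, L), (r, n)), (((Δ, ε), (δ, c)), l))
      (PMF.pure (numN L K n Δ ε c, (numS L K n Δ ε δ c, numIter n Δ ε)))
      (paramTime L K n Δ ε δ c) 0 := by
  have e1 := Runs.comp_pure (p := p) (T := T)
    (P := divP (mulP (castP (.natConst 4)) (mulP inT (mulP (castP inO) (mulP inN inN)))) inδ)
    (x := (((K, L), (r, n)), (((Δ, ε), (δ, c)), l))) (y := (4 * (K * (L * (n * n))) / δ : ℝ))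
    (Runs.simple rfl (by simp [divP, mulP, castP, inN, inT, inO, inδ, Prog.eval]))
    (Runs.log2P (4 * (K * (L * (n * n))) / δ) (by positivity))
  have e2 := (Runs.pair_pure (P := (.id : Prog inputTy inputTy))
    (y := (((K, L), (r, n)), (((Δ, ε), (δ, c)), l))) (Runs.simple rfl rfl) e1).pair_pure
    (Runs.accP (p := p) (T := T) (K := K) (L := L) (r := r) (δ := δ) (c := c)
      (l := l) (Δ := Δ) hn hε)
  have e3 := Runs.comp_pure (p := p) (T := T)
    (P := (divP (mulP (castP (.natConst 16)) (castP (.comp .fst .snd))) (.comp .snd .snd) :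
      Prog (.prod (.prod inputTy .nat) (.prod .nat .real)) .real))
    (x := (((((K, L), (r, n)), (((Δ, ε), (δ, c)), l)), numLog L K n δ),
      (numIter n Δ ε, acc n Δ ε c * acc n Δ ε c)))
    (y := (16 * numLog L K n δ / (acc n Δ ε c * acc n Δ ε c) : ℝ))
    (Runs.simple rfl (by simp [divP, mulP, castP, Prog.eval]))
    (Runs.ceilP (16 * numLog L K n δ / (acc n Δ ε c * acc n Δ ε c)))
  have e4 := Runs.comp_pure (p := p) (T := T)
    (P := (divP (mulP (castP (.natConst 16)) (mulP
        (mulP (.comp (.comp .fst .fst) inN) (.comp (.comp .fst .fst) inN))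
        (mulP (mulP (.comp (.comp .fst .fst) inT) (.comp (.comp .fst .fst) inT))
          (castP (.comp (.comp .fst .fst) inO))))) (.comp .snd .snd) :
      Prog (.prod (.prod inputTy .nat) (.prod .nat .real)) .real))
    (x := (((((K, L), (r, n)), (((Δ, ε), (δ, c)), l)), numLog L K n δ),
      (numIter n Δ ε, acc n Δ ε c * acc n Δ ε c)))
    (y := (16 * ((n * n) * ((K * K) * L)) / (acc n Δ ε c * acc n Δ ε c) : ℝ))
    (Runs.simple rfl (by simp [divP, mulP, castP, inN, inT, inO, Prog.eval]))
    (Runs.ceilP (16 * ((n * n) * ((K * K) * L)) / (acc n Δ ε c * acc n Δ ε c)))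
  have e5 := e2.comp_pure (e4.pair_pure (e3.pair_pure (Q := .comp .snd .fst)
    (z := numIter n Δ ε) (Runs.simple rfl rfl)))
  refine e5.mono ?_ (by omega)
  rw [paramTime]
  conv_rhs => rw [numLog, numS, numN]
  simp only [Prog.cost, divP, mulP, castP, inN, inδ, inO, inT]
  omega

end

/-- Pairs of consecutive entries of a list. -/
def consecP : Prog (.list (.list histTy)) (.list (.prod (.list histTy) (.list histTy))) :=
  .comp (.pair .id (.comp (.pair (.natConst 0) .id) (.listCase .nil (.comp .snd .snd)))) zipP

theorem Runs.consecP (l : List (List (List ℕ))) :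
    Runs p T consecP l (PMF.pure (l.zip l.tail)) ((l.length + 1) * 250) 0 := by
  have e1 := Runs.comp_pure (p := p) (T := T)
    (P := (.pair .id (.comp (.pair (.natConst 0) .id) (.listCase .nil (.comp .snd .snd))) :
        Prog (.list (.list histTy)) (.prod (.list (.list histTy)) (.list (.list histTy)))))
    (x := l) (y := (l, l.tail))
    (Runs.simple rfl (by cases l <;> rfl))
    (Runs.zipP (a := .list histTy) (b := .list histTy) l l.tail)
  refine e1.mono ?_ (by omega)
  simp only [Prog.cost]
  omega

/-- The learner. -/
def learner : Prog inputTy outputTy :=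
  .comp (.pair (.pair paramP inO)
    (.comp (.comp .snd .snd) consecP)) (mapP levelP)

/-- The law of the output of the learner. -/
def learnerD (p : SeqDist O) (T n : ℕ) (Δ ε δ c : ℝ) (l : List (List (List ℕ))) :
    PMF (List (List (List (List ℝ)))) :=
  mapD (fun z => mapD (opD p T (numN O T n Δ ε c) (numS O T n Δ ε δ c) (numIter n Δ ε) z.1 z.2)
    (List.range O)) (l.zip l.tail)

/-- Time bound for the learner. -/
def learnerTime (O T n : ℕ) (Δ ε δ c : ℝ) : ℕ :=
  (T + 3) * (levelTime O T (numN O T n Δ ε c) (numS O T n Δ ε δ c) (numIter n Δ ε) n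
    + paramTime O T n Δ ε δ c + 1000)

theorem Runs.learner {r n : ℕ} {Δ ε δ c : ℝ} {l : List (List (List ℕ))}
    (hn : 0 < n) (hε : 0 < ε) (hδ : 0 < δ) (hT : 0 < T) (hO : 0 < O) (hl : l.length = T + 1)
    (hz : ∀ z ∈ l.zip l.tail, ∃ t, t + 1 ≤ T ∧ (∀ x ∈ z.1, x.length = t) ∧
      (∀ x ∈ z.2, x.length = t + 1) ∧ z.1.length ≤ n ∧ z.2.length ≤ n) :
    Runs p T learner (((T, O), (r, n)), (((Δ, ε), (δ, c)), l)) (learnerD p T n Δ ε δ c l)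
      (learnerTime O T n Δ ε δ c)
      (T * (O * opSamples T (numN O T n Δ ε c) (numS O T n Δ ε δ c) n)) := by
  have e1 := Runs.comp_pure (p := p) (T := T)
    (P := (.comp .snd .snd : Prog inputTy (.list (.list histTy))))
    (x := (((T, O), (r, n)), (((Δ, ε), (δ, c)), l))) (y := l) (Runs.simple rfl rfl)
    (Runs.consecP l)
  have e2 := (Runs.paramP (p := p) (T := T) (K := T) (L := O) (r := r) (δ := δ) (c := c)
      (l := l) (Δ := Δ) hn hε hδ hT hO).pair_pure (Q := inO) (z := O) (Runs.simple rfl rfl)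
  have e3 := e2.pair_pure e1
  have e4 := Runs.mapP (p := p) (T := T) (e := .prod paramTy .nat)
    (x := .prod (.list histTy) (.list histTy)) (y := .list rowsTy) (body := CondSampling.levelP)
    (env := ((numN O T n Δ ε c, (numS O T n Δ ε δ c, numIter n Δ ε)), O))
    (l := l.zip l.tail)
    (fun z => mapD (opD p T (numN O T n Δ ε c) (numS O T n Δ ε δ c) (numIter n Δ ε) z.1 z.2)
      (List.range O))
    (τ := levelTime O T (numN O T n Δ ε c) (numS O T n Δ ε δ c) (numIter n Δ ε) n)
    (sb := O * opSamples T (numN O T n Δ ε c) (numS O T n Δ ε δ c) n)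
    (fun z hzz => by
      obtain ⟨t, h1, h2, h3, h4, h5⟩ := hz z hzz
      exact Runs.levelP _ _ _ _ z.1 z.2 h1 h2 h3 h4 h5)
  have hlen : (l.zip l.tail).length = T := by simp [hl]
  refine (e3.comp_pure e4).mono ?_ ?_
  · rw [hlen, hl, learnerTime]
    simp only [Prog.cost, inO]
    generalize levelTime O T (numN O T n Δ ε c) (numS O T n Δ ε δ c) (numIter n Δ ε) n = u
    nlinarith
  · rw [hlen]; omega

end

end CondSampling

/-! ### Statistics of the estimates. -/

namespace CondSampling

noncomputable section

variable {O : ℕ} {p : SeqDist O} {T : ℕ}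

/-! ### Moments and tails of means -/

theorem ex_sumD {μ : PMF ℝ} (hμ : FinSupp μ) (K : ℕ) (a : ℝ) :
    ex (sumD μ K a) (fun x => x) = a + K * ex μ fun x => x := by
  induction K generalizing a with
  | zero => simp [sumD, ex_pure]
  | succ K ih =>
    rw [sumD, ex_bind hμ fun x _ => finSupp_sumD hμ K _]
    simp only [ih]
    rw [ex_add hμ, ex_add hμ, ex_const, ex_const]
    push_cast; ring

/-- Additivity of the variance: conditionally on the first sample the induction hypothesis applies,
and the cross term has mean zero. The arbitrary start `a` and centre `b` make the induction go
through. -/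
theorem ex_sumD_sq {μ : PMF ℝ} (hμ : FinSupp μ) {m v : ℝ} (hm : ex μ (fun x => x) = m)
    (hv : ex μ (fun x => (x - m) ^ 2) ≤ v) (K : ℕ) (a b : ℝ) :
    ex (sumD μ K a) (fun x => (x - b) ^ 2) ≤ (a + K * m - b) ^ 2 + K * v := by
  induction K generalizing a with
  | zero => simp [sumD, ex_pure]
  | succ K ih =>
    rw [sumD, ex_bind hμ fun x _ => finSupp_sumD hμ K _]
    refine (ex_mono hμ fun x _ => ih (a + x)).trans ?_
    have : ∀ x : ℝ, (a + x + K * m - b) ^ 2 + K * v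
        = (x - m) ^ 2 + ((2 * (a + (K + 1) * m - b)) * (x - m)
          + ((a + (K + 1) * m - b) ^ 2 + K * v)) := fun x => by ring
    simp only [this]
    rw [ex_add hμ, ex_add hμ, ex_mul_left, ex_sub hμ, ex_const, ex_const, hm]
    push_cast
    linarith

theorem ex_meanD {μ : PMF ℝ} (hμ : FinSupp μ) {K : ℕ} (hK : 0 < K) :
    ex (meanD K μ) (fun x => x) = ex μ fun x => x := by
  rw [meanD, ex_map (finSupp_sumD hμ K 0)]
  simp only [div_eq_mul_inv]
  rw [ex_mul_right, ex_sumD hμ]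
  field_simp
  ring

/-- The inequality `|z| ≤ (a + z² / a) / 2` replaces the square root of the variance; keeping `a`
free allows the same `a` for all observations when these bounds are summed. -/
theorem ex_meanD_abs {μ : PMF ℝ} (hμ : FinSupp μ) {m v : ℝ} (hm : ex μ (fun x => x) = m)
    (hv : ex μ (fun x => (x - m) ^ 2) ≤ v) {K : ℕ} (hK : 0 < K) {a : ℝ} (ha : 0 < a) :
    ex (meanD K μ) (fun x => |x - m|) ≤ (a + v / (K * a)) / 2 := by
  rw [meanD, ex_map (finSupp_sumD hμ K 0)]
  have hK' : (0 : ℝ) < K := by exact_mod_cast hK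
  have h1 := ex_sumD_sq hμ hm hv K 0 (K * m)
  have h2 : ∀ x : ℝ, |x / K - m| ≤ a / 2 + (1 / (2 * a * K ^ 2)) * (x - K * m) ^ 2 := by
    intro x
    have e : (1 / (2 * a * K ^ 2)) * (x - K * m) ^ 2 = |x / K - m| ^ 2 / (2 * a) := by
      rw [sq_abs]; field_simp
    rw [e, ← sub_nonneg]
    have : a / 2 + |x / K - m| ^ 2 / (2 * a) - |x / K - m| = (|x / K - m| - a) ^ 2 / (2 * a) := by
      field_simp; ring
    rw [this]; positivity
  refine (ex_mono (finSupp_sumD hμ K 0) fun x _ => h2 x).trans ?_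
  rw [ex_add (finSupp_sumD hμ K 0), ex_const, ex_mul_left]
  have h3 : (1 / (2 * a * K ^ 2)) * ex (sumD μ K 0) (fun x => (x - K * m) ^ 2)
      ≤ (1 / (2 * a * K ^ 2)) * (K * v) := by
    refine mul_le_mul_of_nonneg_left (h1.trans (le_of_eq (by ring))) (by positivity)
  have h4 : (1 / (2 * a * (K : ℝ) ^ 2)) * (K * v) = v / (K * a) / 2 := by field_simp
  linarith

theorem ex_sumD_exp {μ : PMF ℝ} (hμ : FinSupp μ) (l θ : ℝ) (K : ℕ) (a : ℝ) :
    ex (sumD μ K a) (fun x => Real.exp (l * (x - K * θ)))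
      = Real.exp (l * a) * ex μ (fun x => Real.exp (l * (x - θ))) ^ K := by
  induction K generalizing a with
  | zero => simp [sumD, ex_pure]
  | succ K ih =>
    rw [sumD, ex_bind hμ fun x _ => finSupp_sumD hμ K _]
    have : ∀ x, ex (sumD μ K (a + x)) (fun y => Real.exp (l * (y - (K + 1 : ℕ) * θ)))
        = Real.exp (l * (x - θ)) *
          (Real.exp (l * a) * ex μ (fun x => Real.exp (l * (x - θ))) ^ K) := by
      intro x
      have e : ∀ y, Real.exp (l * (y - (K + 1 : ℕ) * θ))
          = Real.exp (- (l * θ)) * Real.exp (l * (y - K * θ)) := by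
        intro y; rw [← Real.exp_add]; push_cast; ring_nf
      simp only [e]
      rw [ex_mul_left, ih, ← mul_assoc, ← Real.exp_add, ← mul_assoc, ← Real.exp_add]
      ring_nf
    simp only [this]
    rw [ex_mul_right, pow_succ]
    ring

/-- From `exp y ≤ 1 + y + y²` for `|y| ≤ 1`. The linear term contributes at most `(σ/4)(σ/2) =
σ²/8`, because `θ` is only within `σ/2` of the mean, and the quadratic one at most `σ²/16`. -/
theorem ex_exp_le {μ : PMF ℝ} (hμ : FinSupp μ) (h01 : ∀ x ∈ μ.support, 0 ≤ x ∧ x ≤ 1) {θ σ : ℝ}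
    (hθ0 : 0 ≤ θ) (hθ1 : θ ≤ 1) (hσ : 0 < σ) (hσ1 : σ ≤ 1)
    (hb : |ex μ (fun x => x) - θ| ≤ σ / 2) {l : ℝ} (hl : |l| = σ / 4) :
    ex μ (fun x => Real.exp (l * (x - θ))) ≤ Real.exp (3 * σ ^ 2 / 16) := by
  have h1 : ∀ x ∈ μ.support, Real.exp (l * (x - θ)) ≤ l * (x - θ) + (1 + σ ^ 2 / 16) := by
    intro x hx
    obtain ⟨hx0, hx1⟩ := h01 x hx
    have h2 : |x - θ| ≤ 1 := by rw [abs_le]; constructor <;> linarith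
    have h3 : |l * (x - θ)| ≤ σ / 4 := by
      rw [abs_mul, hl]
      nlinarith [abs_nonneg (x - θ)]
    have h4 := Real.abs_exp_sub_one_sub_id_le (h3.trans (by linarith))
    have h5 : (l * (x - θ)) ^ 2 ≤ σ ^ 2 / 16 := by
      rw [← sq_abs]
      nlinarith [abs_nonneg (l * (x - θ))]
    have := (abs_le.1 h4).2
    linarith
  refine (ex_mono hμ h1).trans ?_
  rw [ex_add hμ, ex_const, ex_mul_left, ex_sub hμ, ex_const]
  have h6 : l * (ex μ (fun x => x) - θ) ≤ σ / 4 * (σ / 2) := by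
    refine (le_abs_self _).trans ?_
    rw [abs_mul, hl]
    exact mul_le_mul_of_nonneg_left hb (by positivity)
  have := Real.add_one_le_exp (3 * σ ^ 2 / 16)
  nlinarith

/-- A Chernoff bound that tolerates a bias of `σ/2`. With exponent `±σ/4`, a deviation of `K σ` in
the sum gains `K σ²/4` and the moment generating function costs `3 K σ²/16`, which leaves `K σ²/16`
for each tail. -/
theorem HP_meanD {μ : PMF ℝ} (hμ : FinSupp μ) (h01 : ∀ x ∈ μ.support, 0 ≤ x ∧ x ≤ 1) {θ σ : ℝ}
    (hθ0 : 0 ≤ θ) (hθ1 : θ ≤ 1) (hσ : 0 < σ) (hσ1 : σ ≤ 1)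
    (hb : |ex μ (fun x => x) - θ| ≤ σ / 2) {K : ℕ} (hK : 0 < K) :
    HP (meanD K μ) (fun x => |x - θ| ≤ σ) (2 * Real.exp (-(K * σ ^ 2 / 16))) := by
  have hK' : (0 : ℝ) < K := by exact_mod_cast hK
  have hfs := finSupp_sumD hμ K 0
  refine HP.map hfs ?_
  have key : ∀ l : ℝ, |l| = σ / 4 →
      ex (sumD μ K 0) (fun x => Real.exp (-(K * σ ^ 2 / 4)) * Real.exp (l * (x - K * θ)))
        ≤ Real.exp (-(K * σ ^ 2 / 16)) := by
    intro l hl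
    rw [ex_mul_left, ex_sumD_exp hμ]
    have h1 := ex_exp_le hμ h01 hθ0 hθ1 hσ hσ1 hb hl
    have h2 := pow_le_pow_left₀ (ex_nonneg fun x _ => (Real.exp_pos _).le) h1 K
    rw [← Real.exp_nat_mul] at h2
    simp only [mul_zero, Real.exp_zero, one_mul]
    calc _ ≤ Real.exp (-(K * σ ^ 2 / 4)) * Real.exp (K * (3 * σ ^ 2 / 16)) :=
          mul_le_mul_of_nonneg_left h2 (Real.exp_pos _).le
      _ = _ := by rw [← Real.exp_add]; ring_nf
  have h1 := key (σ / 4) (abs_of_pos (by positivity))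
  have h2 := key (-(σ / 4)) (by rw [abs_neg]; exact abs_of_pos (by positivity))
  rw [HP, two_mul]
  refine le_trans ?_ (add_le_add h1 h2)
  rw [← ex_add hfs]
  -- Pointwise, the indicator of a deviation is at most the sum of the two exponentials, since one
  -- of them is then at least one.
  refine ex_mono hfs fun x _ => ?_
  simp only [← Real.exp_add]
  split_ifs with h
  · positivity
  · rw [not_le, lt_abs] at h
    have e : x = K * (x / K) := by field_simp
    rcases h with h | h
    · have : (0 : ℝ) ≤ -(K * σ ^ 2 / 4) + σ / 4 * (x - K * θ) := by
        have : K * σ ≤ x - K * θ := by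
          rw [e, ← mul_sub]
          exact mul_le_mul_of_nonneg_left h.le hK'.le
        nlinarith
      have := Real.one_le_exp this
      have := Real.exp_pos (-(K * σ ^ 2 / 4) + -(σ / 4) * (x - K * θ))
      linarith
    · have : (0 : ℝ) ≤ -(K * σ ^ 2 / 4) + -(σ / 4) * (x - K * θ) := by
        have : K * σ ≤ -(x - K * θ) := by
          rw [e, ← mul_sub, ← mul_neg]
          exact mul_le_mul_of_nonneg_left h.le hK'.le
        nlinarith
      have := Real.one_le_exp this
      have := Real.exp_pos (-(K * σ ^ 2 / 4) + (σ / 4) * (x - K * θ))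
      linarith

/-! ### Sums over futures -/

/-- Sum over the sequences of length `k`. -/
def sumF (O k : ℕ) (φ : List (Fin O) → ℝ) : ℝ := ∑ f : Fin k → Fin O, φ (List.ofFn f)

theorem sumF_zero (φ : List (Fin O) → ℝ) : sumF O 0 φ = φ [] := by
  simp [sumF]

theorem sumF_succ (k : ℕ) (φ : List (Fin O) → ℝ) :
    sumF O (k + 1) φ = ∑ o, sumF O k fun f => φ (o :: f) := by
  simp only [sumF]
  rw [← Fintype.sum_prod_type']
  refine Fintype.sum_equiv (Fin.consEquiv (fun _ => Fin O)).symm _ _ fun f => ?_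
  rw [List.ofFn_succ]
  rfl

theorem sumF_congr {k : ℕ} {φ ψ : List (Fin O) → ℝ} (h : ∀ f, f.length = k → φ f = ψ f) :
    sumF O k φ = sumF O k ψ := Finset.sum_congr rfl fun _ _ => h _ (by simp)

theorem sumF_mono {k : ℕ} {φ ψ : List (Fin O) → ℝ} (h : ∀ f, f.length = k → φ f ≤ ψ f) :
    sumF O k φ ≤ sumF O k ψ := Finset.sum_le_sum fun _ _ => h _ (by simp)

theorem sumF_add (k : ℕ) (φ ψ : List (Fin O) → ℝ) :
    sumF O k (fun f => φ f + ψ f) = sumF O k φ + sumF O k ψ := Finset.sum_add_distrib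

theorem sumF_sub (k : ℕ) (φ ψ : List (Fin O) → ℝ) :
    sumF O k (fun f => φ f - ψ f) = sumF O k φ - sumF O k ψ := Finset.sum_sub_distrib _ _

theorem sumF_mul_left (k : ℕ) (c : ℝ) (φ : List (Fin O) → ℝ) :
    sumF O k (fun f => c * φ f) = c * sumF O k φ := (Finset.mul_sum _ _ _).symm

theorem sumF_list_sum {α : Type*} (k : ℕ) (l : List α) (φ : α → List (Fin O) → ℝ) :
    sumF O k (fun f => (l.map fun a => φ a f).sum) = (l.map fun a => sumF O k (φ a)).sum := by
  induction l with
  | nil => simp [sumF]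
  | cons a l ih => simp [sumF_add, ih]

theorem finSupp_condSample (k : ℕ) (h : List (Fin O)) : FinSupp (condSample p k h) := by
  induction k generalizing h with
  | zero => exact finSupp_pure _
  | succ k ih => exact (finSupp_of_finite _).bind fun o _ => (ih _).map _

theorem ex_condSample (k : ℕ) (h : List (Fin O)) (φ : List (Fin O) → ℝ) :
    ex (condSample p k h) φ = sumF O k fun f => condProb p h f * φ f := by
  induction k generalizing h φ with
  | zero => simp [condSample, ex_pure, sumF_zero, condProb]
  | succ k ih =>
    rw [condSample, ex_bind (finSupp_of_finite _) fun o _ => (finSupp_condSample k _).map _,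
      ex_fintype, sumF_succ]
    refine Finset.sum_congr rfl fun o _ => ?_
    rw [ex_map (finSupp_condSample k _), ih, ← sumF_mul_left]
    refine sumF_congr fun f _ => ?_
    rw [condProb]; ring

theorem sumF_condProb (k : ℕ) (h : List (Fin O)) : sumF O k (condProb p h) = 1 := by
  have := ex_condSample (p := p) k h fun _ => 1
  rw [ex_const] at this
  simpa using this.symm

theorem sum_toReal (h : List (Fin O)) : ∑ o, (p h o).toReal = 1 := by
  have := ex_const (p h) 1
  rw [ex_fintype] at this
  simpa using this

/-- The codes of a sequence. -/
def code (h : List (Fin O)) : List ℕ := h.map Fin.val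

theorem oracle_code {h : List (Fin O)} (hh : h.length ≤ T) :
    oracle p T (code h) = (condSample p (T - h.length) h).map code := by
  have e : (code h).filterMap (fun x => if hx : x < O then some (⟨x, hx⟩ : Fin O) else none) = h := by
    rw [code, List.filterMap_map]
    convert List.filterMap_some (l := h) using 2
    simp
  rw [oracle, if_pos ⟨by simp [code], by simpa [code] using hh⟩, e]
  simp [code]
  rfl

theorem finSupp_oracle (h : List ℕ) : FinSupp (oracle p T h) := by
  rw [oracle]
  split_ifs
  · exact (finSupp_condSample _ _).map _
  · exact finSupp_pure _

/-! ### Accuracy of the estimated probabilities -/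

theorem finSupp_phatD (N : ℕ) (h : List ℕ) (o : ℕ) : FinSupp (phatD p T N h o) :=
  finSupp_meanD ((finSupp_oracle h).map _) N

/-- As `h` is shorter than the horizon, the sampled future is nonempty and its first entry equals
`o` with probability `Pr[o | h]`: a Bernoulli variable. The test function `φ` yields mean and
variance at once. -/
theorem ex_headInd {h : List (Fin O)} (hh : h.length < T) (o : Fin O) (φ : ℝ → ℝ) :
    ex ((oracle p T (code h)).map (headInd o)) φ
      = (p h o).toReal * φ 1 + (1 - (p h o).toReal) * φ 0 := by
  rw [ex_map (finSupp_oracle _), oracle_code hh.le, ex_map (finSupp_condSample _ _)]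
  obtain ⟨k, hk⟩ : ∃ k, T - h.length = k + 1 := ⟨T - h.length - 1, by omega⟩
  rw [hk, condSample, ex_bind (finSupp_of_finite _) fun o _ => (finSupp_condSample k _).map _,
    ex_fintype]
  have h1 : ∀ x : Fin O, ex ((condSample p k (h ++ [x])).map fun f => x :: f)
      (fun a => φ (headInd o (code a))) = if x = o then φ 1 else φ 0 := by
    intro x
    rw [ex_map (finSupp_condSample _ _)]
    have : ∀ a : List (Fin O), φ (headInd o (code (x :: a))) = if x = o then φ 1 else φ 0 := by
      intro a
      simp only [code, List.map_cons, headInd, Fin.val_inj]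
      split_ifs <;> rfl
    simp only [this]
    rw [ex_const]
  simp only [h1]
  have h2 : ∀ x : Fin O, (p h x).toReal * (if x = o then φ 1 else φ 0)
      = (p h x).toReal * φ 0 + (if x = o then (p h x).toReal * (φ 1 - φ 0) else 0) := by
    intro x; split_ifs <;> ring
  simp only [h2, Finset.sum_add_distrib, Finset.sum_ite_eq', Finset.mem_univ, if_true,
    ← Finset.sum_mul, sum_toReal]
  ring

theorem ex_phatD {N : ℕ} (hN : 0 < N) {h : List (Fin O)} (hh : h.length < T) (o : Fin O) :
    ex (phatD p T N (code h) o) (fun x => x) = (p h o).toReal := by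
  rw [phatD, ex_meanD ((finSupp_oracle _).map _) hN, ex_headInd hh]
  ring

theorem ex_phatD_abs {N : ℕ} (hN : 0 < N) {h : List (Fin O)} (hh : h.length < T) {a : ℝ}
    (ha : 0 < a) (o : Fin O) :
    ex (phatD p T N (code h) o) (fun x => |x - (p h o).toReal|)
      ≤ (a + (p h o).toReal / (N * a)) / 2 := by
  refine ex_meanD_abs ((finSupp_oracle _).map _) ?_ ?_ hN ha
  · rw [ex_headInd hh]; ring
  · rw [ex_headInd hh]
    have : (0 : ℝ) ≤ (p h o).toReal := ENNReal.toReal_nonneg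
    nlinarith [sq_nonneg (p h o).toReal, sq_nonneg ((p h o).toReal - 1)]

/-- The variance of each indicator is at most its mean, and the means sum to one, so the total error
is at most `(O a + 1 / (N a)) / 2`; with `a = γ / O` both terms are at most `γ`. This is why `N`
need only be of order `O / γ²`. -/
theorem sum_ex_phatD_abs {N : ℕ} (hN : 0 < N) {h : List (Fin O)} (hh : h.length < T) {γ : ℝ}
    (hγ : 0 < γ) (hNγ : (O : ℝ) ≤ N * γ ^ 2) :
    ∑ o : Fin O, ex (phatD p T N (code h) o) (fun x => |x - (p h o).toReal|) ≤ γ := by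
  have hN' : (0 : ℝ) < N := by exact_mod_cast hN
  have hO : (0 : ℝ) < O := by
    rcases Nat.eq_zero_or_pos O with rfl | h0
    · have := sum_toReal (p := p) h
      simp at this
    · exact_mod_cast h0
  refine (Finset.sum_le_sum fun o _ => ex_phatD_abs hN hh (a := γ / O) (by positivity) o).trans ?_
  rw [← Finset.sum_div, Finset.sum_add_distrib]
  simp only [← Finset.sum_div, sum_toReal, Finset.sum_const, Finset.card_univ, Fintype.card_fin, nsmul_eq_mul]
  have e1 : (O : ℝ) * γ / O = γ := by field_simp
  have e2 : 1 / (N * (γ / O)) ≤ γ := by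
    rw [div_le_iff₀ (by positivity)]
    have : γ * (N * (γ / O)) = (N * γ ^ 2) / O := by field_simp
    rw [this, le_div_iff₀ hO]; linarith
  linarith

theorem nonneg_of_mem_support_meanD {μ : PMF ℝ} (hμ : ∀ x ∈ μ.support, 0 ≤ x) {K : ℕ} {x : ℝ}
    (hx : x ∈ (meanD K μ).support) : 0 ≤ x := by
  have h : ∀ (K : ℕ) (a : ℝ), 0 ≤ a → ∀ x ∈ (sumD μ K a).support, 0 ≤ x := by
    intro K
    induction K with
    | zero => intro a ha x hx; simp [sumD] at hx; simpa [hx] using ha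
    | succ K ih =>
      intro a ha x hx
      simp only [sumD, PMF.support_bind, Set.mem_iUnion] at hx
      obtain ⟨y, hy, hx⟩ := hx
      exact ih _ (add_nonneg ha (hμ y hy)) x hx
  rw [meanD, PMF.support_map] at hx
  obtain ⟨y, hy, rfl⟩ := hx
  exact div_nonneg (h K 0 le_rfl y hy) (Nat.cast_nonneg K)

theorem headInd_nonneg (o : ℕ) (f : List ℕ) : 0 ≤ headInd o f := by
  cases f with
  | nil => simp [headInd]
  | cons x f => simp only [headInd]; split_ifs <;> norm_num

theorem finSupp_futD (N : ℕ) (f h : List ℕ) (acc : ℝ) : FinSupp (futD p T N h acc f) := by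
  induction f generalizing h acc with
  | nil => exact finSupp_pure _
  | cons o f ih => exact (finSupp_phatD N h o).bind fun q _ => ih _ _

theorem nonneg_of_mem_support_futD {N : ℕ} {f h : List ℕ} {acc x : ℝ} (ha : 0 ≤ acc)
    (hx : x ∈ (futD p T N h acc f).support) : 0 ≤ x := by
  induction f generalizing h acc with
  | nil => simp [futD] at hx; simpa [hx] using ha
  | cons o f ih =>
    simp only [futD, PMF.support_bind, Set.mem_iUnion] at hx
    obtain ⟨q, hq, hx⟩ := hx
    refine ih (mul_nonneg ha (nonneg_of_mem_support_meanD ?_ hq)) hx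
    intro y hy
    rw [PMF.support_map] at hy
    obtain ⟨g, _, rfl⟩ := hy
    exact headInd_nonneg _ _

theorem futD_eq_map (N : ℕ) (f h : List ℕ) (acc : ℝ) :
    futD p T N h acc f = (futD p T N h 1 f).map (acc * ·) := by
  induction f generalizing h acc with
  | nil => simp [futD, PMF.pure_map]
  | cons o f ih =>
    simp only [futD, PMF.map_bind]
    congr 1; funext q
    rw [ih, ih _ (1 * q), PMF.map_comp]
    congr 1; funext x; simp [mul_assoc]

theorem code_append (h : List (Fin O)) (o : Fin O) : code h ++ [(o : ℕ)] = code (h ++ [o]) := by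
  simp [code]

/-- The factors come from fresh samples, so the expectation of the product is the product of the
expectations. -/
theorem ex_futD {N : ℕ} (hN : 0 < N) (f h : List (Fin O)) (hh : h.length + f.length ≤ T) :
    ex (futD p T N (code h) 1 (code f)) (fun x => x) = condProb p h f := by
  induction f generalizing h with
  | nil => simp [code, futD, ex_pure, condProb]
  | cons o f ih =>
    simp only [List.length_cons] at hh
    have e : code (o :: f) = (o : ℕ) :: code f := rfl
    rw [e, futD, ex_bind (finSupp_phatD _ _ _) fun q _ => finSupp_futD _ _ _ _]
    have : ∀ q, ex (futD p T N (code h ++ [(o : ℕ)]) (1 * q) (code f)) (fun x => x)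
        = q * condProb p (h ++ [o]) f := by
      intro q
      rw [futD_eq_map, ex_map (finSupp_futD _ _ _ _), ex_mul_left, one_mul, code_append,
        ih _ (by simp; omega)]
    simp only [this]
    rw [ex_mul_right, ex_phatD hN (by omega), condProb]

/-- Write `q x - p P = (q - p) x + p (x - P)`, with `q` the estimate of the first factor `p` and `x`
that of the remaining product `P`. Since `x ≥ 0` has mean `P`, and the `P` sum to one over the
futures, the first part costs `γ` in total; the second is the average over the first observation of
the errors at length `k`. Thus each level adds `γ`, although there are exponentially many futures.
-/
theorem sumF_ex_futD_abs {N : ℕ} (hN : 0 < N) {γ : ℝ} (hγ : 0 < γ)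
    (hNγ : (O : ℝ) ≤ N * γ ^ 2) (k : ℕ) (h : List (Fin O)) (hh : h.length + k ≤ T) :
    sumF O k (fun f => ex (futD p T N (code h) 1 (code f)) fun x => |x - condProb p h f|)
      ≤ k * γ := by
  induction k generalizing h with
  | zero => simp [sumF_zero, code, futD, ex_pure, condProb]
  | succ k ih =>
    rw [sumF_succ]
    have h1 : ∀ o : Fin O, sumF O k (fun f => ex (futD p T N (code h) 1 (code (o :: f)))
        fun x => |x - condProb p h (o :: f)|)
        ≤ ex (phatD p T N (code h) o) (fun x => |x - (p h o).toReal|)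
          + (p h o).toReal * (k * γ) := by
      intro o
      have h2 : ∀ f : List (Fin O), f.length = k → ex (futD p T N (code h) 1 (code (o :: f)))
          (fun x => |x - condProb p h (o :: f)|)
          ≤ ex (phatD p T N (code h) o) (fun x => |x - (p h o).toReal|)
            * condProb p (h ++ [o]) f + (p h o).toReal *
            ex (futD p T N (code (h ++ [o])) 1 (code f)) fun x => |x - condProb p (h ++ [o]) f| := by
        intro f hf
        have e : code (o :: f) = (o : ℕ) :: code f := rfl
        rw [e, futD, ex_bind (finSupp_phatD _ _ _) fun q _ => finSupp_futD _ _ _ _,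
          ← ex_mul_right, ← ex_const (phatD p T N (code h) o) ((p h o).toReal * _),
          ← ex_add (finSupp_phatD _ _ _)]
        refine ex_mono (finSupp_phatD _ _ _) fun q _ => ?_
        -- By unbiasedness the factor `condProb p (h ++ [o]) f` is itself the mean of `x`, so both
        -- sides become expectations over the same `x` and can be compared pointwise.
        rw [futD_eq_map, ex_map (finSupp_futD _ _ _ _), one_mul, code_append,
          ← ex_futD (T := T) hN f (h ++ [o]) (by simp; omega), ← ex_mul_left, ← ex_mul_left,
          ← ex_add (finSupp_futD _ _ _ _), ex_futD (T := T) hN f (h ++ [o]) (by simp; omega)]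
        refine ex_mono (finSupp_futD _ _ _ _) fun x hx => ?_
        have hx0 := nonneg_of_mem_support_futD zero_le_one hx
        have hp0 : (0 : ℝ) ≤ (p h o).toReal := ENNReal.toReal_nonneg
        rw [condProb]
        have e2 : q * x - (p h o).toReal * condProb p (h ++ [o]) f
          = (q - (p h o).toReal) * x + (p h o).toReal * (x - condProb p (h ++ [o]) f) := by ring
        rw [e2]
        refine (abs_add_le _ _).trans ?_
        rw [abs_mul, abs_mul, abs_of_nonneg hx0, abs_of_nonneg hp0]
      refine (sumF_mono h2).trans ?_
      rw [sumF_add, sumF_mul_left, sumF_mul_left, sumF_condProb, mul_one]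
      have := ih (h ++ [o]) (by simp; omega)
      have hp0 : (0 : ℝ) ≤ (p h o).toReal := ENNReal.toReal_nonneg
      nlinarith
    refine (Finset.sum_le_sum fun o _ => h1 o).trans ?_
    rw [Finset.sum_add_distrib, ← Finset.sum_mul, sum_toReal]
    have := sum_ex_phatD_abs (p := p) hN (h := h) (T := T) (by omega) hγ hNγ
    push_cast
    linarith

end

end CondSampling

namespace CondSampling

noncomputable section

variable {O : ℕ} {p : SeqDist O} {T : ℕ}

/-! ### Accuracy of the estimated posterior probabilities -/

theorem foldD_map {α β γ : Type*} (κ : β → α → PMF α) (g : γ → β) (l : List γ) (a : α) :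
    foldD κ (l.map g) a = foldD (fun c => κ (g c)) l a := by
  induction l generalizing a with
  | nil => rfl
  | cons x l ih =>
    simp only [List.map_cons, foldD]
    congr 1; funext s; exact ih s

/-- The triangle inequality for a sum of estimates, with start `a` and target offset `t` left free
for the induction. -/
theorem ex_foldD_abs {β : Type*} {κ : β → PMF ℝ} (hκ : ∀ b, FinSupp (κ b)) (m : β → ℝ)
    (l : List β) (a t : ℝ) :
    ex (foldD (fun b s => (κ b).map (s + ·)) l a) (fun x => |x - (t + (l.map m).sum)|)
      ≤ |a - t| + (l.map fun b => ex (κ b) fun x => |x - m b|).sum := by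
  induction l generalizing a t with
  | nil => simp [foldD, ex_pure]
  | cons b l ih =>
    rw [foldD, PMF.bind_map, ex_bind (hκ b)
      (κ := foldD (fun b s => (κ b).map (s + ·)) l ∘ fun x => a + x)
      fun y _ => finSupp_foldD (fun x s => (hκ x).map _) _ _]
    simp only [Function.comp_apply, List.map_cons, List.sum_cons, ← add_assoc]
    have h1 : ∀ y : ℝ, ex (foldD (fun b s => (κ b).map (s + ·)) l (a + y))
        (fun x => |x - (t + m b + (l.map m).sum)|)
        ≤ |y - m b| + (|a - t| + (l.map fun b => ex (κ b) fun x => |x - m b|).sum) := by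
      intro y
      refine (ih (a + y) (t + m b)).trans ?_
      have e : a + y - (t + m b) = (y - m b) + (a - t) := by ring
      rw [e]
      have := abs_add_le (y - m b) (a - t)
      linarith
    refine (ex_mono (hκ b) fun y _ => h1 y).trans ?_
    rw [ex_add (hκ b), ex_const]
    linarith

theorem finSupp_denD (N : ℕ) (Bl : List (List ℕ)) (f : List ℕ) : FinSupp (denD p T N Bl f) :=
  finSupp_foldD (fun _ _ => (finSupp_futD _ _ _ _).map _) _ _

theorem nonneg_of_mem_support_denD {N : ℕ} {Bl : List (List ℕ)} {f : List ℕ} {x : ℝ}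
    (hx : x ∈ (denD p T N Bl f).support) : 0 ≤ x := by
  have h : ∀ (Bl : List (List ℕ)) (a : ℝ), 0 ≤ a →
      ∀ x ∈ (foldD (fun b s => (futD p T N b 1 f).map (s + ·)) Bl a).support, 0 ≤ x := by
    intro Bl
    induction Bl with
    | nil => intro a ha x hx; simp [foldD] at hx; simpa [hx] using ha
    | cons b Bl ih =>
      intro a ha x hx
      simp only [foldD, PMF.bind_map, PMF.support_bind, Set.mem_iUnion, Function.comp_apply] at hx
      obtain ⟨y, hy, hx⟩ := hx
      exact ih _ (add_nonneg ha (nonneg_of_mem_support_futD zero_le_one hy)) x hx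
  exact h Bl 0 le_rfl x hx

theorem finSupp_postD (N : ℕ) (Bl : List (List ℕ)) (b f : List ℕ) :
    FinSupp (postD p T N Bl b f) :=
  (finSupp_futD _ _ _ _).bind fun _ _ => (finSupp_denD _ _ _).map _

theorem mem_unit_of_mem_support_postD {N : ℕ} {Bl : List (List ℕ)} {b f : List ℕ} {x : ℝ}
    (hx : x ∈ (postD p T N Bl b f).support) : 0 ≤ x ∧ x ≤ 1 := by
  simp only [postD, PMF.support_bind, Set.mem_iUnion, PMF.support_map, Set.mem_image] at hx
  obtain ⟨u, hu, v, hv, rfl⟩ := hx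
  exact ⟨le_min zero_le_one (div_nonneg (nonneg_of_mem_support_futD zero_le_one hu)
    (nonneg_of_mem_support_denD hv)), min_le_left _ _⟩

/-- The weight `s` cancels the small denominator: `s (num / den) - P = (num - P) - (num / den) (den
- s)`, where the ratio is at most one. If it is not, clipping leaves `s - P`, which is at most `(num
- P) - (den - s)`. Clipping matters because the numerator is estimated separately from its
counterpart in the denominator and may exceed it. -/
theorem mul_abs_min_div_sub_le {num den P s : ℝ} (hnum : 0 ≤ num) (hden : 0 ≤ den) (hP : 0 ≤ P)
    (hPs : P ≤ s) : s * |min 1 (num / den) - P / s| ≤ |num - P| + |den - s| := by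
  rcases (hP.trans hPs).eq_or_lt with h0 | hs
  · rw [← h0, zero_mul]; positivity
  have e : s * |min 1 (num / den) - P / s| = |s * min 1 (num / den) - P| := by
    conv_lhs => rw [← abs_of_pos hs]
    rw [← abs_mul, mul_sub, abs_of_pos hs]
    congr 2; field_simp
  rw [e]
  -- For `den = 0` the quotient is `0` by convention, and the error `P` is at most `s = |den - s|`.
  rcases hden.eq_or_lt with h0 | hd
  · rw [← h0, div_zero, min_eq_right zero_le_one, mul_zero, zero_sub, zero_sub, abs_neg, abs_neg,
      abs_of_nonneg hP, abs_of_pos hs]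
    have := abs_nonneg (num - P)
    linarith
  rcases le_total num den with h | h
  · have h1 : num / den ≤ 1 := (div_le_one hd).2 h
    have h2 : 0 ≤ num / den := by positivity
    rw [min_eq_right h1]
    have e2 : s * (num / den) - P = (num - P) - (num / den) * (den - s) := by field_simp; ring
    rw [e2]
    refine (abs_sub _ _).trans ?_
    rw [abs_mul, abs_of_nonneg h2]
    nlinarith [abs_nonneg (den - s)]
  · rw [min_eq_left ((one_le_div hd).2 h), mul_one, abs_of_nonneg (by linarith)]
    have h1 := le_abs_self (num - P)
    have h2 := neg_abs_le (den - s)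
    linarith

/-- The sum of `Pr[f | b]` over a list of histories. -/
def totProb (p : SeqDist O) (Bl : List (List (Fin O))) (f : List (Fin O)) : ℝ :=
  (Bl.map fun b => condProb p b f).sum

/-- The expected error of the estimate of `Pr[f | b]`. -/
def futErr (p : SeqDist O) (T N : ℕ) (b f : List (Fin O)) : ℝ :=
  ex (futD p T N (code b) 1 (code f)) fun x => |x - condProb p b f|

theorem totProb_mul_ex_postD_le (N : ℕ) (Bl : List (List (Fin O))) (b f : List (Fin O))
    (hb : condProb p b f ≤ totProb p Bl f) :
    totProb p Bl f * ex (postD p T N (Bl.map code) (code b) (code f))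
      (fun x => |x - condProb p b f / totProb p Bl f|)
      ≤ futErr p T N b f + (Bl.map fun b => futErr p T N b f).sum := by
  have hden : ex (denD p T N (Bl.map code) (code f)) (fun x => |x - totProb p Bl f|)
      ≤ (Bl.map fun b => futErr p T N b f).sum := by
    rw [denD, foldD_map]
    have := ex_foldD_abs (κ := fun b : List (Fin O) => futD p T N (code b) 1 (code f))
      (fun b => finSupp_futD _ _ _ _) (fun b => condProb p b f) Bl 0 0
    simpa [totProb, futErr] using this
  rw [postD, ex_bind (finSupp_futD _ _ _ _) fun _ _ => (finSupp_denD _ _ _).map _, ← ex_mul_left,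
    futErr, ← ex_const (futD p T N (code b) 1 (code f)) (List.sum _),
    ← ex_add (finSupp_futD _ _ _ _)]
  refine ex_mono (finSupp_futD _ _ _ _) fun num hnum => ?_
  rw [ex_map (finSupp_denD _ _ _), ← ex_mul_left]
  refine (ex_mono (finSupp_denD _ _ _) fun den hd => mul_abs_min_div_sub_le
    (nonneg_of_mem_support_futD zero_le_one hnum) (nonneg_of_mem_support_denD hd)
      (condProb_nonneg p f b) hb).trans ?_
  rw [ex_add (finSupp_denD _ _ _), ex_const]
  linarith

theorem totProb_nonneg (Bl : List (List (Fin O))) (f : List (Fin O)) : 0 ≤ totProb p Bl f :=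
  List.sum_nonneg fun x hx => by
    obtain ⟨b, _, rfl⟩ := List.mem_map.1 hx
    exact condProb_nonneg p f b

theorem condProb_le_totProb {Bl : List (List (Fin O))} {b : List (Fin O)} (hb : b ∈ Bl)
    (f : List (Fin O)) : condProb p b f ≤ totProb p Bl f := by
  refine List.single_le_sum (fun x hx => ?_) _ (List.mem_map.2 ⟨b, hb, rfl⟩)
  obtain ⟨b, _, rfl⟩ := List.mem_map.1 hx
  exact condProb_nonneg p f b

/-- The bias of a matrix entry. The hypothesis `W ≤ totProb` replaces the weight by the one that
`totProb_mul_ex_postD_le` can absorb; what remains is the total `ℓ¹` error of one numerator and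
`Bl.length` summands of the denominator, each at most `k γ`. -/
theorem abs_sumF_post_sub_le {N : ℕ} (hN : 0 < N) {γ : ℝ} (hγ : 0 < γ)
    (hNγ : (O : ℝ) ≤ N * γ ^ 2) {k t : ℕ} (htk : t + k ≤ T) {Bl : List (List (Fin O))}
    (hBl : ∀ b ∈ Bl, b.length = t) {b : List (Fin O)} (hb : b ∈ Bl) {W : List (Fin O) → ℝ}
    (hW0 : ∀ f, 0 ≤ W f) (hW : ∀ f, f.length = k → W f ≤ totProb p Bl f) :
    |sumF O k (fun f => W f * ex (postD p T N (Bl.map code) (code b) (code f)) fun x => x)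
      - sumF O k (fun f => W f * (condProb p b f / totProb p Bl f))|
      ≤ (Bl.length + 1) * (k * γ) := by
  rw [← sumF_sub]
  have h0 : ∀ φ : List (Fin O) → ℝ, |sumF O k φ| ≤ sumF O k fun f => |φ f| := fun φ =>
    Finset.abs_sum_le_sum_abs _ _
  refine (h0 _).trans ?_
  have h1 : ∀ f : List (Fin O), f.length = k →
      |W f * ex (postD p T N (Bl.map code) (code b) (code f)) (fun x => x)
        - W f * (condProb p b f / totProb p Bl f)|
      ≤ futErr p T N b f + (Bl.map fun b => futErr p T N b f).sum := by
    intro f hf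
    rw [← mul_sub, abs_mul, abs_of_nonneg (hW0 f),
      ← ex_const (postD p T N (Bl.map code) (code b) (code f)) (_ / _),
      ← ex_sub (finSupp_postD _ _ _ _)]
    refine le_trans ?_ (totProb_mul_ex_postD_le N Bl b f (condProb_le_totProb hb f))
    exact mul_le_mul (hW f hf) (abs_ex_le (finSupp_postD _ _ _ _) _) (abs_nonneg _)
      (totProb_nonneg _ _)
  refine (sumF_mono h1).trans ?_
  rw [sumF_add, sumF_list_sum]
  have h2 : ∀ b ∈ Bl, sumF O k (futErr p T N b) ≤ k * γ := fun b hb =>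
    sumF_ex_futD_abs hN hγ hNγ k b (by rw [hBl b hb]; exact htk)
  have h3 : (Bl.map fun b => sumF O k (futErr p T N b)).sum ≤ Bl.length * (k * γ) := by
    have := List.sum_le_card_nsmul (Bl.map fun b => sumF O k (futErr p T N b)) (k * γ) (by
      intro x hx
      obtain ⟨b, hb, rfl⟩ := List.mem_map.1 hx
      exact h2 b hb)
    simpa using this
  have h4 := h2 b hb
  have h5 : sumF O k (fun f => futErr p T N b f) = sumF O k (futErr p T N b) := rfl
  have h6 : (Bl.map fun b => sumF O k fun f => futErr p T N b f).sum
    = (Bl.map fun b => sumF O k (futErr p T N b)).sum := rfl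
  linarith

/-! ### Accuracy of the empirical matrices -/

theorem finSupp_stripD (N : ℕ) (Bl : List (List ℕ)) (b w f : List ℕ) :
    FinSupp (stripD p T N Bl b w f) := by
  match w, f with
  | [], f => exact finSupp_postD _ _ _ _
  | _ :: _, [] => exact finSupp_pure _
  | o :: _, x :: f =>
    rw [stripD]
    split_ifs
    · exact finSupp_postD _ _ _ _
    · exact finSupp_pure _

theorem finSupp_entryD (N : ℕ) (Bl : List (List ℕ)) (b w x : List ℕ) :
    FinSupp (entryD p T N Bl b w x) := (finSupp_oracle x).bind fun _ _ => finSupp_stripD _ _ _ _ _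

theorem mem_unit_of_mem_support_entryD {N : ℕ} {Bl : List (List ℕ)} {b w x : List ℕ} {y : ℝ}
    (hy : y ∈ (entryD p T N Bl b w x).support) : 0 ≤ y ∧ y ≤ 1 := by
  simp only [entryD, PMF.support_bind, Set.mem_iUnion] at hy
  obtain ⟨f, _, hy⟩ := hy
  match w, f, hy with
  | [], f, hy => exact mem_unit_of_mem_support_postD hy
  | _ :: _, [], hy => simp [stripD] at hy; simp [hy]
  | o :: _, x :: f, hy =>
    rw [stripD] at hy
    split_ifs at hy
    · exact mem_unit_of_mem_support_postD hy
    · simp at hy; simp [hy]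

theorem ex_entryD_nil (N : ℕ) (Bl : List (List ℕ)) (b : List ℕ) {x : List (Fin O)}
    (hx : x.length ≤ T) :
    ex (entryD p T N Bl b [] (code x)) (fun y => y) = sumF O (T - x.length) fun f =>
      condProb p x f * ex (postD p T N Bl b (code f)) fun y => y := by
  rw [entryD, ex_bind (finSupp_oracle _) fun _ _ => finSupp_stripD _ _ _ _ _, oracle_code hx,
    ex_map (finSupp_condSample _ _), ex_condSample]
  rfl

/-- Only futures that begin with `o` contribute, so the weight of the remaining future `f` is `Pr[o
f | x]`. Total mass at most one is all that is required of it later, not exactly one. -/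
theorem ex_entryD_single (N : ℕ) (Bl : List (List ℕ)) (b : List ℕ) (o : Fin O)
    {x : List (Fin O)} {k : ℕ} (hx : x.length + (k + 1) = T) :
    ex (entryD p T N Bl b [(o : ℕ)] (code x)) (fun y => y) = sumF O k fun f =>
      ((p x o).toReal * condProb p (x ++ [o]) f) * ex (postD p T N Bl b (code f)) fun y => y := by
  rw [entryD, ex_bind (finSupp_oracle _) fun _ _ => finSupp_stripD _ _ _ _ _,
    oracle_code (by omega), ex_map (finSupp_condSample _ _), ex_condSample,
    show T - x.length = k + 1 by omega, sumF_succ]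
  rw [Finset.sum_eq_single o]
  · refine sumF_congr fun f _ => ?_
    simp [code, stripD, condProb]
  · intro o' _ ho
    have : ∀ f, condProb p x (o' :: f) *
        ex (stripD p T N Bl b [(o : ℕ)] (code (o' :: f))) (fun y => y) = 0 := by
      intro f
      have : (o' : ℕ) ≠ o := fun h => ho (Fin.ext h)
      simp [code, stripD, this, ex_pure]
    simp only [this]
    simp [sumF]
  · simp

/-- A union bound over the entries, which also reads the random list as a family indexed by `Fin m`.
-/
theorem HP.mapD_ofFn {α β : Type*} {κ : α → PMF β} (hκ : ∀ x, FinSupp (κ x)) {η : ℝ}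
    (hη : 0 ≤ η) {m : ℕ} {g : Fin m → α} {G : Fin m → β → Prop} (h : ∀ i, HP (κ (g i)) (G i) η) :
    HP (CondSampling.mapD κ (List.ofFn g))
      (fun ys => ∃ y : Fin m → β, ys = List.ofFn y ∧ ∀ i, G i (y i)) (m * η) := by
  induction m with
  | zero => simpa [CondSampling.mapD] using HP.pure (G := fun ys : List β => ys = []) rfl
  | succ m ih =>
    rw [List.ofFn_succ]
    have h2 := ih (g := fun i => g i.succ) (G := fun i => G i.succ) fun i => h i.succ
    have h3 := HP.bind (hκ (g 0)) (κ := fun y => (CondSampling.mapD κ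
      (List.ofFn fun i => g i.succ)).map (y :: ·))
      (fun a _ => (finSupp_mapD hκ _).map _)
      (G' := fun ys => ∃ y : Fin (m + 1) → β, ys = List.ofFn y ∧ ∀ i, G i (y i)) (h 0)
      (by positivity) fun y _ hy =>
        HP.map (finSupp_mapD hκ _) (HP.mono (finSupp_mapD hκ _) h2 (by
          rintro ys _ ⟨z, rfl, hz⟩
          refine ⟨Fin.cons y z, by simp [List.ofFn_succ], fun i => ?_⟩
          refine Fin.cases ?_ (fun i => ?_) i
          · simpa using hy
          · simpa using hz i) le_rfl)
    refine HP.mono (finSupp_mapD hκ (g 0 :: List.ofFn fun i => g i.succ)) h3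
      (fun _ _ h => h) (le_of_eq ?_)
    push_cast; ring

/-- The list of rows of a matrix. -/
def toRows {m m' : ℕ} (M : Matrix (Fin m') (Fin m) ℝ) : List (List ℝ) :=
  List.ofFn fun i => List.ofFn (M i)

/-- A family of histories as a list. -/
def famList {t m : ℕ} (B : Fin m → Fin t → Fin O) : List (List (Fin O)) :=
  List.ofFn fun b => List.ofFn (B b)

theorem finSupp_matD (N S : ℕ) (Bl : List (List ℕ)) (w : List ℕ) (Bs : List (List ℕ)) :
    FinSupp (matD p T N S Bl w Bs) :=
  finSupp_mapD (fun _ => finSupp_mapD (fun _ => finSupp_meanD (finSupp_entryD _ _ _ _ _) _) _) _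

theorem HP_matD_of_entries {N S m m' : ℕ} {σ η : ℝ} (hη : 0 ≤ η) (L : List (List ℕ))
    (w : List ℕ) {g : Fin m → List ℕ} {g' : Fin m' → List ℕ} (hL : L = List.ofFn g')
    {θ : Fin m' → Fin m → ℝ}
    (key : ∀ b b', HP (meanD S (entryD p T N L (g' b') w (g b))) (fun x => |x - θ b' b| ≤ σ) η) :
    HP (matD p T N S L w (List.ofFn g))
      (fun M => ∃ M' : Matrix (Fin m') (Fin m) ℝ, M = toRows M' ∧ ∀ b' b, |M' b' b - θ b' b| ≤ σ)
      (m' * (m * η)) := by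
  have hfs : ∀ b, FinSupp (mapD (fun x => meanD S (entryD p T N L b w x)) (List.ofFn g)) :=
    fun b => finSupp_mapD (fun _ => finSupp_meanD (finSupp_entryD _ _ _ _ _) _) _
  have h1 : ∀ b' : Fin m', HP (mapD (fun x => meanD S (entryD p T N L (g' b') w x))
      (List.ofFn g)) (fun row => ∃ r : Fin m → ℝ, row = List.ofFn r ∧ ∀ b, |r b - θ b' b| ≤ σ)
        (m * η) := fun b' =>
    HP.mapD_ofFn (g := g) (κ := fun x => meanD S (entryD p T N L (g' b') w x))
      (fun _ => finSupp_meanD (finSupp_entryD _ _ _ _ _) _) hη fun b => key b b'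
  have h2 := HP.mapD_ofFn (g := g') hfs (by positivity) h1
  rw [← hL] at h2
  refine HP.mono (finSupp_mapD hfs _) h2 ?_ le_rfl
  rintro M _ ⟨rows, rfl, h⟩
  choose r hr1 hr2 using h
  exact ⟨Matrix.of r, congrArg List.ofFn (funext hr1), hr2⟩

/-- Half of the accuracy pays for the bias, half for the fluctuation of the mean of `S` samples.
Keeping the weights `W` abstract covers both the matrix of the system and the right-hand side. -/
theorem HP_matD {N S t t' k m m' : ℕ} (hN : 0 < N) (hS : 0 < S) {γ σ : ℝ} (hγ : 0 < γ)
    (hNγ : (O : ℝ) ≤ N * γ ^ 2) (hσ : 0 < σ) (hσ1 : σ ≤ 1) (htk : t' + k ≤ T)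
    (B : Fin m → Fin t → Fin O) (B' : Fin m' → Fin t' → Fin O)
    (hbias : ((m' : ℝ) + 1) * (k * γ) ≤ σ / 2) (w : List ℕ) {W : Fin m → List (Fin O) → ℝ}
    (hW0 : ∀ b f, 0 ≤ W b f) (hW : ∀ b f, f.length = k → W b f ≤ totProb p (famList B') f)
    (hW1 : ∀ b, sumF O k (W b) ≤ 1)
    (hex : ∀ b b', ex (entryD p T N ((famList B').map code) (code (List.ofFn (B' b'))) w
      (code (List.ofFn (B b)))) (fun y => y) = sumF O k fun f => W b f *
        ex (postD p T N ((famList B').map code) (code (List.ofFn (B' b'))) (code f)) fun y => y) :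
    HP (matD p T N S ((famList B').map code) w ((famList B).map code))
      (fun M => ∃ M' : Matrix (Fin m') (Fin m) ℝ, M = toRows M' ∧ ∀ b' b, |M' b' b -
        sumF O k (fun f => W b f * (condProb p (List.ofFn (B' b')) f / totProb p (famList B') f))|
          ≤ σ) (m' * (m * (2 * Real.exp (-(S * σ ^ 2 / 16))))) := by
  have e : ∀ {t m : ℕ} (B : Fin m → Fin t → Fin O),
      (famList B).map code = List.ofFn fun b => code (List.ofFn (B b)) := fun B => by
    simp [famList, List.map_ofFn, Function.comp_def]
  have key : ∀ b b', HP (meanD S (entryD p T N ((famList B').map code) (code (List.ofFn (B' b')))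
      w (code (List.ofFn (B b))))) (fun x => |x - sumF O k (fun f => W b f *
        (condProb p (List.ofFn (B' b')) f / totProb p (famList B') f))| ≤ σ)
          (2 * Real.exp (-(S * σ ^ 2 / 16))) := by
    intro b b'
    have hmem : List.ofFn (B' b') ∈ famList B' := by
      rw [famList, List.mem_ofFn]; exact ⟨b', rfl⟩
    have hq : ∀ f, 0 ≤ condProb p (List.ofFn (B' b')) f / totProb p (famList B') f ∧
        condProb p (List.ofFn (B' b')) f / totProb p (famList B') f ≤ 1 := fun f =>
      ⟨div_nonneg (condProb_nonneg _ _ _) (totProb_nonneg _ _),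
        div_le_one_of_le₀ (condProb_le_totProb hmem f) (totProb_nonneg _ _)⟩
    refine HP_meanD (finSupp_entryD _ _ _ _ _) (fun x hx => mem_unit_of_mem_support_entryD hx)
      ?_ ?_ hσ hσ1 ?_ hS
    · exact Finset.sum_nonneg fun f _ => mul_nonneg (hW0 _ _) (hq _).1
    · refine (sumF_mono fun f _ => ?_).trans (hW1 b)
      exact mul_le_of_le_one_right (hW0 _ _) (hq f).2
    · rw [hex b b']
      refine (abs_sumF_post_sub_le hN hγ hNγ htk (t := t') ?_ hmem (hW0 b) (hW b)).trans ?_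
      · intro b hb
        rw [famList, List.mem_ofFn] at hb
        obtain ⟨i, rfl⟩ := hb
        simp
      · simpa [famList] using hbias
  rw [e B]
  exact HP_matD_of_entries (by positivity) _ w (e B') key

end

end CondSampling

/-! ### Linear algebra: stability of the perturbed iteration. -/

namespace CondSampling

noncomputable section

/-! ### The Landweber iteration on matrices -/

theorem zip_ofFn {α β : Type*} {n : ℕ} (f : Fin n → α) (g : Fin n → β) :
    (List.ofFn f).zip (List.ofFn g) = List.ofFn fun i => (f i, g i) := by
  induction n with
  | zero => simp
  | succ n ih => simp [List.ofFn_succ, ih]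

theorem axpy_ofFn {n : ℕ} (a v : Fin n → ℝ) (k : ℝ) :
    axpy (List.ofFn a) k (List.ofFn v) = List.ofFn fun j => a j - k * v j := by
  simp [axpy, zip_ofFn, List.map_ofFn, Function.comp_def]

theorem foldl_axpy_ofFn {n m : ℕ} (q : Fin n → ℝ) (X : Matrix (Fin n) (Fin m) ℝ)
    (a : Fin m → ℝ) :
    (List.ofFn fun i => (q i, List.ofFn (X i))).foldl (fun acc kv => axpy acc kv.1 kv.2)
      (List.ofFn a) = List.ofFn fun j => a j - ∑ i, q i * X i j := by
  induction n generalizing a with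
  | zero => simp
  | succ n ih =>
    rw [List.ofFn_succ, List.foldl_cons]
    simp only [axpy_ofFn]
    have h := ih (fun i => q i.succ) (fun i => X i.succ) (fun j => a j - q 0 * X 0 j)
    rw [h]
    congr 1; funext j
    rw [Fin.sum_univ_succ]; ring

theorem stepRows_toRows {n m : ℕ} (Q : Matrix (Fin n) (Fin n) ℝ) (R X : Matrix (Fin n) (Fin m) ℝ) :
    stepRows (toRows Q) (toRows R) (toRows X) = toRows (X + R - Q * X) := by
  have e : (toRows Q).zip ((toRows R).zip (toRows X)) =
      List.ofFn fun i => (List.ofFn (Q i), List.ofFn (R i), List.ofFn (X i)) := by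
    simp only [toRows, zip_ofFn]
  rw [stepRows, e, List.map_ofFn, toRows.eq_def (X + R - Q * X)]
  congr 1; funext i
  simp only [Function.comp_apply, stepRow, List.foldl_cons, axpy_ofFn]
  rw [toRows, zip_ofFn, foldl_axpy_ofFn]
  congr 1; funext j
  simp only [Matrix.sub_apply, Matrix.add_apply, Matrix.mul_apply]
  ring

/-- The Landweber iteration for `Q * X = R`, started at `0`. -/
def landweber {n m : ℕ} (Q : Matrix (Fin n) (Fin n) ℝ) (R : Matrix (Fin n) (Fin m) ℝ) :
    ℕ → Matrix (Fin n) (Fin m) ℝ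
  | 0 => 0
  | j + 1 => landweber Q R j + R - Q * landweber Q R j

/-- The program starts at `R`, which is already the first iterate from `0`; hence the shift by one.
-/
theorem lwRows_toRows {n m : ℕ} (Q : Matrix (Fin n) (Fin n) ℝ) (R : Matrix (Fin n) (Fin m) ℝ)
    (J : ℕ) : lwRows (toRows Q) (toRows R) J = toRows (landweber Q R (J + 1)) := by
  induction J with
  | zero => simp [lwRows, landweber]
  | succ J ih =>
    rw [lwRows, Function.iterate_succ_apply', ← lwRows, ih, stepRows_toRows, ← landweber]

theorem getD_toRows {n m : ℕ} (M : Matrix (Fin n) (Fin m) ℝ) (i : Fin n) (j : Fin m) :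
    ((toRows M).getD i []).getD j 0 = M i j := by
  simp [toRows, List.getD_eq_getElem?_getD]

/-! ### The Euclidean norm of a vector -/

/-- The Euclidean norm. -/
def l2 {n : ℕ} (v : Fin n → ℝ) : ℝ := ‖WithLp.toLp 2 v‖

theorem l2_nonneg {n : ℕ} (v : Fin n → ℝ) : 0 ≤ l2 v := norm_nonneg _

theorem l2_add_le {n : ℕ} (v w : Fin n → ℝ) : l2 (v + w) ≤ l2 v + l2 w := by
  rw [l2, WithLp.toLp_add]; exact norm_add_le _ _

theorem l2_sub_le {n : ℕ} (v w : Fin n → ℝ) : l2 (v - w) ≤ l2 v + l2 w := by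
  rw [l2, WithLp.toLp_sub]; exact norm_sub_le _ _

theorem l2_neg {n : ℕ} (v : Fin n → ℝ) : l2 (-v) = l2 v := by
  rw [l2, WithLp.toLp_neg, norm_neg, l2]

theorem l2_smul {n : ℕ} (a : ℝ) (v : Fin n → ℝ) : l2 (a • v) = |a| * l2 v := by
  rw [l2, WithLp.toLp_smul, norm_smul, l2, Real.norm_eq_abs]

theorem l2_zero {n : ℕ} : l2 (0 : Fin n → ℝ) = 0 := by
  rw [l2, WithLp.toLp_zero, norm_zero]

theorem l2_sq {n : ℕ} (v : Fin n → ℝ) : l2 v ^ 2 = ∑ i, v i ^ 2 := by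
  rw [l2, EuclideanSpace.real_norm_sq_eq]

theorem l2_le {n : ℕ} {v : Fin n → ℝ} {a : ℝ} (ha : 0 ≤ a) (h : ∑ i, v i ^ 2 ≤ a ^ 2) :
    l2 v ≤ a := by
  rw [← l2_sq] at h
  exact (le_abs_self _).trans (abs_le_of_sq_le_sq h ha)

theorem abs_le_l2 {n : ℕ} (v : Fin n → ℝ) (i : Fin n) : |v i| ≤ l2 v := by
  refine abs_le_of_sq_le_sq' ?_ (l2_nonneg v) |> abs_le.2
  rw [l2_sq]
  exact Finset.single_le_sum (f := fun i => v i ^ 2) (fun _ _ => sq_nonneg _) (Finset.mem_univ i)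

theorem sum_abs_le {n : ℕ} (v : Fin n → ℝ) : ∑ i, |v i| ≤ √n * l2 v := by
  have h : (∑ i, |v i|) ^ 2 ≤ (√n * l2 v) ^ 2 := by
    rw [mul_pow, Real.sq_sqrt (by positivity), l2_sq]
    have := sq_sum_le_card_mul_sum_sq (s := Finset.univ) (f := fun i => |v i|)
    simpa using this
  exact (le_abs_self _).trans (abs_le_of_sq_le_sq h (mul_nonneg (Real.sqrt_nonneg _) (l2_nonneg _)))

theorem l2_le_of_abs_le {n : ℕ} {v : Fin n → ℝ} {a : ℝ} (ha : 0 ≤ a) (h : ∀ i, |v i| ≤ a) :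
    l2 v ≤ √n * a := by
  refine l2_le (by positivity) ?_
  rw [mul_pow, Real.sq_sqrt (by positivity)]
  have : ∀ i ∈ Finset.univ, v i ^ 2 ≤ a ^ 2 := fun i _ => by
    rw [← sq_abs]; exact pow_le_pow_left₀ (abs_nonneg _) (h i) 2
  simpa using Finset.sum_le_card_nsmul _ _ _ this

theorem l2_mulVec_le {n m : ℕ} {E : Matrix (Fin n) (Fin m) ℝ} {a : ℝ} (ha : 0 ≤ a)
    (h : ∀ i j, |E i j| ≤ a) (v : Fin m → ℝ) : l2 (E.mulVec v) ≤ √n * (a * (√m * l2 v)) := by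
  refine l2_le_of_abs_le (by have := l2_nonneg v; positivity) fun i => ?_
  refine (Finset.abs_sum_le_sum_abs (fun j => E i j * v j) Finset.univ).trans ?_
  refine le_trans ?_ (mul_le_mul_of_nonneg_left (sum_abs_le v) ha)
  rw [Finset.mul_sum]
  exact Finset.sum_le_sum fun j _ => by
    rw [abs_mul]; exact mul_le_mul_of_nonneg_right (h i j) (abs_nonneg _)

/-! ### Contraction -/

/-- In an orthonormal eigenbasis `1 - Q` multiplies coordinates by `1 - ev i`, and every eigenvalue
is `0` or lies in `[d, 1]`. So `1 - Q` never expands, and for vectors orthogonal to the kernel the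
coordinates with factor `1` vanish. -/
theorem l2_sub_mulVec_le {n : ℕ} {Q : Matrix (Fin n) (Fin n) ℝ} (hQ : Q.IsHermitian)
    (hle : ∀ v, v ⬝ᵥ Q.mulVec v ≤ v ⬝ᵥ v) {d : ℝ} (hd : 0 ≤ d)
    (hgap : ∀ μ, Module.End.HasEigenvalue (Matrix.toLin' Q) μ → μ ≠ 0 → d ≤ μ) (u : Fin n → ℝ) :
    l2 (u - Q.mulVec u) ≤ l2 u ∧
      ((∀ w, Q.mulVec w = 0 → w ⬝ᵥ u = 0) → d ≤ 1 → l2 (u - Q.mulVec u) ≤ (1 - d) * l2 u) := by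
  set b := hQ.eigenvectorBasis
  set ev := hQ.eigenvalues
  have hb : ∀ i, Q.mulVec (b i).ofLp = ev i • (b i).ofLp := fun i => hQ.mulVec_eigenvectorBasis i
  have hbb : ∀ i, (b i).ofLp ⬝ᵥ (b i).ofLp = 1 := by
    intro i
    have h := b.orthonormal.1 i
    have h2 : l2 (b i).ofLp ^ 2 = 1 := by rw [l2]; change ‖b i‖ ^ 2 = 1; rw [h]; norm_num
    rw [l2_sq] at h2
    rw [← h2]; exact Finset.sum_congr rfl fun j _ => by ring
  have h1 : ∀ i, ev i ≤ 1 := by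
    intro i
    have h := hle (b i).ofLp
    rw [hb, dotProduct_smul, hbb] at h
    simpa using h
  have h2 : ∀ i, ev i = 0 ∨ d ≤ ev i := by
    intro i
    by_cases h : ev i = 0
    · exact Or.inl h
    refine Or.inr (hgap _ ?_ h)
    refine Module.End.hasEigenvalue_of_hasEigenvector (x := (b i).ofLp) ⟨?_, ?_⟩
    · rw [Module.End.mem_eigenspace_iff, Matrix.toLin'_apply, hb]
    · intro h0
      have := hbb i
      rw [h0] at this; simp at this
  have hin : ∀ i (v : Fin n → ℝ), inner ℝ (b i) (WithLp.toLp 2 v) = (b i).ofLp ⬝ᵥ v := by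
    intro i v
    rw [EuclideanSpace.inner_eq_star_dotProduct, dotProduct_comm]
    simp
  have hn : ∀ v : Fin n → ℝ, l2 v ^ 2 = ∑ i, ((b i).ofLp ⬝ᵥ v) ^ 2 := by
    intro v
    rw [l2, ← b.sum_sq_inner_right]
    exact Finset.sum_congr rfl fun i _ => by rw [hin]
  have hc : ∀ i, (b i).ofLp ⬝ᵥ (u - Q.mulVec u) = (1 - ev i) * ((b i).ofLp ⬝ᵥ u) := by
    intro i
    rw [dotProduct_sub, Matrix.dotProduct_mulVec, ← Matrix.mulVec_transpose]
    have : Q.transpose = Q := by simpa [Matrix.IsHermitian] using hQ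
    rw [this, hb, smul_dotProduct, smul_eq_mul]; ring
  have key : ∀ a : ℝ, 0 ≤ a → (∀ i, |1 - ev i| ≤ a ∨ (b i).ofLp ⬝ᵥ u = 0) →
      l2 (u - Q.mulVec u) ≤ a * l2 u := by
    intro a ha h
    have h3 : l2 (u - Q.mulVec u) ^ 2 ≤ (a * l2 u) ^ 2 := by
      rw [hn, mul_pow, hn, Finset.mul_sum]
      refine Finset.sum_le_sum fun i _ => ?_
      rw [hc, mul_pow]
      rcases h i with h | h
      · refine mul_le_mul_of_nonneg_right ?_ (sq_nonneg _)
        rw [← sq_abs]; exact pow_le_pow_left₀ (abs_nonneg _) h 2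
      · rw [h]; simp
    exact (le_abs_self _).trans (abs_le_of_sq_le_sq h3 (mul_nonneg ha (l2_nonneg _)))
  refine ⟨?_, fun hu hd1 => key _ (by linarith) fun i => ?_⟩
  · rw [← one_mul (l2 u)]
    refine key 1 zero_le_one fun i => Or.inl ?_
    rw [abs_le]
    rcases h2 i with h | h <;> constructor <;> linarith [h1 i]
  · rcases h2 i with h | h
    · refine Or.inr (hu _ ?_)
      rw [hb, h, zero_smul]
    · refine Or.inl ?_
      rw [abs_le]; constructor <;> linarith [h1 i]

theorem landweber_mulVec {n m : ℕ} (Q : Matrix (Fin n) (Fin n) ℝ) (R : Matrix (Fin n) (Fin m) ℝ)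
    (j : ℕ) (a : Fin m) : (fun i => landweber Q R (j + 1) i a) =
      (fun i => landweber Q R j i a) + (fun i => R i a)
        - Q.mulVec fun i => landweber Q R j i a := by
  funext i
  simp [landweber, Matrix.mul_apply, Matrix.mulVec, dotProduct]

/-- Each iterate of a column is `x + g + ν`. Here `g` is the error of the exact iteration,
orthogonal to the kernel and hence contracting; `ν` collects the perturbations, which may have
kernel components and are only known not to expand. As `ν` grows by a fixed amount per step, no
perturbation theory for eigenspaces or pseudoinverses is needed. -/
theorem l2_landweber_sub_le {n m : ℕ} {Q Q' : Matrix (Fin n) (Fin n) ℝ}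
    {R R' : Matrix (Fin n) (Fin m) ℝ} (hQ : Q.IsHermitian)
    (hle : ∀ v, v ⬝ᵥ Q.mulVec v ≤ v ⬝ᵥ v) {d : ℝ} (hd : 0 ≤ d) (hd1 : d ≤ 1)
    (hgap : ∀ μ, Module.End.HasEigenvalue (Matrix.toLin' Q) μ → μ ≠ 0 → d ≤ μ)
    {σ c : ℝ} (hσ : 0 ≤ σ) (hc : 1 ≤ √n * c) (hQ' : ∀ i j, |Q' i j - Q i j| ≤ σ)
    (hR' : ∀ i j, |R' i j - R i j| ≤ σ) (a : Fin m) {x : Fin n → ℝ}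
    (hx : Q.mulVec x = fun i => R i a) (hxker : ∀ w, Q.mulVec w = 0 → w ⬝ᵥ x = 0)
    (hxc : l2 x ≤ c) (K : ℕ) (hK : K * (4 * n * σ) ≤ 1) :
    l2 ((fun i => landweber Q' R' K i a) - x) ≤ (1 - d) ^ K * c + K * (4 * n * σ * c) := by
  have hc0 : 0 ≤ c := (l2_nonneg x).trans hxc
  have hn2 : √(n : ℝ) * √n = n := Real.mul_self_sqrt (by positivity)
  have hT : Q.transpose = Q := by simpa [Matrix.IsHermitian] using hQ
  have main : ∀ j ≤ K, ∃ g ν : Fin n → ℝ, (fun i => landweber Q' R' j i a) = x + (g + ν) ∧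
      (∀ w, Q.mulVec w = 0 → w ⬝ᵥ g = 0) ∧ l2 g ≤ (1 - d) ^ j * c ∧
      l2 ν ≤ j * (4 * n * σ * c) := by
    intro j
    induction j with
    | zero =>
      intro _
      -- Starting from zero makes the initial error `-x`, which is orthogonal to the kernel.
      refine ⟨-x, 0, ?_, fun w hw => ?_, ?_, ?_⟩
      · funext i; simp [landweber]
      · rw [dotProduct_neg, hxker w hw, neg_zero]
      · simpa [l2_neg] using hxc
      · simp [l2_zero]
    | succ j ih =>
      intro hj
      obtain ⟨g, ν, h1, h2, h3, h4⟩ := ih (by omega)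
      set y : Fin n → ℝ := fun i => landweber Q' R' j i a
      refine ⟨g - Q.mulVec g, (ν - Q.mulVec ν) + ((fun i => R' i a - R i a)
        - (Q' - Q).mulVec y), ?_, fun w hw => ?_, ?_, ?_⟩
      · have e2 : (fun i => R' i a - R i a) = (fun i => R' i a) - Q.mulVec x := by
          rw [hx]; rfl
        rw [landweber_mulVec, e2, Matrix.sub_mulVec]
        change y + _ - Q'.mulVec y = _
        have e3 : Q.mulVec y = Q.mulVec x + (Q.mulVec g + Q.mulVec ν) := by
          rw [h1, Matrix.mulVec_add, Matrix.mulVec_add]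
        rw [e3, h1]
        abel
      · rw [dotProduct_sub, h2 w hw, Matrix.dotProduct_mulVec, ← Matrix.mulVec_transpose, hT, hw]
        simp
      · refine ((l2_sub_mulVec_le hQ hle hd hgap g).2 h2 hd1).trans ?_
        rw [pow_succ', mul_assoc]
        exact mul_le_mul_of_nonneg_left h3 (by linarith)
      -- Each of `x`, `g` and `ν` has norm at most `c`; for `ν` this is the hypothesis `hK`.
      · have hy : l2 y ≤ 3 * c := by
          rw [h1]
          refine (l2_add_le _ _).trans ?_
          have h5 := l2_add_le g ν
          have h6 : (1 - d) ^ j * c ≤ c :=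
            mul_le_of_le_one_left hc0 (pow_le_one₀ (by linarith) (by linarith))
          have h7 : (j : ℝ) * (4 * n * σ * c) ≤ c := by
            have h8 : (j : ℝ) ≤ K := by exact_mod_cast (by omega : j ≤ K)
            have h9 : (j : ℝ) * (4 * n * σ) ≤ 1 :=
              (mul_le_mul_of_nonneg_right h8 (by positivity)).trans hK
            nlinarith
          linarith
        -- The natural bound is `√n σ`; the factor `√n c ≥ 1` makes it comparable with the error `3
        -- n σ c` coming from `Q'`, for a total of `4 n σ c` per step.
        have h5 : l2 (fun i => R' i a - R i a) ≤ n * σ * c := by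
          refine (l2_le_of_abs_le hσ fun i => hR' i a).trans ?_
          have : √(n : ℝ) * σ * 1 ≤ √n * σ * (√n * c) :=
            mul_le_mul_of_nonneg_left hc (by positivity)
          calc √(n : ℝ) * σ = √(n : ℝ) * σ * 1 := by ring
            _ ≤ _ := this
            _ = (√n * √n) * σ * c := by ring
            _ = _ := by rw [hn2]
        have h6 : l2 ((Q' - Q).mulVec y) ≤ 3 * (n * σ * c) := by
          refine (l2_mulVec_le hσ hQ' y).trans ?_
          calc √(n : ℝ) * (σ * (√n * l2 y)) = (√n * √n) * σ * l2 y := by ring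
            _ = n * σ * l2 y := by rw [hn2]
            _ ≤ n * σ * (3 * c) := mul_le_mul_of_nonneg_left hy (by positivity)
            _ = _ := by ring
        have h7 := (l2_sub_mulVec_le hQ hle hd hgap ν).1
        have h8 := l2_add_le (ν - Q.mulVec ν) ((fun i => R' i a - R i a) - (Q' - Q).mulVec y)
        have h9 := l2_sub_le (fun i => R' i a - R i a) ((Q' - Q).mulVec y)
        push_cast
        linarith
  obtain ⟨g, ν, h1, -, h3, h4⟩ := main K le_rfl
  rw [h1, add_sub_cancel_left]
  exact (l2_add_le _ _).trans (add_le_add h3 h4)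

end

end CondSampling

namespace CondSampling

noncomputable section

variable {O : ℕ} {p : SeqDist O} {T : ℕ}

/-! ### The matrix of posterior probabilities -/

theorem totProb_famList {t m : ℕ} (B : Fin m → Fin t → Fin O) (f : List (Fin O)) :
    totProb p (famList B) f = ∑ b, condProb p (List.ofFn (B b)) f := by
  simp [totProb, famList, List.map_ofFn, Function.comp_def, List.sum_ofFn]

/-- Valid also when the average vanishes, because then both inverses are `0`. -/
theorem inv_avgProb {t m : ℕ} (B : Fin m → Fin t → Fin O) (f : Fin (T - t) → Fin O) :
    (avgProb p T B f)⁻¹ = m * (totProb p (famList B) (List.ofFn f))⁻¹ := by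
  rw [avgProb, totProb_famList, mul_inv, one_div, inv_inv]
  rfl

theorem covMat_mulVec {t m : ℕ} (B : Fin m → Fin t → Fin O) (v : Fin m → ℝ) (b : Fin m) :
    (covMat p T B).mulVec v b =
      m * ∑ f, (futureMat p T B).mulVec v f *
        (futureMat p T B f b / totProb p (famList B) (List.ofFn f)) := by
  rw [covMat, ← Matrix.mulVec_mulVec, ← Matrix.mulVec_mulVec, Finset.mul_sum]
  refine Finset.sum_congr rfl fun f _ => ?_
  change futureMat p T B f b * _ = _
  rw [Matrix.mulVec_diagonal, inv_avgProb]
  ring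

theorem covMat_isHermitian {t m : ℕ} (B : Fin m → Fin t → Fin O) :
    (covMat p T B).IsHermitian := by
  rw [Matrix.IsHermitian, Matrix.conjTranspose_eq_transpose_of_trivial, covMat,
    Matrix.transpose_mul, Matrix.transpose_mul, Matrix.transpose_transpose,
    Matrix.diagonal_transpose, Matrix.mul_assoc]

theorem futureMat_le_totProb {t m : ℕ} (B : Fin m → Fin t → Fin O) (f : Fin (T - t) → Fin O)
    (b : Fin m) : futureMat p T B f b ≤ totProb p (famList B) (List.ofFn f) := by
  refine condProb_le_totProb ?_ _
  rw [famList, List.mem_ofFn]; exact ⟨b, rfl⟩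

theorem sum_futureMat {t m : ℕ} (B : Fin m → Fin t → Fin O) (b : Fin m) :
    ∑ f, futureMat p T B f b = 1 :=
  sumF_condProb (T - t) (List.ofFn (B b))

/-- Cauchy–Schwarz with weights `Pr[f | b]` gives `(∑_b Pr[f | b] v_b)² ≤ s(f) ∑_b Pr[f | b] v_b²`,
with `s(f)` the total weight. Dividing by `s(f)` and summing over `f` leaves `v ⬝ᵥ v`, as each
column sums to one. -/
theorem dotProduct_covMat_mulVec_le {t m : ℕ} (B : Fin m → Fin t → Fin O) (v : Fin m → ℝ) :
    v ⬝ᵥ (covMat p T B).mulVec v ≤ m * (v ⬝ᵥ v) := by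
  have hM : ∀ f b, 0 ≤ futureMat p T B f b := fun f b => condProb_nonneg p _ _
  have h1 : v ⬝ᵥ (covMat p T B).mulVec v = m * ∑ f, (futureMat p T B).mulVec v f ^ 2 *
      (totProb p (famList B) (List.ofFn f))⁻¹ := by
    simp only [dotProduct, covMat_mulVec, Finset.mul_sum]
    rw [Finset.sum_comm]
    refine Finset.sum_congr rfl fun f _ => ?_
    rw [sq, Matrix.mulVec, dotProduct]
    conv_rhs => rw [Finset.sum_mul_sum, Finset.sum_mul, Finset.mul_sum]
    refine Finset.sum_congr rfl fun b _ => ?_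
    rw [← Finset.mul_sum]
    ring
  rw [h1]
  refine mul_le_mul_of_nonneg_left ?_ (by positivity)
  have h2 : ∀ f, (futureMat p T B).mulVec v f ^ 2 * (totProb p (famList B) (List.ofFn f))⁻¹
      ≤ ∑ b, futureMat p T B f b * v b ^ 2 := by
    intro f
    have h3 : (futureMat p T B).mulVec v f ^ 2 ≤
        totProb p (famList B) (List.ofFn f) * ∑ b, futureMat p T B f b * v b ^ 2 := by
      rw [totProb_famList]
      refine Finset.sum_sq_le_sum_mul_sum_of_sq_le_mul Finset.univ
        (r := fun b => futureMat p T B f b * v b) (fun b _ => hM f b)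
        (fun b _ => mul_nonneg (hM f b) (sq_nonneg (v b))) fun b _ => le_of_eq ?_
      change _ = futureMat p T B f b * _
      ring
    have h4 : 0 ≤ ∑ b, futureMat p T B f b * v b ^ 2 :=
      Finset.sum_nonneg fun b _ => mul_nonneg (hM f b) (sq_nonneg _)
    rcases (totProb_nonneg (p := p) (famList B) (List.ofFn f)).eq_or_lt with h | h
    · rw [← h]; simpa using h4
    · rw [← div_eq_mul_inv, div_le_iff₀ h, mul_comm]; exact h3
  refine (Finset.sum_le_sum fun f _ => h2 f).trans ?_
  rw [Finset.sum_comm]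
  refine Finset.sum_le_sum fun b _ => ?_
  rw [← Finset.sum_mul, sum_futureMat, one_mul, sq]

/-- The posteriors sum to one over the family, which makes the all-ones vector an eigenvector. Its
eigenvalue `m` forces `Δ ≤ m` for robust bases. -/
theorem covMat_mulVec_one {t m : ℕ} (B : Fin m → Fin t → Fin O) :
    (covMat p T B).mulVec (fun _ => 1) = (m : ℝ) • fun _ => 1 := by
  funext b
  rw [covMat_mulVec, Pi.smul_apply, smul_eq_mul]
  congr 1
  refine Eq.trans ?_ (sum_futureMat (p := p) (T := T) B b)
  refine Finset.sum_congr rfl fun f _ => ?_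
  have h1 : (futureMat p T B).mulVec (fun _ => 1) f = totProb p (famList B) (List.ofFn f) := by
    rw [totProb_famList, Matrix.mulVec, dotProduct]
    simp [futureMat]
  rw [h1]
  rcases (totProb_nonneg (p := p) (famList B) (List.ofFn f)).eq_or_lt with h | h
  -- If the total vanishes then so does `futureMat p T B f b`, and the quotient `0 / 0 = 0` is
  -- consistent.
  · have := futureMat_le_totProb (p := p) B f b
    have h2 : 0 ≤ futureMat p T B f b := condProb_nonneg p _ _
    rw [← h] at this ⊢
    linarith
  · field_simp

/-- The matrix `covMat` divided by the size of the family. -/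
def postMat (p : SeqDist O) (T : ℕ) {t m : ℕ} (B : Fin m → Fin t → Fin O) :
    Matrix (Fin m) (Fin m) ℝ := (m : ℝ)⁻¹ • covMat p T B

/-- The normal equations for the coefficients of `x`. Their right-hand side is the expected
posterior of `b` under futures sampled after `x`, which the oracle makes accessible without
knowledge of the coefficients. -/
theorem postMat_mulVec {t m : ℕ} (B : Fin m → Fin t → Fin O) {x : Fin t → Fin O}
    {v : Fin m → ℝ} (hv : (futureMat p T B).mulVec v = futureVec p T x) (b : Fin m) :
    (postMat p T B).mulVec v b = sumF O (T - t) fun f => condProb p (List.ofFn x) f *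
      (condProb p (List.ofFn (B b)) f / totProb p (famList B) f) := by
  have hm : (m : ℝ) ≠ 0 := by
    have := Fin.pos b
    positivity
  rw [postMat, Matrix.smul_mulVec, Pi.smul_apply, covMat_mulVec, smul_eq_mul,
    inv_mul_cancel_left₀ hm, hv]
  rfl

theorem postMat_apply {t m : ℕ} (B : Fin m → Fin t → Fin O) (b' b : Fin m) :
    postMat p T B b' b = sumF O (T - t) fun f => condProb p (List.ofFn (B b)) f *
      (condProb p (List.ofFn (B b')) f / totProb p (famList B) f) := by
  have h : (futureMat p T B).mulVec (Pi.single b 1) = futureVec p T (B b) := by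
    rw [Matrix.mulVec_single_one]; rfl
  rw [← postMat_mulVec B h, Matrix.mulVec_single_one]; rfl

theorem postMat_isHermitian {t m : ℕ} (B : Fin m → Fin t → Fin O) :
    (postMat p T B).IsHermitian := by
  have h := covMat_isHermitian (p := p) (T := T) B
  rw [Matrix.IsHermitian] at h ⊢
  rw [postMat, Matrix.conjTranspose_smul, h]; simp

theorem dotProduct_postMat_mulVec_le {t m : ℕ} (B : Fin m → Fin t → Fin O) (v : Fin m → ℝ) :
    v ⬝ᵥ (postMat p T B).mulVec v ≤ v ⬝ᵥ v := by
  rcases Nat.eq_zero_or_pos m with rfl | hm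
  · simp [dotProduct]
  have hm : (0 : ℝ) < m := by exact_mod_cast hm
  rw [postMat, Matrix.smul_mulVec, dotProduct_smul, smul_eq_mul, inv_mul_le_iff₀ hm]
  exact dotProduct_covMat_mulVec_le B v

theorem le_of_hasEigenvalue_postMat {t m : ℕ} {B : Fin m → Fin t → Fin O} {Δ : ℝ} (hm : 0 < m)
    (hB : ∀ μ : ℝ, Module.End.HasEigenvalue (Matrix.toLin' (covMat p T B)) μ → μ ≠ 0 → Δ ≤ μ)
    (μ : ℝ) (h : Module.End.HasEigenvalue (Matrix.toLin' (postMat p T B)) μ) (hμ : μ ≠ 0) :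
    Δ / m ≤ μ := by
  have hm : (0 : ℝ) < m := by exact_mod_cast hm
  obtain ⟨v, hv, hv0⟩ := h.exists_hasEigenvector
  rw [Module.End.mem_eigenspace_iff, Matrix.toLin'_apply, postMat, Matrix.smul_mulVec] at hv
  rw [div_le_iff₀' hm]
  refine hB _ (Module.End.hasEigenvalue_of_hasEigenvector (x := v) ⟨?_, hv0⟩) (by positivity)
  rw [Module.End.mem_eigenspace_iff, Matrix.toLin'_apply, mul_smul, ← hv, smul_inv_smul₀ hm.ne']

theorem le_card_of_hasEigenvalue {t m : ℕ} {B : Fin m → Fin t → Fin O} {Δ : ℝ} (hm : 0 < m)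
    (hB : ∀ μ : ℝ, Module.End.HasEigenvalue (Matrix.toLin' (covMat p T B)) μ → μ ≠ 0 → Δ ≤ μ) :
    Δ ≤ m := by
  refine hB m (Module.End.hasEigenvalue_of_hasEigenvector (x := fun _ => 1) ⟨?_, ?_⟩)
    (by positivity)
  · rw [Module.End.mem_eigenspace_iff, Matrix.toLin'_apply, covMat_mulVec_one]
  · intro h
    exact one_ne_zero (congrFun h ⟨0, hm⟩)

theorem covMat_mulVec_eq_zero_iff {t m : ℕ} (B : Fin m → Fin t → Fin O) (w : Fin m → ℝ) :
    (postMat p T B).mulVec w = 0 ↔ (covMat p T B).mulVec w = 0 := by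
  rcases Nat.eq_zero_or_pos m with rfl | hm
  · exact ⟨fun _ => Subsingleton.elim _ _, fun _ => Subsingleton.elim _ _⟩
  have hm : (m : ℝ)⁻¹ ≠ 0 := by positivity
  rw [postMat, Matrix.smul_mulVec, smul_eq_zero, or_iff_right hm]

/-! ### Coefficients -/

theorem isCoeff_coeff {t m : ℕ} {B : Fin m → Fin t → Fin O} (hB : IsBasisAt p T B)
    (x : Fin t → Fin O) : IsCoeff p T B x (coeff p T B x) := by
  have h : ∃ β, IsCoeff p T B x β := (existsUnique_isCoeff p T hB x).exists
  rw [coeff, dif_pos h]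
  exact h.choose_spec

theorem eq_coeff {t m : ℕ} {B : Fin m → Fin t → Fin O} (hB : IsBasisAt p T B)
    {x : Fin t → Fin O} {β : Fin m → ℝ} (h : IsCoeff p T B x β) : β = coeff p T B x :=
  (existsUnique_isCoeff p T hB x).unique h (isCoeff_coeff hB x)

/-- This is where `c ≤ 1` enters the bias estimate: coefficients of absolute value at most one make
`Pr[f | x]` at most the sum of the `Pr[f | b]`. -/
theorem condProb_le_totProb_of_coeff {t m : ℕ} {B : Fin m → Fin t → Fin O}
    (hB : IsBasisAt p T B) {x : Fin t → Fin O} (hx : l2 (coeff p T B x) ≤ 1)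
    {f : List (Fin O)} (hf : f.length = T - t) :
    condProb p (List.ofFn x) f ≤ totProb p (famList B) f := by
  obtain ⟨g, rfl⟩ : ∃ g : Fin (T - t) → Fin O, f = List.ofFn g := by
    refine ⟨fun i => f.get (i.cast hf.symm), ?_⟩
    apply List.ext_get <;> simp [hf]
  have h := congrFun (isCoeff_coeff hB x).1 g
  rw [futureVec] at h
  rw [← h, totProb_famList]
  refine Finset.sum_le_sum (s := Finset.univ)
    (f := fun b => futureMat p T B g b * coeff p T B x b)
    (g := fun b => futureMat p T B g b) fun b _ => ?_
  exact mul_le_of_le_one_right (condProb_nonneg p _ _)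
    ((le_abs_self _).trans ((abs_le_l2 _ b).trans hx))

/-- Summing the defining equation over all futures shows that the coefficients add up to one, and
`‖·‖₁ ≤ √m ‖·‖₂`. It also yields `m > 0` and the lower bound for `c`. -/
theorem one_le_sqrt_mul_l2_coeff {t m : ℕ} {B : Fin m → Fin t → Fin O} (hB : IsBasisAt p T B)
    (x : Fin t → Fin O) : 1 ≤ √m * l2 (coeff p T B x) := by
  have h : ∑ b, coeff p T B x b = 1 := by
    have h1 : ∑ f, (futureMat p T B).mulVec (coeff p T B x) f = 1 := by
      rw [(isCoeff_coeff hB x).1]; exact sumF_condProb (T - t) (List.ofFn x)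
    simp only [Matrix.mulVec, dotProduct] at h1
    rw [Finset.sum_comm] at h1
    rw [← h1]
    refine Finset.sum_congr rfl fun b _ => ?_
    rw [← Finset.sum_mul, sum_futureMat, one_mul]
  rw [← h]
  exact (Finset.sum_le_sum fun b _ => le_abs_self _).trans (sum_abs_le _)

theorem card_pos_of_isBasisAt {t m : ℕ} {B : Fin m → Fin t → Fin O} (hB : IsBasisAt p T B)
    (x : Fin t → Fin O) : 0 < m := by
  have h := one_le_sqrt_mul_l2_coeff hB x
  rcases Nat.eq_zero_or_pos m with rfl | hm
  · simp at h; linarith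
  · exact hm

/-- The unit vector at `b` represents the column of `b` itself, so by uniqueness its projection onto
the complement of the kernel is the coefficient vector of `B b`. -/
theorem coeffMat_eq {t m : ℕ} {B : Fin m → Fin t → Fin O} (hB : IsBasisAt p T B) {k : ℕ}
    {W : Matrix (Fin m) (Fin k) ℝ} (hW : IsKerONB (covMat p T B) W) :
    coeffMat p T B = 1 - W * W.transpose := by
  have hker : ∀ y, (covMat p T B).mulVec (W.mulVec y) = 0 := by
    intro y
    have : W.mulVec y ∈ LinearMap.ker (covMat p T B).mulVecLin := by
      rw [← hW.2]; exact ⟨y, rfl⟩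
    exact this
  ext i b
  set e : Fin m → ℝ := Pi.single b 1
  have h : IsCoeff p T B (B b) (e - W.mulVec (W.transpose.mulVec e)) := by
    constructor
    · rw [Matrix.mulVec_sub, futureMat_mulVec_eq_zero p T B (hker _), sub_zero,
        Matrix.mulVec_single_one]
      rfl
    · intro w hw
      have : w ∈ LinearMap.range W.mulVecLin := by rw [hW.2]; exact hw
      obtain ⟨y, rfl⟩ := this
      rw [Matrix.mulVecLin_apply, dotProduct_sub, ← Matrix.vecMul_transpose W y,
        ← Matrix.dotProduct_mulVec, ← Matrix.dotProduct_mulVec, Matrix.mulVec_mulVec, hW.1,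
        Matrix.one_mulVec, sub_self]
  rw [coeffMat, Matrix.of_apply, ← eq_coeff hB h, Matrix.mulVec_mulVec, Pi.sub_apply,
    Matrix.mulVec_single_one, Matrix.sub_apply, Matrix.one_apply]
  simp [e, Pi.single_apply, Matrix.col]

/-- Bessel's inequality, read off from `‖u - W Wᵀ u‖² ≥ 0`. -/
theorem l2_transpose_mulVec_le {m k : ℕ} {W : Matrix (Fin m) (Fin k) ℝ}
    (hW : W.transpose * W = 1) (u : Fin m → ℝ) : l2 (W.transpose.mulVec u) ≤ l2 u := by
  have hd : ∀ {n : ℕ} (v : Fin n → ℝ), l2 v ^ 2 = v ⬝ᵥ v := fun v => by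
    rw [l2_sq]; exact Finset.sum_congr rfl fun i _ => sq _
  set y := W.transpose.mulVec u
  have h1 : W.mulVec y ⬝ᵥ W.mulVec y = y ⬝ᵥ y := by
    conv_lhs => enter [1]; rw [← Matrix.vecMul_transpose]
    rw [← Matrix.dotProduct_mulVec, Matrix.mulVec_mulVec, hW, Matrix.one_mulVec]
  have h2 : W.mulVec y ⬝ᵥ u = y ⬝ᵥ y := by
    rw [← Matrix.vecMul_transpose, ← Matrix.dotProduct_mulVec]
  have h3 : 0 ≤ (u - W.mulVec y) ⬝ᵥ (u - W.mulVec y) := by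
    rw [← hd]; positivity
  rw [sub_dotProduct, dotProduct_sub, dotProduct_sub, h1, dotProduct_comm u (W.mulVec y), h2] at h3
  refine l2_le (l2_nonneg u) ?_
  rw [hd]
  have : ∑ i, y i ^ 2 = y ⬝ᵥ y := by rw [← l2_sq, hd]
  rw [this]; linarith

theorem card_le_of_transpose_mul_self {m k : ℕ} {W : Matrix (Fin m) (Fin k) ℝ}
    (hW : W.transpose * W = 1) : k ≤ m := by
  have h := Matrix.rank_mul_le_right W.transpose W
  rw [hW, Matrix.rank_one, Fintype.card_fin] at h
  simpa using h.trans W.rank_le_card_height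

/-- For `u = E v` take `α = u` and `αperp = Wᵀ u`; then `(1 - W Wᵀ) u + W Wᵀ u = u`. One factor `√n`
is lost in passing from columns to `u`, another from `ℓ²` to `ℓ¹`, and together they consume the `1
/ n` in the column bound. -/
theorem exists_decomposition {t m m' n : ℕ} {B : Fin m' → Fin t → Fin O} (hB : IsBasisAt p T B)
    (hm : m ≤ n) (hm' : m' ≤ n) {ε : ℝ} (hε : 0 ≤ ε) {E : Matrix (Fin m') (Fin m) ℝ}
    (hE : ∀ a, l2 (fun i => E i a) ≤ ε / n) {k : ℕ} {W : Matrix (Fin m') (Fin k) ℝ}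
    (hW : IsKerONB (covMat p T B) W) (v : Fin m → ℝ) :
    ∃ (α : Fin m' → ℝ) (αperp : Fin k → ℝ),
      E.mulVec v = (coeffMat p T B).mulVec α + W.mulVec αperp ∧
      ∑ i, |α i| ≤ ε * ‖WithLp.toLp 2 v‖ ∧ ∑ i, |αperp i| ≤ ε * ‖WithLp.toLp 2 v‖ := by
  set u := E.mulVec v
  have hv := l2_nonneg v
  have hu : l2 u ≤ √n * l2 v * (ε / n) := by
    have h1 : u = ∑ a, v a • fun i => E i a := by
      funext i
      simp [u, Matrix.mulVec, dotProduct, mul_comm]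
    have h2 : ∀ s : Finset (Fin m), l2 (∑ a ∈ s, v a • fun i => E i a) ≤
        ∑ a ∈ s, |v a| * (ε / n) := by
      intro s
      refine Finset.le_sum_of_subadditive _ l2_zero.le l2_add_le _ _ |>.trans ?_
      refine Finset.sum_le_sum fun a _ => ?_
      rw [l2_smul]
      exact mul_le_mul_of_nonneg_left (hE a) (abs_nonneg _)
    rw [h1]
    refine (h2 _).trans ?_
    rw [← Finset.sum_mul]
    refine mul_le_mul_of_nonneg_right ((sum_abs_le v).trans ?_) (by positivity)
    exact mul_le_mul_of_nonneg_right (Real.sqrt_le_sqrt (by exact_mod_cast hm)) hv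
  have hfin : ∀ {j : ℕ} (y : Fin j → ℝ), j ≤ n → l2 y ≤ l2 u →
      ∑ i, |y i| ≤ ε * ‖WithLp.toLp 2 v‖ := by
    intro j y hj hy
    refine (sum_abs_le y).trans ?_
    have h1 : √(j : ℝ) ≤ √n := Real.sqrt_le_sqrt (by exact_mod_cast hj)
    refine (mul_le_mul h1 (hy.trans hu) (l2_nonneg _) (Real.sqrt_nonneg _)).trans ?_
    have h2 : √(n : ℝ) * √n = n := Real.mul_self_sqrt (by positivity)
    calc √(n : ℝ) * (√n * l2 v * (ε / n)) = (√(n : ℝ) * √n) * (ε / n) * l2 v := by ring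
      _ = n * (ε / n) * l2 v := by rw [h2]
      _ ≤ ε * l2 v := mul_le_mul_of_nonneg_right (by
          rcases Nat.eq_zero_or_pos n with rfl | hn
          · simpa using hε
          · rw [mul_div_cancel₀]; positivity) hv
  refine ⟨u, W.transpose.mulVec u, ?_, hfin u hm' le_rfl,
    hfin _ ((card_le_of_transpose_mul_self hW.1).trans hm') (l2_transpose_mulVec_le hW.1 u)⟩
  rw [coeffMat_eq hB hW, Matrix.sub_mulVec, Matrix.one_mulVec,
    Matrix.mulVec_mulVec u W W.transpose, sub_add_cancel]

theorem ofFn_snoc {t : ℕ} (x : Fin t → Fin O) (o : Fin O) :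
    List.ofFn (Fin.snoc (α := fun _ => Fin O) x o) = List.ofFn x ++ [o] := by
  rw [List.ofFn_succ']
  simp

/-! ### Nondegeneracy -/

/-- The row of the empty future consists of ones, so the matrix at length `1` is not zero. The rank
serves only as a factor at least one in the sample bound. -/
theorem rank_pos_of_hasRank {r : ℕ} (hT : 1 ≤ T) (h : HasRank p T r) : 1 ≤ r := by
  by_contra hr
  have h1 := h 1 le_rfl hT
  set M := Matrix.of fun (f : Σ k : Fin (T - 1 + 1), Fin k → Fin O) (h : Fin 1 → Fin O) =>
      condProb p (List.ofFn h) (List.ofFn f.2) with hM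
  obtain ⟨o, -⟩ := (p []).support_nonempty
  have h2 : M.rank = 0 := by omega
  have h3 : M.mulVecLin = 0 := by
    rw [Matrix.rank, Submodule.finrank_eq_zero] at h2
    exact LinearMap.range_eq_bot.1 h2
  have h4 := congrFun (LinearMap.congr_fun h3 (Pi.single (fun _ => o) 1)) ⟨0, Fin.elim0⟩
  rw [Matrix.mulVecLin_apply, Matrix.mulVec_single_one] at h4
  simp [hM, Matrix.col, condProb] at h4

end

end CondSampling

namespace CondSampling

noncomputable section

variable {O : ℕ} {p : SeqDist O} {T : ℕ}

/-! ### Accuracy of the estimated operators -/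

theorem finSupp_opD (N S J : ℕ) (Bl Bl' : List (List ℕ)) (o : ℕ) :
    FinSupp (opD p T N S J Bl Bl' o) :=
  (finSupp_matD _ _ _ _ _).bind fun _ _ => (finSupp_matD _ _ _ _ _).map _

/-- The two estimated matrices are entrywise `σ`-close to `postMat` and to the right-hand side whose
exact solution is `opMat`; the perturbed iteration then bounds the error column by column. The
failure probability collects at most `2 n²` entries with two tails each. -/
theorem HP_opD {N S J t m m' n : ℕ} {Δ ε c σ γ : ℝ} (B : Fin m → Fin t → Fin O)
    (B' : Fin m' → Fin (t + 1) → Fin O) (o : Fin O) (ht : t + 1 ≤ T) (hB' : IsBasisAt p T B')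
    (hgap : ∀ μ : ℝ, Module.End.HasEigenvalue (Matrix.toLin' (covMat p T B')) μ → μ ≠ 0 → Δ ≤ μ)
    (hΔ : 0 < Δ) (hc : c ≤ 1) (hcoeff : ∀ x, l2 (coeff p T B' x) ≤ c) (hm : m ≤ n) (hm' : m' ≤ n)
    (hN : 0 < N) (hS : 0 < S) (hγ : 0 < γ) (hNγ : (O : ℝ) ≤ N * γ ^ 2) (hσ : 0 < σ) (hσ1 : σ ≤ 1)
    (hbias : ((n : ℝ) + 1) * (T * γ) ≤ σ / 2) (hJ : ((J + 1 : ℕ) : ℝ) * (4 * n * σ) ≤ 1)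
    (herr : (1 - Δ / n) ^ (J + 1) * c + ((J + 1 : ℕ) : ℝ) * (4 * n * σ * c) ≤ ε / n) :
    HP (opD p T N S J ((famList B).map code) ((famList B').map code) o)
      (fun L => ∃ X : Matrix (Fin m') (Fin m) ℝ, L = toRows X ∧
        ∀ a, l2 (fun i => (X - opMat p T B B' o) i a) ≤ ε / n)
      (4 * (n * n) * Real.exp (-(S * σ ^ 2 / 16))) := by
  have hm0 : 0 < m' := card_pos_of_isBasisAt hB' fun _ => o
  have hmR : (0 : ℝ) < m' := by exact_mod_cast hm0
  have hmn : (m' : ℝ) ≤ n := by exact_mod_cast hm'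
  have hmn' : (m : ℝ) ≤ n := by exact_mod_cast hm
  have hc0 : 0 ≤ c := (l2_nonneg _).trans (hcoeff fun _ => o)
  have hb' : ((m' : ℝ) + 1) * (((T - (t + 1) : ℕ) : ℝ) * γ) ≤ σ / 2 := by
    refine le_trans ?_ hbias
    have : ((T - (t + 1) : ℕ) : ℝ) ≤ T := by exact_mod_cast Nat.sub_le _ _
    gcongr
  have hQ := HP_matD (p := p) (T := T) (k := T - (t + 1)) hN hS hγ hNγ hσ hσ1 (by omega) B' B' hb'
    [] (W := fun b f => condProb p (List.ofFn (B' b)) f) (fun b f => condProb_nonneg p f _)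
    (fun b f _ => condProb_le_totProb (by rw [famList, List.mem_ofFn]; exact ⟨b, rfl⟩) f)
    (fun b => (sumF_condProb _ _).le)
    (fun b b' => by
      rw [ex_entryD_nil N _ _ (x := List.ofFn (B' b)) (by simpa using ht)]
      simp)
  -- The weight `Pr[o f | b]` is at most `Pr[f | b o]`, and the history `b o` has coefficients
  -- bounded by `c ≤ 1`.
  have hR := HP_matD (p := p) (T := T) (k := T - (t + 1)) hN hS hγ hNγ hσ hσ1 (by omega) B B' hb'
    [(o : ℕ)]
    (W := fun b f => (p (List.ofFn (B b)) o).toReal * condProb p (List.ofFn (B b) ++ [o]) f)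
    (fun b f => mul_nonneg ENNReal.toReal_nonneg (condProb_nonneg p f _))
    (fun b f hf => by
      refine (mul_le_of_le_one_left (condProb_nonneg p f _) ?_).trans ?_
      · exact ENNReal.toReal_mono ENNReal.one_ne_top (PMF.coe_le_one _ _)
      · rw [← ofFn_snoc]
        exact condProb_le_totProb_of_coeff hB' ((hcoeff _).trans hc) hf)
    (fun b => by
      rw [sumF_mul_left, sumF_condProb, mul_one]
      exact ENNReal.toReal_mono ENNReal.one_ne_top (PMF.coe_le_one _ _))
    (fun b b' => ex_entryD_single N _ _ o (by simp; omega))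
  set e := Real.exp (-(S * σ ^ 2 / 16))
  have he : 0 ≤ e := (Real.exp_pos _).le
  refine HP.mono (finSupp_opD _ _ _ _ _ _) (HP.bind (finSupp_matD _ _ _ _ _)
    (fun _ _ => (finSupp_matD _ _ _ _ _).map _) hQ (by positivity)
    (η' := m' * (m * (2 * e))) fun L _ hL => ?_) (fun _ _ h => h) ?_
  swap
  · have h1 : (m' : ℝ) * (m' * (2 * e)) ≤ n * (n * (2 * e)) := by gcongr
    have h2 : (m' : ℝ) * (m * (2 * e)) ≤ n * (n * (2 * e)) := by gcongr
    linarith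
  obtain ⟨Q', rfl, hQ'⟩ := hL
  refine HP.map (finSupp_matD _ _ _ _ _) (hR.mono (finSupp_matD _ _ _ _ _) ?_ le_rfl)
  rintro _ _ ⟨R', rfl, hR'⟩
  refine ⟨_, lwRows_toRows Q' R' J, fun a => ?_⟩
  have hd : Δ / n ≤ Δ / m' := by gcongr
  have hΔm := le_card_of_hasEigenvalue hm0 hgap
  have hnpos : (0 : ℝ) < n := hmR.trans_le hmn
  set x : Fin m' → ℝ := fun i => opMat p T B B' o i a with hxdef
  have hx : x = (p (List.ofFn (B a)) o).toReal • coeff p T B' (Fin.snoc (α := fun _ => Fin O) (B a) o) := by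
    funext i
    simp [hxdef, opMat, mul_comm]
  have hco := isCoeff_coeff hB' (Fin.snoc (α := fun _ => Fin O) (B a) o)
  have hp1 : (p (List.ofFn (B a)) o).toReal ≤ 1 :=
    ENNReal.toReal_mono ENNReal.one_ne_top (PMF.coe_le_one _ _)
  have key := l2_landweber_sub_le (Q := postMat p T B') (Q' := Q')
    (R := Matrix.of fun b' b => sumF O (T - (t + 1)) fun f => (p (List.ofFn (B b)) o).toReal *
      condProb p (List.ofFn (B b) ++ [o]) f * (condProb p (List.ofFn (B' b')) f /
        totProb p (famList B') f)) (R' := R') (d := Δ / n) (σ := σ) (c := c)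
    (postMat_isHermitian B') (dotProduct_postMat_mulVec_le B') (by positivity)
    ((div_le_one hnpos).2 (hΔm.trans hmn))
    (fun μ h1 h2 => hd.trans (le_of_hasEigenvalue_postMat hm0 hgap μ h1 h2)) hσ.le
    ((one_le_sqrt_mul_l2_coeff hB' fun _ => o).trans
      (mul_le_mul_of_nonneg_left (hcoeff _) (Real.sqrt_nonneg _)))
    (fun i j => by rw [postMat_apply]; exact hQ' i j) (fun i j => hR' i j) a (x := x)
    -- The normal equations for `b o`, scaled by `Pr[o | b]`, say that the exact column solves the
    -- system.
    (by
      funext b'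
      rw [hx, Matrix.mulVec_smul, Pi.smul_apply, postMat_mulVec B' hco.1, smul_eq_mul,
        ← sumF_mul_left, ofFn_snoc, Matrix.of_apply]
      exact sumF_congr fun f _ => by ring)
    (fun w hw => by
      rw [hx, dotProduct_smul, hco.2 w ((covMat_mulVec_eq_zero_iff B' w).1 hw), smul_zero])
    (by
      rw [hx, l2_smul, abs_of_nonneg ENNReal.toReal_nonneg]
      exact (mul_le_of_le_one_left (l2_nonneg _) hp1).trans (hcoeff _))
    -- The estimate holds with the actual family size `m'`, which is bounded by `n` here and in the
    -- final comparison.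
    (J + 1) (le_trans (by gcongr) hJ)
  refine key.trans (le_trans ?_ herr)
  gcongr

theorem zip_tail_encodeBases {m : ℕ → ℕ} (B : (t : ℕ) → Fin (m t) → Fin t → Fin O) :
    (encodeBases T B).zip (encodeBases T B).tail = List.ofFn fun t : Fin T =>
      ((famList (B t)).map code, (famList (B (t + 1))).map code) := by
  have e : encodeBases T B = (List.range (T + 1)).map fun t => (famList (B t)).map code := by
    simp [encodeBases, famList, code, List.map_ofFn, Function.comp_def]
  rw [e]
  apply List.ext_getElem
  · simp
  · intro i h1 h2
    simp only [List.getElem_zip, List.getElem_map, List.getElem_tail, List.getElem_ofFn]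
    exact Prod.ext (congrArg (fun t => (famList (B t)).map code) (List.getElem_range _))
      (congrArg (fun t => (famList (B t)).map code) (List.getElem_range _))

theorem goodOutput_ofFn {n : ℕ} {ε Δ : ℝ} {m : ℕ → ℕ} {B : (t : ℕ) → Fin (m t) → Fin t → Fin O}
    (hε : 0 ≤ ε) (hm : ∀ t, t ≤ T → m t ≤ n) (hB : RobustBases p T B Δ)
    {z : Fin T → Fin O → List (List ℝ)}
    (h : ∀ (t : Fin T) (o : Fin O), ∃ X : Matrix (Fin (m (t + 1))) (Fin (m t)) ℝ, z t o = toRows X ∧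
      ∀ a, l2 (fun i => (X - opMat p T (B t) (B (t + 1)) o) i a) ≤ ε / n) :
    GoodOutput p T ε B (List.ofFn fun t => List.ofFn (z t)) := by
  intro o t ht k W hW v
  obtain ⟨X, hX, hX'⟩ := h ⟨t, ht⟩ o
  have e : readOp (List.ofFn fun t => List.ofFn (z t)) t o (m (t + 1)) (m t) = X := by
    ext i j
    have e1 : (List.ofFn fun t => List.ofFn (z t)).getD t [] = List.ofFn (z ⟨t, ht⟩) := by
      simp [List.getD_eq_getElem?_getD, ht]
    have e2 : (List.ofFn (z ⟨t, ht⟩)).getD o [] = toRows X := by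
      rw [← hX]; simp [List.getD_eq_getElem?_getD]
    rw [readOp, Matrix.of_apply, e1, e2]
    exact getD_toRows X i j
  rw [e]
  exact exists_decomposition (hB (t + 1) (by omega) ht).1 (hm t ht.le) (hm (t + 1) ht) hε hX' hW v

theorem HP.mapD_mapD_ofFn {α β γ : Type*} {κ : α → β → PMF γ} (hκ : ∀ x y, FinSupp (κ x y))
    {η : ℝ} (hη : 0 ≤ η) {m n : ℕ} {g : Fin m → α} {g' : Fin n → β}
    {G : Fin m → Fin n → γ → Prop} (h : ∀ i j, HP (κ (g i) (g' j)) (G i j) η) :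
    HP (CondSampling.mapD (fun x => CondSampling.mapD (κ x) (List.ofFn g')) (List.ofFn g))
      (fun ys => ∃ z : Fin m → Fin n → γ, ys = List.ofFn (fun i => List.ofFn (z i)) ∧
        ∀ i j, G i j (z i j)) (m * (n * η)) := by
  have hf : ∀ x, FinSupp (CondSampling.mapD (κ x) (List.ofFn g')) := fun x =>
    finSupp_mapD (hκ x) _
  refine (HP.mapD_ofFn hf (by positivity) fun i =>
    HP.mapD_ofFn (hκ (g i)) hη (h i)).mono (finSupp_mapD hf _) ?_ le_rfl
  rintro _ _ ⟨y, rfl, hy⟩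
  choose z hz hz' using hy
  exact ⟨z, by rw [funext hz], hz'⟩

theorem finSupp_learnerD (n : ℕ) (Δ ε δ c : ℝ) (l : List (List (List ℕ))) :
    FinSupp (learnerD p T n Δ ε δ c l) :=
  finSupp_mapD (fun _ => finSupp_mapD (fun _ => finSupp_opD _ _ _ _ _ _) _) _

theorem HP_learnerD {n : ℕ} {Δ ε δ c : ℝ} {m : ℕ → ℕ} (B : (t : ℕ) → Fin (m t) → Fin t → Fin O)
    {η : ℝ} (hη : 0 ≤ η) (hε : 0 ≤ ε) (hm : ∀ t, t ≤ T → m t ≤ n) (hB : RobustBases p T B Δ)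
    (h : ∀ (t : Fin T) (o : Fin O), HP (opD p T (numN O T n Δ ε c) (numS O T n Δ ε δ c)
        (numIter n Δ ε) ((famList (B t)).map code) ((famList (B (t + 1))).map code) o)
      (fun L => ∃ X : Matrix (Fin (m (t + 1))) (Fin (m t)) ℝ, L = toRows X ∧
        ∀ a, l2 (fun i => (X - opMat p T (B t) (B (t + 1)) o) i a) ≤ ε / n) η) :
    HP (learnerD p T n Δ ε δ c (encodeBases T B)) (GoodOutput p T ε B) (T * (O * η)) := by
  have hr : List.range O = List.ofFn fun o : Fin O => (o : ℕ) := by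
    apply List.ext_getElem <;> simp
  rw [learnerD, zip_tail_encodeBases, hr]
  have h1 := HP.mapD_mapD_ofFn (κ := fun z : List (List ℕ) × List (List ℕ) =>
    opD p T (numN O T n Δ ε c) (numS O T n Δ ε δ c) (numIter n Δ ε) z.1 z.2)
    (g := fun t : Fin T => ((famList (B t)).map code, (famList (B (t + 1))).map code))
    (g' := fun o : Fin O => (o : ℕ))
    (G := fun t o L => ∃ X : Matrix (Fin (m (t + 1))) (Fin (m t)) ℝ, L = toRows X ∧
        ∀ a, l2 (fun i => (X - opMat p T (B t) (B (t + 1)) o) i a) ≤ ε / n)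
    (fun _ _ => finSupp_opD _ _ _ _ _ _) hη h
  refine h1.mono (finSupp_mapD (fun _ => finSupp_mapD (fun _ => finSupp_opD _ _ _ _ _ _) _) _) ?_ le_rfl
  rintro _ _ ⟨z, rfl, hz⟩
  exact goodOutput_ofFn hε hm hB hz

end

end CondSampling

/-! ### Numerical choice of the parameters. -/

namespace CondSampling

noncomputable section

variable {O T n : ℕ} {Δ ε δ c : ℝ}

/-! ### The parameters of the learner -/

theorem le_two_pow_numHalf (hn : 1 ≤ n) (hε : 0 < ε) : 2 * n / ε ≤ 2 ^ numHalf n ε := by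
  have hn : (1 : ℝ) ≤ n := by exact_mod_cast hn
  have h := Nat.le_ceil (Real.logb 2 (2 * n / ε))
  rw [Real.logb_le_iff_le_rpow one_lt_two (by positivity), Real.rpow_natCast] at h
  exact h

theorem one_le_numHalf (hn : 1 ≤ n) (hε : 0 < ε) (hε1 : ε < 1) : 1 ≤ numHalf n ε := by
  have hn : (1 : ℝ) ≤ n := by exact_mod_cast hn
  refine Nat.ceil_pos.2 (Real.logb_pos one_lt_two ?_)
  rw [one_lt_div hε]; linarith

theorem le_two_pow_numLog (hn : 1 ≤ n) (hT : 1 ≤ T) (hO : 1 ≤ O) (hδ : 0 < δ) :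
    4 * (T * (O * (n * n))) / δ ≤ 2 ^ numLog O T n δ := by
  have h := Nat.le_ceil (Real.logb 2 (4 * (T * (O * (n * n))) / δ))
  rw [Real.logb_le_iff_le_rpow one_lt_two (by positivity), Real.rpow_natCast] at h
  exact h

theorem one_le_numLog (hn : 1 ≤ n) (hT : 1 ≤ T) (hO : 1 ≤ O) (hδ : 0 < δ) (hδ1 : δ < 1) :
    1 ≤ numLog O T n δ := by
  refine Nat.ceil_pos.2 (Real.logb_pos one_lt_two ?_)
  rw [one_lt_div hδ]
  have : (1 : ℝ) ≤ (T * (O * (n * n)) : ℕ) := by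
    exact_mod_cast Nat.one_le_iff_ne_zero.2 (by positivity)
  push_cast at this
  linarith

theorem le_numIter : n * numHalf n ε / Δ ≤ numIter n Δ ε := Nat.le_ceil _

theorem one_le_ratio (hn : 1 ≤ n) (hΔ : 0 < Δ) (hΔn : Δ ≤ n) (hε : 0 < ε) (hε1 : ε < 1) :
    1 ≤ n * numHalf n ε / Δ := by
  have h1 : (1 : ℝ) ≤ numHalf n ε := by exact_mod_cast one_le_numHalf hn hε hε1
  rw [one_le_div hΔ]
  nlinarith

theorem one_le_numIter (hn : 1 ≤ n) (hΔ : 0 < Δ) (hΔn : Δ ≤ n) (hε : 0 < ε) (hε1 : ε < 1) :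
    1 ≤ numIter n Δ ε := by
  exact_mod_cast (one_le_ratio hn hΔ hΔn hε hε1).trans le_numIter

theorem one_le_mul_of_one_le_sqrt_mul (hn : 1 ≤ n) (hc : 1 ≤ √n * c) : 0 < c ∧ 1 ≤ n * c := by
  have h0 : 0 < c := by
    by_contra h
    nlinarith [Real.sqrt_nonneg (n : ℝ)]
  refine ⟨h0, hc.trans (mul_le_mul_of_nonneg_right ?_ h0.le)⟩
  rw [Real.sqrt_le_left (by positivity)]
  have : (1 : ℝ) ≤ n := by exact_mod_cast hn
  nlinarith

theorem acc_pos (hn : 1 ≤ n) (hΔ : 0 < Δ) (hΔn : Δ ≤ n) (hε : 0 < ε) (hε1 : ε < 1)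
    (hc : 0 < c) : 0 < acc n Δ ε c := by
  have := one_le_numIter hn hΔ hΔn hε hε1
  rw [acc]; positivity

theorem acc_mul (hn : 1 ≤ n) (hΔ : 0 < Δ) (hΔn : Δ ≤ n) (hε : 0 < ε) (hε1 : ε < 1)
    (hc : 0 < c) : acc n Δ ε c * (16 * (numIter n Δ ε * (n * (n * c)))) = ε := by
  have := one_le_numIter hn hΔ hΔn hε hε1
  rw [acc, div_mul_cancel₀]; positivity

theorem acc_le_one (hn : 1 ≤ n) (hΔ : 0 < Δ) (hΔn : Δ ≤ n) (hε : 0 < ε) (hε1 : ε < 1)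
    (hc : 1 ≤ √n * c) : acc n Δ ε c ≤ 1 := by
  obtain ⟨h0, h1⟩ := one_le_mul_of_one_le_sqrt_mul hn hc
  have hJ : (1 : ℝ) ≤ numIter n Δ ε := by exact_mod_cast one_le_numIter hn hΔ hΔn hε hε1
  have hn : (1 : ℝ) ≤ n := by exact_mod_cast hn
  have h2 : (1 : ℝ) ≤ numIter n Δ ε * (n * (n * c)) :=
    one_le_mul_of_one_le_of_one_le hJ (one_le_mul_of_one_le_of_one_le hn h1)
  rw [acc, div_le_one (by linarith)]
  linarith

/-- The constant `16` in `acc` is `2 · 4 · 2`: one factor two from `numIter + 1 ≤ 2 * numIter`, the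
four from the perturbation per step, and one to stay within half of the error budget `ε / n`. -/
theorem numIter_mul_acc (hn : 1 ≤ n) (hΔ : 0 < Δ) (hΔn : Δ ≤ n) (hε : 0 < ε) (hε1 : ε < 1)
    (hc : 0 < c) :
    ((numIter n Δ ε + 1 : ℕ) : ℝ) * (4 * n * acc n Δ ε c * c) ≤ ε / (2 * n) := by
  have hJ : (1 : ℝ) ≤ numIter n Δ ε := by exact_mod_cast one_le_numIter hn hΔ hΔn hε hε1
  have h := acc_mul (c := c) hn hΔ hΔn hε hε1 hc
  have hσ := acc_pos (c := c) hn hΔ hΔn hε hε1 hc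
  have hn : (1 : ℝ) ≤ n := by exact_mod_cast hn
  rw [le_div_iff₀ (by positivity)]
  push_cast
  have h2 : (numIter n Δ ε : ℝ) + 1 ≤ 2 * numIter n Δ ε := by linarith
  calc ((numIter n Δ ε : ℝ) + 1) * (4 * n * acc n Δ ε c * c) * (2 * n)
      ≤ (2 * numIter n Δ ε) * (4 * n * acc n Δ ε c * c) * (2 * n) := by gcongr
    _ = acc n Δ ε c * (16 * (numIter n Δ ε * (n * (n * c)))) := by ring
    _ ≤ ε := h.le

theorem numIter_mul_acc_le_one (hn : 1 ≤ n) (hΔ : 0 < Δ) (hΔn : Δ ≤ n) (hε : 0 < ε)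
    (hε1 : ε < 1) (hc : 1 ≤ √n * c) :
    ((numIter n Δ ε + 1 : ℕ) : ℝ) * (4 * n * acc n Δ ε c) ≤ 1 := by
  obtain ⟨h0, h1⟩ := one_le_mul_of_one_le_sqrt_mul hn hc
  have h := numIter_mul_acc (c := c) hn hΔ hΔn hε hε1 h0
  have hσ := acc_pos (c := c) hn hΔ hΔn hε hε1 h0
  have hn : (1 : ℝ) ≤ n := by exact_mod_cast hn
  rw [le_div_iff₀ (by positivity)] at h
  set a : ℝ := ((numIter n Δ ε + 1 : ℕ) : ℝ) * (4 * n * acc n Δ ε c) with ha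
  have ha0 : 0 ≤ a := by positivity
  have h2 : a * (2 * (n * c)) ≤ 1 := by
    refine le_trans (le_of_eq ?_) (h.trans hε1.le)
    rw [ha]; ring
  nlinarith

/-- Parameters are computed with binary logarithms while the estimates use the natural exponential;
`2 ≤ e` is all that is lost. -/
theorem two_pow_neg_le {k : ℕ} {x : ℝ} (hx : (k : ℝ) ≤ x) {a : ℝ} (ha : 0 < a)
    (h : a ≤ 2 ^ k) : Real.exp (-x) ≤ 1 / a := by
  have h1 : (2 : ℝ) ^ k ≤ Real.exp k := by
    rw [← Real.exp_one_pow]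
    exact pow_le_pow_left₀ (by norm_num) (by linarith [Real.add_one_le_exp (1 : ℝ)]) k
  rw [Real.exp_neg, ← one_div]
  exact one_div_le_one_div_of_le ha (h.trans (h1.trans (Real.exp_le_exp.2 hx)))

/-- Half of `ε / n` is for the accumulated perturbations. The other half is for the contraction: `(1
- Δ/n) ^ J ≤ exp (-J Δ / n)`, and `J ≥ n * numHalf / Δ` makes this at most `ε / (2 n)`. -/
theorem landweber_error_le (hn : 1 ≤ n) (hΔ : 0 < Δ) (hΔn : Δ ≤ n) (hε : 0 < ε) (hε1 : ε < 1)
    (hc : 0 < c) (hc1 : c ≤ 1) :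
    (1 - Δ / n) ^ (numIter n Δ ε + 1) * c +
      ((numIter n Δ ε + 1 : ℕ) : ℝ) * (4 * n * acc n Δ ε c * c) ≤ ε / n := by
  have h1 := numIter_mul_acc (c := c) hn hΔ hΔn hε hε1 hc
  have hpow := le_two_pow_numHalf hn hε
  have hnR : (0 : ℝ) < n := by exact_mod_cast hn
  have hx : Δ / n ≤ 1 := (div_le_one hnR).2 hΔn
  have h2 : (1 - Δ / n) ^ (numIter n Δ ε + 1) ≤ ε / (2 * n) := by
    have h3 : (1 - Δ / n) ≤ Real.exp (-(Δ / n)) := by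
      have := Real.add_one_le_exp (-(Δ / n)); linarith
    have h4 : (1 - Δ / n) ^ (numIter n Δ ε + 1) ≤ (1 - Δ / n) ^ numIter n Δ ε :=
      pow_le_pow_of_le_one (by linarith) (by have : 0 ≤ Δ / n := by positivity
                                             linarith) (Nat.le_succ _)
    refine h4.trans ((pow_le_pow_left₀ (by linarith) h3 _).trans ?_)
    rw [← Real.exp_nat_mul, mul_neg]
    refine (two_pow_neg_le (k := numHalf n ε) ?_ (by positivity) hpow).trans (le_of_eq ?_)
    · have h5 := le_numIter (n := n) (Δ := Δ) (ε := ε)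
      rw [div_le_iff₀ hΔ] at h5
      rw [← mul_div_assoc, le_div_iff₀ hnR]
      linarith
    · rw [one_div_div]
  have h5 : (1 - Δ / n) ^ (numIter n Δ ε + 1) * c ≤ ε / (2 * n) :=
    (mul_le_of_le_one_right (pow_nonneg (by linarith) _) hc1).trans h2
  have h6 : ε / (2 * n) + ε / (2 * n) = ε / n := by field_simp; ring
  linarith

/-- `numS` makes the Chernoff exponent at least `numLog`, and `2 ^ numLog` dominates `4 T O n² / δ`.
-/
theorem failure_le (hn : 1 ≤ n) (hT : 1 ≤ T) (hO : 1 ≤ O) (hδ : 0 < δ)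
    (hσ : 0 < acc n Δ ε c) :
    T * (O * (4 * (n * n) * Real.exp (-(numS O T n Δ ε δ c * acc n Δ ε c ^ 2 / 16)))) ≤ δ := by
  have h := Nat.le_ceil (16 * numLog O T n δ / (acc n Δ ε c * acc n Δ ε c))
  rw [← numS, div_le_iff₀ (by positivity)] at h
  have h1 := two_pow_neg_le (k := numLog O T n δ)
    (x := numS O T n Δ ε δ c * acc n Δ ε c ^ 2 / 16) (by rw [sq]; linarith) (by positivity)
    (le_two_pow_numLog hn hT hO hδ)
  rw [one_div_div, le_div_iff₀ (by positivity)] at h1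
  refine le_trans (le_of_eq ?_) h1
  ring

theorem le_numN_mul (hn : 1 ≤ n) (hT : 1 ≤ T) (hσ : 0 < acc n Δ ε c) :
    (O : ℝ) ≤ numN O T n Δ ε c * (acc n Δ ε c / (4 * n * T)) ^ 2 := by
  have h := Nat.le_ceil (16 * ((n * n) * ((T * T) * O)) / (acc n Δ ε c * acc n Δ ε c))
  rw [← numN, div_le_iff₀ (by positivity)] at h
  rw [div_pow, ← mul_div_assoc, le_div_iff₀ (by positivity)]
  refine le_trans (le_of_eq ?_) (h.trans (le_of_eq ?_)) <;> ring

theorem one_le_numS (hn : 1 ≤ n) (hT : 1 ≤ T) (hO : 1 ≤ O) (hδ : 0 < δ) (hδ1 : δ < 1)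
    (hσ : 0 < acc n Δ ε c) : 1 ≤ numS O T n Δ ε δ c := by
  have := one_le_numLog hn hT hO hδ hδ1
  exact Nat.ceil_pos.2 (by positivity)

theorem one_le_numN (hn : 1 ≤ n) (hT : 1 ≤ T) (hO : 1 ≤ O) (hσ : 0 < acc n Δ ε c) :
    1 ≤ numN O T n Δ ε c := Nat.ceil_pos.2 (by positivity)

theorem HP_goodOutput {p : SeqDist O} {m : ℕ → ℕ} (B : (t : ℕ) → Fin (m t) → Fin t → Fin O)
    (hn : 1 ≤ n) (hT : 1 ≤ T) (hO : 1 ≤ O) (hΔ : 0 < Δ) (hΔn : Δ ≤ n) (hε : 0 < ε) (hε1 : ε < 1)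
    (hδ : 0 < δ) (hδ1 : δ < 1) (hc : 1 ≤ √n * c) (hc1 : c ≤ 1)
    (hm : ∀ t, t ≤ T → m t ≤ n) (hB : RobustBases p T B Δ)
    (hcoeff : ∀ t, 1 ≤ t → t ≤ T → ∀ x, l2 (coeff p T (B t) x) ≤ c) :
    HP (learnerD p T n Δ ε δ c (encodeBases T B)) (GoodOutput p T ε B) δ := by
  obtain ⟨h0, -⟩ := one_le_mul_of_one_le_sqrt_mul hn hc
  have hσ := acc_pos (c := c) hn hΔ hΔn hε hε1 h0
  refine (HP_learnerD B (η := 4 * (n * n) *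
    Real.exp (-(numS O T n Δ ε δ c * acc n Δ ε c ^ 2 / 16))) (by positivity) hε.le hm hB
    fun t o => ?_).mono (finSupp_learnerD _ _ _ _ _ _)
    (fun _ _ h => h) (failure_le hn hT hO hδ hσ)
  have ht : (t : ℕ) + 1 ≤ T := t.2
  obtain ⟨h1, h2⟩ := hB (t + 1) (by omega) ht
  have hnR : (1 : ℝ) ≤ n := by exact_mod_cast hn
  have hTR : (1 : ℝ) ≤ T := by exact_mod_cast hT
  -- With this `γ` the bias `(n + 1) T γ ≤ 2 n T γ` is at most half of `acc`.
  refine HP_opD (γ := acc n Δ ε c / (4 * n * T)) (B t) (B (t + 1)) o ht h1 h2 hΔ hc1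
    (hcoeff (t + 1) (by omega) ht) (hm t (by omega)) (hm (t + 1) ht) (one_le_numN hn hT hO hσ)
    (one_le_numS hn hT hO hδ hδ1 hσ) (by positivity) (le_numN_mul hn hT hσ) hσ
    (acc_le_one hn hΔ hΔn hε hε1 hc) ?_ (numIter_mul_acc_le_one hn hΔ hΔn hε hε1 hc)
    (landweber_error_le hn hΔ hΔn hε hε1 h0 hc1)
  calc ((n : ℝ) + 1) * (T * (acc n Δ ε c / (4 * n * T)))
      ≤ (n + n) * (T * (acc n Δ ε c / (4 * n * T))) := by gcongr
    _ = acc n Δ ε c / 2 := by field_simp; ring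

end

end CondSampling

namespace CondSampling

noncomputable section

variable {O T n : ℕ} {Δ ε δ c : ℝ}

/-! ### Polynomial bounds for the running time -/

/-- Pads lower-order terms to a common power of `K`, so that each time bound becomes a single
monomial. -/
theorem le_mul_pow_of_one_le {K : ℕ} (hK : 1 ≤ K) (a i : ℕ) : a ≤ a * K ^ i :=
  Nat.le_mul_of_pos_right _ (Nat.pow_pos hK)

theorem mul_pow_le_mul_pow {K : ℕ} (hK : 1 ≤ K) (a : ℕ) {i j : ℕ} (h : i ≤ j) :
    a * K ^ i ≤ a * K ^ j := Nat.mul_le_mul_left _ (Nat.pow_le_pow_right hK h)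

section Time

variable {K N S J : ℕ}

theorem stepTime_le (hK : 1 ≤ K) (hn : n ≤ K) : stepTime n ≤ 14000 * K ^ 3 :=
  calc stepTime n ≤ (K + K) * ((K + 2 * K) * ((K + K) * 1000) + 1000 * K ^ 2) := by
        unfold stepTime
        gcongr
        · omega
        · exact le_mul_pow_of_one_le hK _ _
    _ = _ := by ring

theorem lwTime_le (hK : 1 ≤ K) (hn : n ≤ K) (hJ : J ≤ K) : lwTime J n ≤ 28400 * K ^ 4 :=
  calc lwTime J n ≤ (K + K) * (14000 * K ^ 3 + 200 * K ^ 3) := by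
        unfold lwTime
        gcongr
        · exact stepTime_le hK hn
        · exact le_mul_pow_of_one_le hK _ _
    _ = _ := by ring

theorem futTime_le (hK : 1 ≤ K) (hT : T ≤ K) (hN : N ≤ K) : futTime T N ≤ 2680 * K ^ 3 :=
  calc futTime T N ≤ (K + K) * ((K + K) * (70 * K + 400 * K) + 400 * K ^ 2) := by
        unfold futTime
        gcongr
        · omega
        · exact le_mul_pow_of_one_le hK _ _
    _ = _ := by ring

theorem postTime_le (hK : 1 ≤ K) (hn : n ≤ K) (hT : T ≤ K) (hN : N ≤ K) :
    postTime T N n ≤ 8640 * K ^ 4 :=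
  calc postTime T N n ≤ (K + 2 * K) * (2680 * K ^ 3 + 200 * K ^ 3) := by
        unfold postTime
        gcongr
        · omega
        · exact futTime_le hK hT hN
        · exact le_mul_pow_of_one_le hK _ _
    _ = _ := by ring

theorem entryTime_le (hK : 1 ≤ K) (hn : n ≤ K) (hT : T ≤ K) (hN : N ≤ K) :
    entryTime T N n ≤ 8841 * K ^ 4 :=
  calc entryTime T N n ≤ 8640 * K ^ 4 + 1 * K ^ 4 + 200 * K ^ 4 := by
        unfold entryTime
        gcongr
        · exact postTime_le hK hn hT hN
        · exact hT.trans ((by simp : K ≤ 1 * K ^ 1).trans (mul_pow_le_mul_pow hK 1 (by norm_num)))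
        · exact le_mul_pow_of_one_le hK _ _
    _ = _ := by ring

theorem matTime_le (hK : 1 ≤ K) (hn : n ≤ K) (hT : T ≤ K) (hN : N ≤ K) (hS : S ≤ K) :
    matTime T N S n ≤ 73728 * K ^ 7 :=
  calc matTime T N S n
      ≤ (K + K) * ((K + K) * ((K + K) * (8841 * K ^ 4 + 150 * K ^ 4) + 300 * K ^ 5)
          + 300 * K ^ 6) := by
        unfold matTime
        gcongr
        · exact entryTime_le hK hn hT hN
        all_goals exact le_mul_pow_of_one_le hK _ _
    _ = _ := by ring

theorem opTime_le (hK : 1 ≤ K) (hn : n ≤ K) (hT : T ≤ K) (hN : N ≤ K) (hS : S ≤ K) (hJ : J ≤ K) :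
    opTime T N S J n ≤ 175956 * K ^ 7 :=
  calc opTime T N S J n ≤ 2 * (73728 * K ^ 7) + 28400 * K ^ 7 + 100 * K ^ 7 := by
        unfold opTime
        gcongr
        · exact matTime_le hK hn hT hN hS
        · exact (lwTime_le hK hn hJ).trans (mul_pow_le_mul_pow hK _ (by norm_num))
        · exact le_mul_pow_of_one_le hK _ _
    _ = _ := by ring

theorem levelTime_le (hK : 1 ≤ K) (hO : O ≤ K) (hn : n ≤ K) (hT : T ≤ K) (hN : N ≤ K)
    (hS : S ≤ K) (hJ : J ≤ K) : levelTime O T N S J n ≤ 352512 * K ^ 8 :=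
  calc levelTime O T N S J n ≤ (K + K) * (175956 * K ^ 7 + 300 * K ^ 7) := by
        unfold levelTime
        gcongr
        · exact opTime_le hK hn hT hN hS hJ
        · exact le_mul_pow_of_one_le hK _ _
    _ = _ := by ring

theorem learnerTime_le (hK : 1 ≤ K) (hO : O ≤ K) (hn : n ≤ K) (hT : T ≤ K)
    (hN : numN O T n Δ ε c ≤ K) (hS : numS O T n Δ ε δ c ≤ K) (hJ : numIter n Δ ε ≤ K)
    (h1 : numHalf n ε ≤ K) (h2 : numLog O T n δ ≤ K) :
    learnerTime O T n Δ ε δ c ≤ 1419968 * K ^ 9 :=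
  calc learnerTime O T n Δ ε δ c
      ≤ (K + 3 * K) * (352512 * K ^ 8 + 1480 * K ^ 8 + 1000 * K ^ 8) := by
        have hp : paramTime O T n Δ ε δ c ≤ 1480 * K ^ 1 := by
          rw [pow_one]
          unfold paramTime
          omega
        unfold learnerTime
        gcongr
        · omega
        · exact levelTime_le hK hO hn hT hN hS hJ
        · exact hp.trans (mul_pow_le_mul_pow hK _ (by norm_num))
        · exact le_mul_pow_of_one_le hK _ _
    _ = _ := by ring

end Time

/-! ### Bounds for the parameters -/

/-- Because `log 2 > 1/2`. -/
theorem logb_two_le {x : ℝ} (hx : 1 ≤ x) : Real.logb 2 x ≤ 2 * Real.log x := by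
  have h := Real.log_two_gt_d9
  rw [Real.logb, div_le_iff₀ (by linarith)]
  nlinarith [Real.log_nonneg hx]

theorem numHalf_le (hn : 1 ≤ n) (hε : 0 < ε) (hε1 : ε < 1) :
    (numHalf n ε : ℝ) ≤ 2 * Real.log (2 * n / ε) + 1 := by
  have hn : (1 : ℝ) ≤ n := by exact_mod_cast hn
  have h1 : 1 ≤ 2 * n / ε := by rw [one_le_div hε]; linarith
  have h := Nat.ceil_lt_add_one (Real.logb_nonneg one_lt_two h1)
  rw [← numHalf] at h
  linarith [logb_two_le h1]

theorem numLog_le (hn : 1 ≤ n) (hT : 1 ≤ T) (hO : 1 ≤ O) (hδ : 0 < δ) (hδ1 : δ < 1) :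
    (numLog O T n δ : ℝ) ≤ 2 * (Real.log (4 * (T * (O * (n * n)))) + Real.log (1 / δ)) + 1 := by
  have h0 : (1 : ℝ) ≤ (T * (O * (n * n)) : ℕ) := by
    exact_mod_cast Nat.one_le_iff_ne_zero.2 (by positivity)
  push_cast at h0
  have h1 : 1 ≤ 4 * (T * (O * (n * n))) / δ := by rw [one_le_div hδ]; linarith
  have h := Nat.ceil_lt_add_one (Real.logb_nonneg one_lt_two h1)
  rw [← numLog] at h
  rw [← Real.log_mul (by linarith) (by positivity), mul_one_div]
  linarith [logb_two_le h1]

theorem numIter_le (hn : 1 ≤ n) (hΔ : 0 < Δ) (hΔn : Δ ≤ n) (hε : 0 < ε) (hε1 : ε < 1) :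
    (numIter n Δ ε : ℝ) ≤ 2 * (n * numHalf n ε / Δ) := by
  have h0 := one_le_ratio hn hΔ hΔn hε hε1
  have h := Nat.ceil_lt_add_one (zero_le_one.trans h0)
  rw [← numIter] at h
  linarith

/-- Inserting `numIter ≤ 2 n numHalf / Δ` into the definition of `acc` gives `Δ ε ≤ 32 n³ numHalf c
acc`, which is then squared. -/
theorem inv_acc_sq_le (hn : 1 ≤ n) (hΔ : 0 < Δ) (hΔn : Δ ≤ n) (hε : 0 < ε) (hε1 : ε < 1)
    (hc : 0 < c) : 1 / (acc n Δ ε c * acc n Δ ε c) ≤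
      1024 * n ^ 6 * numHalf n ε ^ 2 * c ^ 2 / (Δ ^ 2 * ε ^ 2) := by
  have h := acc_mul (c := c) hn hΔ hΔn hε hε1 hc
  have hσ := acc_pos (c := c) hn hΔ hΔn hε hε1 hc
  have hJ := numIter_le hn hΔ hΔn hε hε1
  rw [div_le_div_iff₀ (by positivity) (by positivity), one_mul]
  set σ := acc n Δ ε c
  have h2 : ε ≤ σ * (16 * (2 * (n * numHalf n ε / Δ) * (n * (n * c)))) := by
    refine h.ge.trans ?_
    gcongr
  have h3 : Δ * ε ≤ 32 * n ^ 3 * numHalf n ε * c * σ := by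
    have := mul_le_mul_of_nonneg_left h2 hΔ.le
    refine this.trans (le_of_eq ?_)
    field_simp
    ring
  have h4 := pow_le_pow_left₀ (by positivity) h3 2
  refine le_trans (le_of_eq (by ring)) (h4.trans (le_of_eq ?_))
  ring

theorem ceil_le_seventeen_mul {x : ℝ} (hx : 1 ≤ x) : (⌈16 * x⌉₊ : ℝ) ≤ 17 * x := by
  have := Nat.ceil_lt_add_one (show 0 ≤ 16 * x by linarith)
  linarith

theorem numS_le (hn : 1 ≤ n) (hT : 1 ≤ T) (hO : 1 ≤ O) (hδ : 0 < δ) (hδ1 : δ < 1)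
    (hσ : 0 < acc n Δ ε c) (hσ1 : acc n Δ ε c ≤ 1) :
    (numS O T n Δ ε δ c : ℝ) ≤ 17 * (numLog O T n δ * (1 / (acc n Δ ε c * acc n Δ ε c))) := by
  have h1 : (1 : ℝ) ≤ numLog O T n δ := by exact_mod_cast one_le_numLog hn hT hO hδ hδ1
  rw [numS, mul_div_assoc, ← mul_one_div (numLog O T n δ : ℝ)]
  refine ceil_le_seventeen_mul (one_le_mul_of_one_le_of_one_le h1 ?_)
  rw [one_le_div (by positivity)]
  exact mul_le_one₀ hσ1 hσ.le hσ1

theorem numN_le (hn : 1 ≤ n) (hT : 1 ≤ T) (hO : 1 ≤ O)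
    (hσ : 0 < acc n Δ ε c) (hσ1 : acc n Δ ε c ≤ 1) :
    (numN O T n Δ ε c : ℝ) ≤
      17 * (((n * n) * ((T * T) * O)) * (1 / (acc n Δ ε c * acc n Δ ε c))) := by
  have h0 : (1 : ℝ) ≤ ((n * n) * ((T * T) * O) : ℕ) := by
    exact_mod_cast Nat.one_le_iff_ne_zero.2 (by positivity)
  push_cast at h0
  rw [numN, mul_div_assoc, ← mul_one_div ((n * n : ℝ) * ((T * T) * O))]
  refine ceil_le_seventeen_mul (one_le_mul_of_one_le_of_one_le h0 ?_)
  rw [one_le_div (by positivity)]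
  exact mul_le_one₀ hσ1 hσ.le hσ1

/-- All parameters are at most `2 ^ 23 * Y ^ 19`, the worst being the number `N` of samples per
conditional probability. The running time is of degree nine in their maximum with a constant below
`2 ^ 21`, so the exponents are `171 = 9 · 19` and `228 = 21 + 9 · 23`. -/
theorem learnerTime_le_pow {Y : ℝ} (hn : 1 ≤ n) (hT : 1 ≤ T) (hO : 1 ≤ O) (hΔ : 0 < Δ)
    (hΔn : Δ ≤ n) (hε : 0 < ε) (hε1 : ε < 1) (hδ : 0 < δ) (hδ1 : δ < 1) (hc : 1 ≤ √n * c)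
    (hc1 : c ≤ 1) (hnY : n ≤ Y) (hTY : T ≤ Y) (hOY : O ≤ Y) (hεY : 1 / ε ≤ Y) (hΔY : 1 / Δ ≤ Y)
    (hδY : Real.log (1 / δ) ≤ Y) :
    (learnerTime O T n Δ ε δ c : ℝ) ≤ 2 ^ 228 * Y ^ 171 := by
  obtain ⟨h0, -⟩ := one_le_mul_of_one_le_sqrt_mul hn hc
  have hσ := acc_pos (c := c) hn hΔ hΔn hε hε1 h0
  have hσ1 := acc_le_one hn hΔ hΔn hε hε1 hc
  have hY : 1 ≤ Y := le_trans (by exact_mod_cast hn) hnY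
  have hpow : ∀ i ≤ 19, Y ^ i ≤ Y ^ 19 := fun i hi => pow_le_pow_right₀ hY hi
  have hYi : ∀ i, 1 ≤ Y ^ i := fun i => one_le_pow₀ hY
  have h1 : (numHalf n ε : ℝ) ≤ 5 * Y ^ 2 := by
    refine (numHalf_le hn hε hε1).trans ?_
    have h := Real.log_le_self (show 0 ≤ 2 * n / ε by positivity)
    have h' : 2 * n / ε ≤ 2 * (Y * Y) := by
      rw [mul_div_assoc, ← mul_one_div]; gcongr
    nlinarith [hYi 2]
  have h2 : (numLog O T n δ : ℝ) ≤ 11 * Y ^ 4 := by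
    refine (numLog_le hn hT hO hδ hδ1).trans ?_
    have h := Real.log_le_self (show (0 : ℝ) ≤ 4 * (T * (O * (n * n))) by positivity)
    have h' : (4 * (T * (O * (n * n))) : ℝ) ≤ 4 * (Y * (Y * (Y * Y))) := by gcongr
    have h3 : Y ≤ Y ^ 4 := le_self_pow₀ hY (by norm_num)
    have h4 := hYi 4
    have h5 : Y * (Y * (Y * Y)) = Y ^ 4 := by ring
    linarith
  have h3 : (numIter n Δ ε : ℝ) ≤ 10 * Y ^ 4 := by
    refine (numIter_le hn hΔ hΔn hε hε1).trans ?_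
    rw [← mul_one_div]
    calc 2 * ((n : ℝ) * numHalf n ε * (1 / Δ)) ≤ 2 * (Y * (5 * Y ^ 2) * Y) := by gcongr
      _ = _ := by ring
  have h4 : 1 / (acc n Δ ε c * acc n Δ ε c) ≤ 25600 * Y ^ 14 := by
    refine (inv_acc_sq_le hn hΔ hΔn hε hε1 h0).trans ?_
    calc 1024 * (n : ℝ) ^ 6 * numHalf n ε ^ 2 * c ^ 2 / (Δ ^ 2 * ε ^ 2)
        = 1024 * (n : ℝ) ^ 6 * numHalf n ε ^ 2 * c ^ 2 * ((1 / Δ) ^ 2 * (1 / ε) ^ 2) := by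
          field_simp
      _ ≤ 1024 * Y ^ 6 * (5 * Y ^ 2) ^ 2 * 1 ^ 2 * (Y ^ 2 * Y ^ 2) := by gcongr
      _ = _ := by ring
  have h5 : (numS O T n Δ ε δ c : ℝ) ≤ 2 ^ 23 * Y ^ 18 := by
    refine (numS_le hn hT hO hδ hδ1 hσ hσ1).trans ?_
    calc 17 * ((numLog O T n δ : ℝ) * (1 / (acc n Δ ε c * acc n Δ ε c)))
        ≤ 17 * (11 * Y ^ 4 * (25600 * Y ^ 14)) := by gcongr
      _ = 4787200 * Y ^ 18 := by ring
      _ ≤ _ := by gcongr; norm_num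
  have h6 : (numN O T n Δ ε c : ℝ) ≤ 2 ^ 23 * Y ^ 19 := by
    refine (numN_le hn hT hO hσ hσ1).trans ?_
    calc 17 * (((n : ℝ) * n * (T * T * O)) * (1 / (acc n Δ ε c * acc n Δ ε c)))
        ≤ 17 * ((Y * Y * (Y * Y * Y)) * (25600 * Y ^ 14)) := by gcongr
      _ = 435200 * Y ^ 19 := by ring
      _ ≤ _ := by gcongr; norm_num
  have hle : ∀ (x : ℕ) (a : ℝ) (i : ℕ), (x : ℝ) ≤ a * Y ^ i → 0 ≤ a → a ≤ 2 ^ 23 → i ≤ 19 →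
      x ≤ ⌊2 ^ 23 * Y ^ 19⌋₊ := by
    intro x a i hx ha ha' hi
    refine Nat.le_floor (hx.trans ?_)
    have := hpow i hi
    gcongr
  have key := learnerTime_le (O := O) (T := T) (n := n) (Δ := Δ) (ε := ε) (δ := δ) (c := c)
    (K := ⌊2 ^ 23 * Y ^ 19⌋₊)
    (hle 1 1 0 (by norm_num) (by norm_num) (by norm_num) (by norm_num))
    (hle O 1 1 (by simpa using hOY) (by norm_num) (by norm_num) (by norm_num))
    (hle n 1 1 (by simpa using hnY) (by norm_num) (by norm_num) (by norm_num))
    (hle T 1 1 (by simpa using hTY) (by norm_num) (by norm_num) (by norm_num))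
    (hle _ _ _ h6 (by norm_num) (by norm_num) (by norm_num))
    (hle _ _ _ h5 (by norm_num) (by norm_num) (by norm_num))
    (hle _ _ _ h3 (by norm_num) (by norm_num) (by norm_num))
    (hle _ _ _ h1 (by norm_num) (by norm_num) (by norm_num))
    (hle _ _ _ h2 (by norm_num) (by norm_num) (by norm_num))
  calc (learnerTime O T n Δ ε δ c : ℝ) ≤ 1419968 * (⌊2 ^ 23 * Y ^ 19⌋₊ : ℝ) ^ 9 := by
        exact_mod_cast key
    _ ≤ 2 ^ 21 * (2 ^ 23 * Y ^ 19) ^ 9 := by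
        gcongr
        · norm_num
        · exact Nat.floor_le (by positivity)
    _ = _ := by ring

theorem opSamples_le {N S : ℕ} (hn : 1 ≤ n) (hT : 1 ≤ T) (hN : 1 ≤ N) :
    opSamples T N S n ≤ 6 * n ^ 3 * T * S * N :=
  calc opSamples T N S n ≤ 2 * (n * (n * (S * ((n + n) * (T * N) + n * (T * N))))) := by
        unfold opSamples
        gcongr
        exact Nat.one_le_iff_ne_zero.2 (by positivity)
    _ = _ := by ring

/-- The product of the parameters is of order `T⁴ O² n⁵ / acc⁴`, where `1 / acc²` is of order `n⁶ c²
/ (Δ² ε²)` up to logarithms. This is better than claimed; the missing powers are supplied by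
quantities that are at least one. -/
theorem samples_le {r : ℕ} {Y : ℝ} (hn : 1 ≤ n) (hT : 1 ≤ T) (hO : 1 ≤ O) (hr : 1 ≤ r)
    (hΔ : 0 < Δ) (hΔn : Δ ≤ n) (hε : 0 < ε) (hε1 : ε < 1) (hδ : 0 < δ) (hδ1 : δ < 1)
    (hc : 1 ≤ √n * c) (hnY : n ≤ Y) (hTY : T ≤ Y) (hOY : O ≤ Y) (hεY : 1 / ε ≤ Y) :
    ((T * (O * opSamples T (numN O T n Δ ε c) (numS O T n Δ ε δ c) n) : ℕ) : ℝ) ≤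
      2 ^ 228 * (c ^ 8 * r ^ 3 * n ^ 21 * O ^ 3 * T ^ 5 / (Δ ^ 6 * ε ^ 6)
        * (1 + Real.log (1 / δ)) ^ 2) * Real.log (2 + Y) ^ 171 := by
  obtain ⟨h0, -⟩ := one_le_mul_of_one_le_sqrt_mul hn hc
  have hσ := acc_pos (c := c) hn hΔ hΔn hε hε1 h0
  have hσ1 := acc_le_one hn hΔ hΔn hε hε1 hc
  have hY : 1 ≤ Y := le_trans (by exact_mod_cast hn) hnY
  have hnR : (1 : ℝ) ≤ n := by exact_mod_cast hn
  have hTR : (1 : ℝ) ≤ T := by exact_mod_cast hT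
  have hOR : (1 : ℝ) ≤ O := by exact_mod_cast hO
  have hrR : (1 : ℝ) ≤ r := by exact_mod_cast hr
  set L := Real.log (2 + Y) with hL
  set lam := Real.log (1 / δ) with hlam
  have hlam0 : 0 ≤ lam := Real.log_nonneg (by rw [one_le_div hδ]; exact hδ1.le)
  have hL1 : 1 ≤ L := by
    rw [hL, Real.le_log_iff_exp_le (by linarith)]
    linarith [Real.exp_one_lt_d9]
  have hlog : ∀ (x : ℝ) (i : ℕ), 0 < x → x ≤ (2 + Y) ^ i → Real.log x ≤ i * L := by
    intro x i hx h
    rw [hL, ← Real.log_pow]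
    exact Real.log_le_log hx h
  have h1 : (numHalf n ε : ℝ) ≤ 7 * L := by
    refine (numHalf_le hn hε hε1).trans ?_
    have h := hlog (2 * n / ε) 3 (by positivity) (by
      rw [mul_div_assoc, ← mul_one_div]
      calc 2 * (n * (1 / ε)) ≤ (2 + Y) * ((2 + Y) * (2 + Y)) := by
            gcongr <;> linarith
        _ = _ := by ring)
    push_cast at h
    linarith
  have h2 : (numLog O T n δ : ℝ) ≤ 15 * L * (1 + lam) ^ 2 := by
    refine (numLog_le hn hT hO hδ hδ1).trans ?_
    have h := hlog (4 * (T * (O * (n * n)))) 6 (by positivity) (by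
      calc (4 * (T * (O * (n * n))) : ℝ)
          ≤ ((2 + Y) * (2 + Y)) * ((2 + Y) * ((2 + Y) * ((2 + Y) * (2 + Y)))) := by
            gcongr
            · nlinarith
            all_goals linarith
        _ = _ := by ring)
    push_cast at h
    have h3 : 1 + lam ≤ (1 + lam) ^ 2 := by nlinarith
    have h4 : L * (1 + lam) ≤ L * (1 + lam) ^ 2 := mul_le_mul_of_nonneg_left h3 (by linarith)
    nlinarith
  set s : ℝ := 1 / (acc n Δ ε c * acc n Δ ε c) with hs
  have hs0 : 0 ≤ s := by positivity
  have h3 : s ≤ 2 ^ 16 * L ^ 2 * (n ^ 6 * c ^ 2 / (Δ ^ 2 * ε ^ 2)) := by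
    refine (inv_acc_sq_le hn hΔ hΔn hε hε1 h0).trans ?_
    calc 1024 * (n : ℝ) ^ 6 * numHalf n ε ^ 2 * c ^ 2 / (Δ ^ 2 * ε ^ 2)
        ≤ 1024 * (n : ℝ) ^ 6 * (7 * L) ^ 2 * c ^ 2 / (Δ ^ 2 * ε ^ 2) := by gcongr
      _ = 50176 * L ^ 2 * (n ^ 6 * c ^ 2 / (Δ ^ 2 * ε ^ 2)) := by ring
      _ ≤ _ := by gcongr; norm_num
  have h4 := numS_le (O := O) (T := T) (δ := δ) hn hT hO hδ hδ1 hσ hσ1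
  have h5 := numN_le (O := O) (T := T) hn hT hO hσ hσ1
  have h6 : ((opSamples T (numN O T n Δ ε c) (numS O T n Δ ε δ c) n : ℕ) : ℝ) ≤
      6 * n ^ 3 * T * numS O T n Δ ε δ c * numN O T n Δ ε c := by
    exact_mod_cast opSamples_le hn hT (one_le_numN hn hT hO hσ)
  -- The slack factors: this is the fourth power of `√n c ≥ 1`, and the next two come from `Δ ≤ n`
  -- and `ε < 1`. They raise the powers of `c`, `n`, `1/Δ` and `1/ε` to the stated ones.
  have hn2 : 1 ≤ (c ^ 4 * n ^ 2 : ℝ) := by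
    have h7 := one_le_pow₀ (n := 4) hc
    have h8 : (√(n : ℝ) * c) ^ 4 = c ^ 4 * (√(n : ℝ) ^ 2) ^ 2 := by ring
    rwa [h8, Real.sq_sqrt (by positivity)] at h7
  have hΔ2 : 1 ≤ (n ^ 2 / Δ ^ 2 : ℝ) := by
    rw [← div_pow]
    exact one_le_pow₀ ((one_le_div hΔ).2 hΔn)
  have hε2 : 1 ≤ 1 / ε ^ 2 := by
    rw [one_le_div (by positivity)]
    exact pow_le_one₀ hε.le hε1.le
  push_cast
  calc (T : ℝ) * (O * (opSamples T (numN O T n Δ ε c) (numS O T n Δ ε δ c) n : ℕ))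
      ≤ T * (O * (6 * n ^ 3 * T * (17 * (15 * L * (1 + lam) ^ 2 * s)) *
          (17 * (((n * n) * ((T * T) * O)) * s)))) := by
        refine mul_le_mul_of_nonneg_left (mul_le_mul_of_nonneg_left (h6.trans ?_)
          (by positivity)) (by positivity)
        have h8 : (numS O T n Δ ε δ c : ℝ) ≤ 17 * (15 * L * (1 + lam) ^ 2 * s) :=
          h4.trans (by gcongr)
        gcongr
    _ = 26010 * (T ^ 4 * O ^ 2 * n ^ 5) * (L * (1 + lam) ^ 2) * s ^ 2 := by ring
    _ ≤ 26010 * (T ^ 4 * O ^ 2 * n ^ 5) * (L * (1 + lam) ^ 2) *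
          (2 ^ 16 * L ^ 2 * (n ^ 6 * c ^ 2 / (Δ ^ 2 * ε ^ 2))) ^ 2 := by gcongr
    -- The ones are placeholders, to be replaced factor by factor in the next line.
    _ = 26010 * 2 ^ 32 * (1 * (T ^ 4 * 1) * (O ^ 2 * 1) * (c ^ 4 * n ^ 17 / (Δ ^ 4 * ε ^ 4))
          * (1 * 1 * 1) * (1 + lam) ^ 2) * L ^ 5 := by
        field_simp
    _ ≤ 2 ^ 228 * (r ^ 3 * (T ^ 4 * T) * (O ^ 2 * O) * (c ^ 4 * n ^ 17 / (Δ ^ 4 * ε ^ 4))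
          * ((c ^ 4 * n ^ 2) * (n ^ 2 / Δ ^ 2) * (1 / ε ^ 2)) * (1 + lam) ^ 2) * L ^ 171 := by
        have h9 : (1 : ℝ) ≤ r ^ 3 := one_le_pow₀ hrR
        have h10 : L ^ 5 ≤ L ^ 171 := pow_le_pow_right₀ hL1 (by norm_num)
        gcongr
        norm_num
    _ = _ := by
        field_simp

end

end CondSampling

/-! ### Assembly of the theorem. -/

theorem mainTheorem5 :
    ∃ (learner : CondSampling.Prog CondSampling.inputTy CondSampling.outputTy)
      (C : ℝ) (k : ℕ), ∀ (O T r n : ℕ) (p : CondSampling.SeqDist O) (m : ℕ → ℕ)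
      (B : (t : ℕ) → Fin (m t) → Fin t → Fin O) (Δ ε δ c : ℝ),
      1 ≤ T →
      CondSampling.HasRank p T r →
      (∀ t, t ≤ T → m t ≤ n) →
      0 < Δ → CondSampling.RobustBases p T B Δ →
      c ≤ 1 →
      (∀ t, 1 ≤ t → t ≤ T → ∀ x : Fin t → Fin O,
        ‖WithLp.toLp 2 (CondSampling.coeff p T (B t) x)‖ ≤ c) →
      0 < ε → ε < 1 → 0 < δ → δ < 1 →
      ∃ fuel : ℕ,
        (∀ res ∈ (learner.run p T fuel
            (CondSampling.encodeInput T r n Δ ε δ c B)).support,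
          ∃ (out : List (List (List (List ℝ)))) (time samples : ℕ),
            res = some (out, time, samples) ∧
            (time : ℝ) ≤ C * (r + O + T + n + 1 / ε + 1 / Δ + Real.log (1 / δ)) ^ k ∧
            (samples : ℝ) ≤
              C * (c ^ 8 * r ^ 3 * n ^ 21 * O ^ 3 * T ^ 5 / (Δ ^ 6 * ε ^ 6)
                * (1 + Real.log (1 / δ)) ^ 2)
                * Real.log (2 + r + O + T + n + 1 / ε + 1 / Δ + Real.log (1 / δ)) ^ k) ∧
        ENNReal.ofReal (1 - δ) ≤
          (learner.run p T fuel (CondSampling.encodeInput T r n Δ ε δ c B)).toOuterMeasure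
            {res | ∃ (out : List (List (List (List ℝ)))) (time samples : ℕ),
              res = some (out, time, samples) ∧ CondSampling.GoodOutput p T ε B out} := by
  -- The constants are dictated by the time bound; the sample bound would allow smaller ones.
  refine ⟨CondSampling.learner, 2 ^ 228, 171, ?_⟩
  intro O T r n p m B Δ ε δ c hT hrank hm hΔ hB hc1 hcoeff hε hε1 hδ hδ1
  -- A probability distribution on `Fin O` exists, so `O` is positive. The inequalities `1 ≤ n`, `Δ
  -- ≤ n` and `1 ≤ √n c` are then read off from the basis at length one.
  obtain ⟨o, -⟩ := (p []).support_nonempty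
  have hO : 1 ≤ O := Fin.pos o
  have hr := CondSampling.rank_pos_of_hasRank hT hrank
  obtain ⟨hB1, hB2⟩ := hB 1 le_rfl hT
  have hm1 := CondSampling.card_pos_of_isBasisAt hB1 fun _ => o
  have hn : 1 ≤ n := hm1.trans_le (hm 1 hT)
  have hmn : (m 1 : ℝ) ≤ n := by exact_mod_cast hm 1 hT
  have hΔn : Δ ≤ n := (CondSampling.le_card_of_hasEigenvalue hm1 hB2).trans hmn
  have hc : 1 ≤ √n * c :=
    (CondSampling.one_le_sqrt_mul_l2_coeff hB1 fun _ => o).trans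
      (mul_le_mul (Real.sqrt_le_sqrt hmn) (hcoeff 1 le_rfl hT _) (norm_nonneg _)
        (Real.sqrt_nonneg _))
  have hrun := CondSampling.Runs.learner (p := p) (T := T) (r := r) (n := n) (Δ := Δ) (ε := ε)
    (δ := δ) (c := c) (l := CondSampling.encodeBases T B) hn hε hδ hT hO
    (by simp [CondSampling.encodeBases])
    (by
      intro z hz
      rw [CondSampling.zip_tail_encodeBases, List.mem_ofFn] at hz
      obtain ⟨t, rfl⟩ := hz
      refine ⟨t, t.2, ?_, ?_, ?_, ?_⟩
      · intro x hx
        simp only [CondSampling.famList, CondSampling.code, List.mem_map, List.mem_ofFn] at hx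
        obtain ⟨_, ⟨b, rfl⟩, rfl⟩ := hx
        simp
      · intro x hx
        simp only [CondSampling.famList, CondSampling.code, List.mem_map, List.mem_ofFn] at hx
        obtain ⟨_, ⟨b, rfl⟩, rfl⟩ := hx
        simp
      · simpa [CondSampling.famList] using hm t t.2.le
      · simpa [CondSampling.famList] using hm (t + 1) t.2)
  -- With fuel equal to the time bound the run never exhausts it: `ν` is the joint law of output,
  -- time and samples, and its first marginal is `learnerD`.
  obtain ⟨ν, h1, h2, h3⟩ := hrun _ le_rfl
  have hgood := (CondSampling.HP_goodOutput B hn hT hO hΔ hΔn hε hε1 hδ hδ1 hc hc1 hm hB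
    hcoeff).le_toOuterMeasure (CondSampling.finSupp_learnerD _ _ _ _ _ _)
  have hlog : 0 ≤ Real.log (1 / δ) := Real.log_nonneg (by rw [one_le_div hδ]; exact hδ1.le)
  have hε0 : 0 ≤ 1 / ε := by positivity
  have hΔ0 : 0 ≤ 1 / Δ := by positivity
  have hr0 : (0 : ℝ) ≤ r := by positivity
  have hO0 : (0 : ℝ) ≤ O := by positivity
  have hT0 : (0 : ℝ) ≤ T := by positivity
  have hn0 : (0 : ℝ) ≤ n := by positivity
  set Y : ℝ := r + O + T + n + 1 / ε + 1 / Δ + Real.log (1 / δ) with hY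
  have hY2 : 2 + r + O + T + n + 1 / ε + 1 / Δ + Real.log (1 / δ) = 2 + Y := by rw [hY]; ring
  refine ⟨CondSampling.learnerTime O T n Δ ε δ c, ?_, ?_⟩
  · intro res hres
    rw [CondSampling.encodeInput, h1, PMF.support_map] at hres
    obtain ⟨⟨out, time, samples⟩, hy, rfl⟩ := hres
    obtain ⟨ht, hs⟩ := h3 _ hy
    refine ⟨out, time, samples, rfl, ?_, ?_⟩
    · exact le_trans (by exact_mod_cast ht) (CondSampling.learnerTime_le_pow hn hT hO hΔ hΔn hε hε1
        hδ hδ1 hc hc1 (by linarith) (by linarith) (by linarith) (by linarith) (by linarith)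
        (by linarith))
    · rw [hY2]
      exact le_trans (by exact_mod_cast hs) (CondSampling.samples_le hn hT hO hr hΔ hΔn hε hε1
        hδ hδ1 hc (by linarith) (by linarith) (by linarith) (by linarith))
  · refine hgood.trans ?_
    -- Both events are pulled back to `ν`, where the good outputs are contained in the event of the
    -- theorem.
    rw [CondSampling.encodeInput, h1, ← h2, PMF.toOuterMeasure_map_apply,
      PMF.toOuterMeasure_map_apply]
    refine MeasureTheory.OuterMeasure.mono _ ?_
    rintro ⟨out, time, samples⟩ hy
    exact ⟨out, time, samples, rfl, hy⟩
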